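/- \textbf{Setting.} $D(p)$ is the open unit disc centred at $p\in\mathbb R^2$. A valid configuration of $n$ points is a set of $n$ points with pairwise distances at least $2$. An instance $(S,T,M)$ consists of two valid configurations $S,T$ of $n\ge 1$ points each and a bijection $M:S\to T$; we write $D(S)=\bigcup_{s\in S}D(s)$, and a pair $A=(A^S,A^T)\in M$ has $A^T=M(A^S)$. A translation $v\in\mathbb R^2$ is \emph{valid} if the pairs of $M$ can be ordered as $(s_1,M(s_1)),\dots,(s_n,M(s_n))$ so that, for each $i$, the open unit disc moving along the straight segment from $s_i$ to $M(s_i)+v$ never meets a disc $D(s_j)$ with $j>i$ or a disc $D(M(s_j)+v)$ with $j<i$. Let $Q$ be the set of all valid translations. For $p,q\in\mathbb R^2$ let $H(p,q)$ be the convex hull of $D(p)\cup D(q)$. For $A\ne B$ in $M$, the two vippodromes of $(A,B)$ are $\{v: D(A^S)\cap H(B^S,B^T+v)\neq\emptyset\}$ and $\{v: D(B^T+v)\cap H(A^S,A^T+v)\ne\emptyset\}$; the boundary $\gamma$ of each is a curve homeomorphic to a line. $\mathcal D_Q$ consists, for each of the $2n(n-1)$ vippodrome boundaries $\gamma$, of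 a binary search tree whose nodes hold the maximal arcs (connected components) of $\gamma\cap Q$, ordered along $\gamma$ and each given by its endpoints; the tree is balanced, that is, a tree with $m$ nodes has height at most $c\lfloor\log_2(m+1)\rfloor$, where $c$ is a fixed constant. Let $\varphi(v)$ be the area of the axis-aligned bounding rectangle of $D(S)\cup D(T+v)$. The model of computation is a real RAM: exact arithmetic, comparisons, square roots and extraction of real roots of polynomials of degree at most $4$ on reals, and addition, subtraction, comparison and indirect addressing on non-negative integers, each at unit cost. \textbf{Theorem.} (1) There is one real-RAM program that, whenever its memory holds an instance $(S,T,M)$ of any size $n\geq 1$ together with $\mathcal D_Q$, halts after $O(n^2\log (n+1))$ steps, the implied constant depending only on $c$, and outputs a valid translation $v$ that minimizes $\varphi(v)$ over all valid translations, or reports that no valid translation exists if $Q=\emptyset$. (2) For every instance with $n\geq 1$, let $[a_S,b_S]\times[c_S,d_S]$ and $[a_T,b_T]\times[c_T,d_T]$ be the axis-aligned bounding rectangles of $D(S)$ and $D(T)$. The two vertical lines $x=a_S-a_T$, $x=b_S-b_T$ and the two horizontal lines $y=c_S-c_T$, $y=d_S-d_T$ (which may coincide) divide the plane into nine closed rectangular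 regions, indexed from left to right by $i\in\{-1,0,1\}$ and from bottom to top by $j\in\{-1,0,1\}$, and there are reals $\alpha_i,\beta_j$ such that $\varphi(x,y)=(i\,x+\alpha_i)(j\,y+\beta_j)$ on region $(i,j)$. In particular $\varphi$ is constant on the central region $R_0$ (the one with $i=j=0$). The local minima of $\varphi$ on $\mathbb R^2$ are exactly the points of $R_0$, and at each of them $\varphi$ attains its global minimum. -/

import Mathlib

open Set MeasureTheory Topology

namespace DiscReconfig

/-! ### Geometry: configurations, motions, valid translations -/

/-- The Euclidean plane. -/
abbrev Plane : Type := EuclideanSpace ℝ (Fin 2)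

/-- The open unit disc centred at `p`.  Discs are open, so that discs may touch. -/
def disc (p : Plane) : Set Plane := Metric.ball p 1

/-- A labeled instance with `n` discs: start positions `S`, target positions `T`, each a valid
configuration (distinct open unit discs are disjoint, that is, distinct centres are at distance
at least two), and the matching `M`: the disc starting at `S i` has its target at `T (M i)`.
The pairs of the matching are indexed by `i : Fin n`. -/
structure Inst (n : ℕ) where
  S : Fin n → Plane
  T : Fin n → Plane
  M : Equiv.Perm (Fin n)
  validS : ∀ i j, i ≠ j → 2 ≤ dist (S i) (S j)
  validT : ∀ i j, i ≠ j → 2 ≤ dist (T i) (T j)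

/-- The target position of the `a`-th pair of the matching, before the translation. -/
def Inst.target {n : ℕ} (I : Inst n) (a : Fin n) : Plane := I.T (I.M a)

/-- The order `π` (the `k`-th disc to move is that of the pair `π k`) is a valid itinerary for the
translation `v`: while the disc of `π k` moves along the straight segment from its start position
to its translated target position, it meets neither a disc that has not moved yet
nor a disc that has been moved before. -/
def Inst.ValidItinerary {n : ℕ} (I : Inst n) (v : Plane) (π : Equiv.Perm (Fin n)) : Prop :=
  ∀ k : Fin n, ∀ t ∈ Set.Icc (0 : ℝ) 1,
    (∀ l, k < l → Disjoint
      (disc (AffineMap.lineMap (I.S (π k)) (I.target (π k) + v) t)) (disc (I.S (π l)))) ∧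
    (∀ l, l < k → Disjoint
      (disc (AffineMap.lineMap (I.S (π k)) (I.target (π k) + v) t)) (disc (I.target (π l) + v)))

/-- The region `Q` of all valid translations. -/
def Inst.Q {n : ℕ} (I : Inst n) : Set Plane := {v | ∃ π, I.ValidItinerary v π}

/-! ### The area of the axis-aligned bounding rectangle -/

/-- `D(C)`: the union of the unit discs centred at the points of `C`. -/
def discs {n : ℕ} (C : Fin n → Plane) : Set Plane := ⋃ i, disc (C i)

/-- Least `k`-th coordinate (infimum) over a planar set. -/
noncomputable def lo (X : Set Plane) (k : Fin 2) : ℝ := sInf ((fun p : Plane => p k) '' X)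

/-- Greatest `k`-th coordinate (supremum) over a planar set. -/
noncomputable def hi (X : Set Plane) (k : Fin 2) : ℝ := sSup ((fun p : Plane => p k) '' X)

/-- The axis-aligned bounding rectangle of a (non-empty, bounded) planar set. -/
def aabr (X : Set Plane) : Set Plane := {p | ∀ k, lo X k ≤ p k ∧ p k ≤ hi X k}

/-- `φ(v)`: the area of the axis-aligned bounding rectangle of `D(S) ∪ D(T + v)`. -/
noncomputable def Inst.area {n : ℕ} (I : Inst n) (v : Plane) : ℝ :=
  (volume (aabr (discs I.S ∪ discs (fun i => I.T i + v)))).toReal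

/-- The smaller breakpoint in the `k`-th coordinate: the smaller one of `a_S - a_T`, `b_S - b_T`,
where `[a_S, b_S]` and `[a_T, b_T]` are the `k`-th sides of the bounding rectangles of `D(S)` and
`D(T)`. -/
noncomputable def Inst.brkLo {n : ℕ} (I : Inst n) (k : Fin 2) : ℝ :=
  min (lo (discs I.S) k - lo (discs I.T) k) (hi (discs I.S) k - hi (discs I.T) k)

/-- The larger breakpoint in the `k`-th coordinate. -/
noncomputable def Inst.brkHi {n : ℕ} (I : Inst n) (k : Fin 2) : ℝ :=
  max (lo (discs I.S) k - lo (discs I.T) k) (hi (discs I.S) k - hi (discs I.T) k)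

/-- The three closed intervals into which two breakpoints divide the real line. -/
def zone (x₁ x₂ : ℝ) : Fin 3 → Set ℝ := ![Set.Iic x₁, Set.Icc x₁ x₂, Set.Ici x₂]

/-- Region `(i, j)` of the nine rectangular regions of the translation plane. -/
def Inst.region {n : ℕ} (I : Inst n) (i j : Fin 3) : Set Plane :=
  {v | v 0 ∈ zone (I.brkLo 0) (I.brkHi 0) i ∧ v 1 ∈ zone (I.brkLo 1) (I.brkHi 1) j}

/-- The central region. -/
def Inst.R₀ {n : ℕ} (I : Inst n) : Set Plane := I.region 1 1

/-! ### Vippodromes and the structure `D_Q` -/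

/-- The hippodrome of the unit discs centred at `p` and `q`. -/
def hippodrome (p q : Plane) : Set Plane := convexHull ℝ (disc p ∪ disc q)

/-- The vippodrome of the pairs `(a, b)`; `true` is the first type, `false` the second type. -/
def Inst.vippodrome {n : ℕ} (I : Inst n) (a b : Fin n) : Bool → Set Plane
  | true => {v | (disc (I.S a) ∩ hippodrome (I.S b) (I.target b + v)).Nonempty}
  | false => {v | (disc (I.target b + v) ∩ hippodrome (I.S a) (I.target a + v)).Nonempty}

/-- The vippodrome boundary `γ`. -/
def Inst.bdry {n : ℕ} (I : Inst n) (a b : Fin n) (τ : Bool) : Set Plane :=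
  frontier (I.vippodrome a b τ)

/-- The axis of symmetry of the wedge of the vippodrome. -/
noncomputable def Inst.axis {n : ℕ} (I : Inst n) (a b : Fin n) : Bool → Plane
  | true => I.S a - I.S b
  | false => I.target a - I.target b

/-- The position of a point along `γ`: its coordinate orthogonal to the axis.  For `a ≠ b` a
vippodrome is the sum of an open disc and a wedge of positive angle (at most `π`) with this axis,
so its boundary is the graph of a function over the direction orthogonal to the axis, and this
coordinate maps `γ` homeomorphically (and monotonically) onto `ℝ`. -/
noncomputable def Inst.pos {n : ℕ} (I : Inst n) (a b : Fin n) (τ : Bool) (v : Plane) : ℝ :=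
  (I.axis a b τ) 0 * v 1 - (I.axis a b τ) 1 * v 0

/-- An arc of a curve, given by its two endpoints; `none` means that the arc is unbounded in that
direction. -/
abbrev Arc : Type := Option Plane × Option Plane

/-- `v` (a point of the curve) lies on the arc `J`, positions being measured by `pos`. -/
def OnArc (pos : Plane → ℝ) (J : Arc) (v : Plane) : Prop :=
  (∀ p ∈ J.1, pos p ≤ pos v) ∧ (∀ q ∈ J.2, pos v ≤ pos q)

/-- `L` lists the maximal arcs (the connected components) of `γ ∩ Q` in their order along `γ`. -/
def ListsArcs (γ Q : Set Plane) (pos : Plane → ℝ) (L : List Arc) : Prop :=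
  (∀ J ∈ L, (∀ p ∈ J.1, p ∈ γ) ∧ (∀ q ∈ J.2, q ∈ γ) ∧ (∀ p ∈ J.1, ∀ q ∈ J.2, pos p ≤ pos q)) ∧
  L.Pairwise (fun J K => ∃ q ∈ J.2, ∃ p ∈ K.1, pos q < pos p) ∧
  ∀ v ∈ γ, v ∈ Q ↔ ∃ J ∈ L, OnArc pos J v

/-- The entries of a binary tree from left to right. -/
def inorder {α : Type} : BinaryTree α → List α
  | .nil => []
  | .node x l r => inorder l ++ x :: inorder r

/-- `t` is a `c`-balanced search tree for `γ ∩ Q`: its nodes hold the maximal arcs of `γ ∩ Q`,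
in symmetric order along `γ`, and its height is at most `c` times the logarithm of its size. -/
def IsDQ (c : ℕ) (γ Q : Set Plane) (pos : Plane → ℝ) (t : BinaryTree Arc) : Prop :=
  ListsArcs γ Q pos (inorder t) ∧ t.height ≤ c * Nat.log 2 (t.numNodes + 1)

/-! ### The machine: a real RAM -/

/-- The `k`-th smallest (counting from `0`) real root of `a₀ + a₁ X + … + a₄ X⁴`;
`0` if there is none, or if all coefficients are zero. -/
noncomputable def quarticRoot (a₀ a₁ a₂ a₃ a₄ : ℝ) (k : ℕ) : ℝ :=
  ((Polynomial.C a₀ + Polynomial.C a₁ * Polynomial.X + Polynomial.C a₂ * Polynomial.X ^ 2 +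
    Polynomial.C a₃ * Polynomial.X ^ 3 + Polynomial.C a₄ * Polynomial.X ^ 4 :
      Polynomial ℝ).roots.toFinset.sort).getD k 0

/-- Memory: integer registers, real registers, integer arrays and real arrays
(first argument: the name of the array, second argument: the index). -/
structure State where
  nv : ℕ → ℕ
  rv : ℕ → ℝ
  na : ℕ → ℕ → ℕ
  ra : ℕ → ℕ → ℝ

/-- Integer expressions. Integers serve as counters, indices and pointers; there is no
multiplication of integers, and no conversion from reals to integers. -/
inductive NExp where
  | lit (k : ℕ)
  | var (x : ℕ)
  | get (arr : ℕ) (i : NExp)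
  | add (e f : NExp)
  | sub (e f : NExp)

/-- Real expressions: exact arithmetic, square roots, and roots of polynomials of degree at most
four. -/
inductive RExp where
  | lit (k : ℕ)
  | var (x : ℕ)
  | get (arr : ℕ) (i : NExp)
  | add (e f : RExp)
  | sub (e f : RExp)
  | mul (e f : RExp)
  | div (e f : RExp)
  | sqrt (e : RExp)
  | root (a₀ a₁ a₂ a₃ a₄ : RExp) (k : ℕ)

/-- Tests: exact comparisons and their Boolean combinations. -/
inductive BExp where
  | leN (e f : NExp)
  | leR (e f : RExp)
  | neg (b : BExp)
  | conj (b c : BExp)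

/-- Programs. -/
inductive Cmd where
  | skip
  | setN (x : ℕ) (e : NExp)
  | setR (x : ℕ) (e : RExp)
  | storeN (arr : ℕ) (i e : NExp)
  | storeR (arr : ℕ) (i : NExp) (e : RExp)
  | seq (p q : Cmd)
  | cond (b : BExp) (p q : Cmd)
  | loop (b : BExp) (p : Cmd)

def NExp.eval (σ : State) : NExp → ℕ
  | .lit k => k
  | .var x => σ.nv x
  | .get arr i => σ.na arr (i.eval σ)
  | .add e f => e.eval σ + f.eval σ
  | .sub e f => e.eval σ - f.eval σ

noncomputable def RExp.eval (σ : State) : RExp → ℝ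
  | .lit k => k
  | .var x => σ.rv x
  | .get arr i => σ.ra arr (i.eval σ)
  | .add e f => e.eval σ + f.eval σ
  | .sub e f => e.eval σ - f.eval σ
  | .mul e f => e.eval σ * f.eval σ
  | .div e f => e.eval σ / f.eval σ
  | .sqrt e => Real.sqrt (e.eval σ)
  | .root a₀ a₁ a₂ a₃ a₄ k =>
      quarticRoot (a₀.eval σ) (a₁.eval σ) (a₂.eval σ) (a₃.eval σ) (a₄.eval σ) k

def BExp.holds (σ : State) : BExp → Prop
  | .leN e f => e.eval σ ≤ f.eval σ
  | .leR e f => e.eval σ ≤ f.eval σ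
  | .neg b => ¬ b.holds σ
  | .conj b c => b.holds σ ∧ c.holds σ

/-! The cost of an expression is its number of elementary operations and memory accesses. -/

def NExp.cost : NExp → ℕ
  | .lit _ => 1
  | .var _ => 1
  | .get _ i => i.cost + 1
  | .add e f => e.cost + f.cost + 1
  | .sub e f => e.cost + f.cost + 1

def RExp.cost : RExp → ℕ
  | .lit _ => 1
  | .var _ => 1
  | .get _ i => i.cost + 1
  | .add e f => e.cost + f.cost + 1
  | .sub e f => e.cost + f.cost + 1
  | .mul e f => e.cost + f.cost + 1
  | .div e f => e.cost + f.cost + 1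
  | .sqrt e => e.cost + 1
  | .root a₀ a₁ a₂ a₃ a₄ _ => a₀.cost + a₁.cost + a₂.cost + a₃.cost + a₄.cost + 1

def BExp.cost : BExp → ℕ
  | .leN e f => e.cost + f.cost + 1
  | .leR e f => e.cost + f.cost + 1
  | .neg b => b.cost + 1
  | .conj b c => b.cost + c.cost + 1

/-- `Exec p σ k σ'`: started in the state `σ`, the program `p` halts after exactly `k` steps in the
state `σ'`. -/
inductive Exec : Cmd → State → ℕ → State → Prop
  | skip (σ : State) : Exec .skip σ 1 σ
  | setN (σ : State) (x : ℕ) (e : NExp) :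
      Exec (.setN x e) σ (e.cost + 1) { σ with nv := Function.update σ.nv x (e.eval σ) }
  | setR (σ : State) (x : ℕ) (e : RExp) :
      Exec (.setR x e) σ (e.cost + 1) { σ with rv := Function.update σ.rv x (e.eval σ) }
  | storeN (σ : State) (arr : ℕ) (i e : NExp) :
      Exec (.storeN arr i e) σ (i.cost + e.cost + 1)
        { σ with
          na := Function.update σ.na arr (Function.update (σ.na arr) (i.eval σ) (e.eval σ)) }
  | storeR (σ : State) (arr : ℕ) (i : NExp) (e : RExp) :
      Exec (.storeR arr i e) σ (i.cost + e.cost + 1)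
        { σ with
          ra := Function.update σ.ra arr (Function.update (σ.ra arr) (i.eval σ) (e.eval σ)) }
  | seq {p q : Cmd} {σ σ₁ σ₂ : State} {k l : ℕ} :
      Exec p σ k σ₁ → Exec q σ₁ l σ₂ → Exec (.seq p q) σ (k + l) σ₂
  | condTrue {b : BExp} {p q : Cmd} {σ σ₁ : State} {k : ℕ} :
      b.holds σ → Exec p σ k σ₁ → Exec (.cond b p q) σ (b.cost + k) σ₁
  | condFalse {b : BExp} {p q : Cmd} {σ σ₁ : State} {k : ℕ} :
      ¬ b.holds σ → Exec q σ k σ₁ → Exec (.cond b p q) σ (b.cost + k) σ₁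
  | loopDone {b : BExp} {p : Cmd} {σ : State} :
      ¬ b.holds σ → Exec (.loop b p) σ b.cost σ
  | loopStep {b : BExp} {p : Cmd} {σ σ₁ σ₂ : State} {k l : ℕ} :
      b.holds σ → Exec p σ k σ₁ → Exec (.loop b p) σ₁ l σ₂ →
      Exec (.loop b p) σ (b.cost + k + l) σ₂

/-! ### Input and output

Integer register `0` holds `n`; real arrays `0, 1` hold the coordinates of the start positions, real
arrays `2, 3` those of the target positions, integer array `0` holds the matching.
The tree of the boundary of type `τ` of the pairs `(a, b)` has its root pointer in integer array `1`
at index `2 (n a + b) + τ`.  The node with address `p` has its children in integer arrays `2, 3` (the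
null pointer is `0`); integer arrays `4, 5` tell whether the two endpoints of its arc exist (`1`) or
not (`0`), and real arrays `4, 5` and `6, 7` hold the coordinates of the endpoints.
All other registers and arrays may hold anything. -/

/-- The flag is `1` and the two reals are the coordinates of the point, or the flag is `0` and there
is no point. -/
def EndAt (flag : ℕ) (x y : ℝ) : Option Plane → Prop
  | none => flag = 0
  | some p => flag = 1 ∧ x = p 0 ∧ y = p 1

/-- The tree `t` is stored in memory with its root at address `p`. -/
def TreeAt (σ : State) : BinaryTree Arc → ℕ → Prop
  | .nil, p => p = 0
  | .node J l r, p =>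
      p ≠ 0 ∧ EndAt (σ.na 4 p) (σ.ra 4 p) (σ.ra 5 p) J.1 ∧
      EndAt (σ.na 5 p) (σ.ra 6 p) (σ.ra 7 p) J.2 ∧
      TreeAt σ l (σ.na 2 p) ∧ TreeAt σ r (σ.na 3 p)

/-- The memory `σ` holds the instance `I`, together with its precomputed structure `D_Q`: a
`c`-balanced search tree of the maximal arcs of `γ ∩ Q`, for each vippodrome boundary `γ`. -/
def InputOK {n : ℕ} (c : ℕ) (I : Inst n) (σ : State) : Prop :=
  σ.nv 0 = n ∧
  (∀ i : Fin n, σ.ra 0 i = I.S i 0 ∧ σ.ra 1 i = I.S i 1 ∧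
    σ.ra 2 i = I.T i 0 ∧ σ.ra 3 i = I.T i 1 ∧ σ.na 0 i = I.M i) ∧
  (∀ a b : Fin n, a ≠ b → ∀ τ : Bool, ∃ t : BinaryTree Arc,
    IsDQ c (I.bdry a b τ) I.Q (I.pos a b τ) t ∧
    TreeAt σ t (σ.na 1 (2 * (n * a + b) + τ.toNat)))

/-- The memory `σ` holds a solution: integer register `1` is `1`, and real registers `0, 1` are the
coordinates of a valid translation which minimizes the area among all valid translations; or
integer register `1` is `0`, and there is no valid translation. -/
def OutputOK {n : ℕ} (I : Inst n) (σ : State) : Prop :=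
  (σ.nv 1 = 1 ∧ ∃ v ∈ I.Q, σ.rv 0 = v 0 ∧ σ.rv 1 = v 1 ∧ ∀ w ∈ I.Q, I.area v ≤ I.area w) ∨
  (σ.nv 1 = 0 ∧ I.Q = ∅)

end DiscReconfig

namespace DiscReconfig

/-! ### Bounding rectangles -/

/-! The area is a product of two side lengths, each depending on one coordinate of the translation
only (`Inst.area_eq`). Each side length is at least 2 and is convex and piecewise affine with slopes
-1, 0, 1; the two breakpoints bound its central interval. Moving a coordinate towards its central
interval never increases the area, and from outside this interval arbitrarily small moves decrease
it strictly. This is part (2). It also shows that the area does not increase along any segment that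
ends in `R₀` (`Inst.area_lineMap_le`).

For part (1), collisions are pairwise conditions: the translation `v` lies in a vippodrome of `(a,
b)` exactly when `a` has to move before `b`. So `v` is valid if and only if the precedence relation
given by the vippodromes containing `v` extends to a linear order (`Inst.mem_Q_iff`), `Q` is closed,
and its frontier is covered by vippodrome boundaries. A corner of `R₀` is tested by topological
sorting. If it is valid, it is optimal. If not, the segment from any valid translation to the corner
crosses the frontier of `Q`, and the area has not increased up to the crossing. Hence only the sets
`γ ∩ Q` have to be examined, and `Q` is empty if all of them are (`Inst.exists_mem_bdry_area_le`).

In the frame of its axis, a vippodrome is the region above the graph of `profile`: a circular arc of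
radius 2 continued by its tangents from the apex (`exists_scaled_disc_iff`). On each of the three
pieces, all relevant functions of the position `s` have the form `a₀ + a₁ s + a₂ s² + (b₀ + b₁ s)
√(4 - s²)`, and their zeros are roots of a polynomial of degree at most 4. A fixed number of such
roots splits `γ` into intervals on which the area is monotone. Since the area is also coercive along
`γ`, from every point one can descend monotonically to a breakpoint (`Inst.exists_breakpoint`).

The breakpoint itself may be invalid, so it is searched for in the tree of `γ ∩ Q`. Whenever the
search discards arcs, it records the arc end that lies between the breakpoint and all discarded
arcs; by monotonicity this end is at least as good as any point of them (`searchLoop_spec`).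
Validity along `γ` changes at most `O(n²)` times, since every other vippodrome contributes boundedly
many roots. The trees thus have height `O(log n)` for fixed `c` (`Inst.height_le`), and `O(n²)`
curves with boundedly many searches each give the running time. The program is verified with
Hoare-style rules that carry a step bound, together with a syntactic frame rule (`Exec.keeps`). -/

theorem coord_sub_le_dist (p q : Plane) (k : Fin 2) : |p k - q k| ≤ dist p q := by
  rw [EuclideanSpace.dist_eq, ← Real.sqrt_sq_eq_abs]
  refine Real.sqrt_le_sqrt ?_
  rw [← sq_abs (p k - q k), ← Real.dist_eq]
  exact Finset.single_le_sum (f := fun i => dist (p i) (q i) ^ 2) (fun i _ => sq_nonneg _)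
    (Finset.mem_univ k)

theorem image_disc (p : Plane) (k : Fin 2) :
    (fun q : Plane => q k) '' disc p = Ioo (p k - 1) (p k + 1) := by
  ext x
  simp only [disc, mem_image, Metric.mem_ball, mem_Ioo]
  constructor
  · rintro ⟨q, hq, rfl⟩
    have := abs_lt.1 ((coord_sub_le_dist q p k).trans_lt hq)
    constructor <;> linarith
  · rintro ⟨h1, h2⟩
    refine ⟨p + EuclideanSpace.single k (x - p k), ?_, by simp⟩
    rw [dist_eq_norm, add_sub_cancel_left, PiLp.norm_single, Real.norm_eq_abs, abs_lt]
    constructor <;> linarith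

theorem image_discs {n : ℕ} (C : Fin n → Plane) (k : Fin 2) :
    (fun q : Plane => q k) '' discs C = ⋃ i, Ioo (C i k - 1) (C i k + 1) := by
  simp only [discs, image_iUnion, image_disc]

/-- The discs are open, so the extreme coordinate is approached but not attained. The projection of
the disc with the extreme centre already has this infimum. -/
theorem isGLB_discs {n : ℕ} {C : Fin n → Plane} {k : Fin 2} {m : ℝ}
    (h : IsLeast (range fun i => C i k) m) :
    IsGLB ((fun q : Plane => q k) '' discs C) (m - 1) := by
  rw [image_discs]
  obtain ⟨⟨i, hi⟩, hm⟩ := h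
  constructor
  · intro x hx
    obtain ⟨j, hj⟩ := mem_iUnion.1 hx
    have : m ≤ C j k := hm ⟨j, rfl⟩
    linarith [hj.1]
  · intro b hb
    refine (isGLB_Ioo (show m - 1 < m + 1 by linarith)).2 fun x hx => hb ?_
    exact mem_iUnion.2 ⟨i, by simpa only [hi] using hx⟩

theorem isLUB_discs {n : ℕ} {C : Fin n → Plane} {k : Fin 2} {m : ℝ}
    (h : IsGreatest (range fun i => C i k) m) :
    IsLUB ((fun q : Plane => q k) '' discs C) (m + 1) := by
  rw [image_discs]
  obtain ⟨⟨i, hi⟩, hm⟩ := h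
  constructor
  · intro x hx
    obtain ⟨j, hj⟩ := mem_iUnion.1 hx
    have : C j k ≤ m := hm ⟨j, rfl⟩
    linarith [hj.2]
  · intro b hb
    refine (isLUB_Ioo (show m - 1 < m + 1 by linarith)).2 fun x hx => hb ?_
    exact mem_iUnion.2 ⟨i, by simpa only [hi] using hx⟩

theorem discs_nonempty {n : ℕ} (hn : 1 ≤ n) (C : Fin n → Plane) : (discs C).Nonempty :=
  ⟨C ⟨0, hn⟩, mem_iUnion.2 ⟨⟨0, hn⟩, Metric.mem_ball_self one_pos⟩⟩

theorem exists_isLeast {n : ℕ} (hn : 1 ≤ n) (f : Fin n → ℝ) : ∃ m, IsLeast (range f) m :=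
  (finite_range f).isCompact.exists_isLeast ⟨_, ⟨0, hn⟩, rfl⟩

theorem exists_isGreatest {n : ℕ} (hn : 1 ≤ n) (f : Fin n → ℝ) : ∃ m, IsGreatest (range f) m :=
  (finite_range f).isCompact.exists_isGreatest ⟨_, ⟨0, hn⟩, rfl⟩

theorem lo_discs {n : ℕ} (hn : 1 ≤ n) {C : Fin n → Plane} {k : Fin 2} {m : ℝ}
    (h : IsLeast (range fun i => C i k) m) : lo (discs C) k = m - 1 :=
  (isGLB_discs h).csInf_eq ((discs_nonempty hn C).image _)

theorem hi_discs {n : ℕ} (hn : 1 ≤ n) {C : Fin n → Plane} {k : Fin 2} {m : ℝ}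
    (h : IsGreatest (range fun i => C i k) m) : hi (discs C) k = m + 1 :=
  (isLUB_discs h).csSup_eq ((discs_nonempty hn C).image _)

/-- The length of the `k`-th side of the bounding rectangle of `D(S) ∪ D(T + v)`, as a function of
the `k`-th coordinate of `v`. -/
noncomputable def Inst.width {n : ℕ} (I : Inst n) (k : Fin 2) (x : ℝ) : ℝ :=
  max (hi (discs I.S) k) (hi (discs I.T) k + x) - min (lo (discs I.S) k) (lo (discs I.T) k + x)

theorem lo_add_two_le_hi {n : ℕ} (hn : 1 ≤ n) (C : Fin n → Plane) (k : Fin 2) :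
    lo (discs C) k + 2 ≤ hi (discs C) k := by
  obtain ⟨m, hm⟩ := exists_isLeast hn fun i => C i k
  obtain ⟨M, hM⟩ := exists_isGreatest hn fun i => C i k
  rw [lo_discs hn hm, hi_discs hn hM]
  have : m ≤ M := hm.2 hM.1
  linarith

theorem Inst.two_le_width {n : ℕ} (hn : 1 ≤ n) (I : Inst n) (k : Fin 2) (x : ℝ) :
    2 ≤ I.width k x := by
  have := lo_add_two_le_hi hn I.S k
  have h1 := le_max_left (hi (discs I.S) k) (hi (discs I.T) k + x)
  have h2 := min_le_left (lo (discs I.S) k) (lo (discs I.T) k + x)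
  unfold Inst.width
  linarith

theorem lo_union {n : ℕ} (hn : 1 ≤ n) (I : Inst n) (v : Plane) (k : Fin 2) :
    lo (discs I.S ∪ discs (fun i => I.T i + v)) k =
      min (lo (discs I.S) k) (lo (discs I.T) k + v k) := by
  obtain ⟨m, hm⟩ := exists_isLeast hn fun i => I.S i k
  obtain ⟨m', hm'⟩ := exists_isLeast hn fun i => I.T i k
  have hm'' : IsLeast (range fun i => (I.T i + v) k) (m' + v k) := by
    obtain ⟨⟨i, rfl⟩, h⟩ := hm'
    refine ⟨⟨i, rfl⟩, ?_⟩
    rintro _ ⟨j, rfl⟩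
    simpa using h ⟨j, rfl⟩
  rw [lo_discs hn hm, lo_discs hn hm', lo, image_union,
    ((isGLB_discs hm).union (isGLB_discs hm'')).csInf_eq
      (((discs_nonempty hn _).image _).inl)]
  congr 1; ring

theorem hi_union {n : ℕ} (hn : 1 ≤ n) (I : Inst n) (v : Plane) (k : Fin 2) :
    hi (discs I.S ∪ discs (fun i => I.T i + v)) k =
      max (hi (discs I.S) k) (hi (discs I.T) k + v k) := by
  obtain ⟨m, hm⟩ := exists_isGreatest hn fun i => I.S i k
  obtain ⟨m', hm'⟩ := exists_isGreatest hn fun i => I.T i k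
  have hm'' : IsGreatest (range fun i => (I.T i + v) k) (m' + v k) := by
    obtain ⟨⟨i, rfl⟩, h⟩ := hm'
    refine ⟨⟨i, rfl⟩, ?_⟩
    rintro _ ⟨j, rfl⟩
    simpa using h ⟨j, rfl⟩
  rw [hi_discs hn hm, hi_discs hn hm', hi, image_union,
    ((isLUB_discs hm).union (isLUB_discs hm'')).csSup_eq
      (((discs_nonempty hn _).image _).inl)]
  congr 1; ring

/-- The hypothesis excludes an empty rectangle, for which the product of two negative lengths would
give a wrong area. -/
theorem volume_aabr (X : Set Plane) (h : ∀ k, lo X k ≤ hi X k) :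
    (volume (aabr X)).toReal = (hi X 0 - lo X 0) * (hi X 1 - lo X 1) := by
  have : aabr X = (WithLp.ofLp : Plane → Fin 2 → ℝ) ⁻¹' Icc (lo X) (hi X) := by
    ext p
    simp only [aabr, mem_ofPred_eq, mem_preimage, mem_Icc, Pi.le_def, ← forall_and]
  rw [this, (PiLp.volume_preserving_ofLp (Fin 2)).measure_preimage
    measurableSet_Icc.nullMeasurableSet, Real.volume_Icc_pi_toReal h]
  simp

/-- This separation of the two coordinates reduces every statement about the area to the functions
`width`. -/
theorem Inst.area_eq {n : ℕ} (hn : 1 ≤ n) (I : Inst n) (v : Plane) :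
    I.area v = I.width 0 (v 0) * I.width 1 (v 1) := by
  rw [Inst.area, volume_aabr]
  · simp only [lo_union hn, hi_union hn, Inst.width]
  · intro k
    have := I.two_le_width hn k (v k)
    rw [lo_union hn, hi_union hn]
    unfold Inst.width at this
    linarith

/-- The constant term of the affine function with which `width` agrees on a zone. -/
noncomputable def Inst.offs {n : ℕ} (I : Inst n) (k : Fin 2) : Fin 3 → ℝ :=
  ![hi (discs I.S) k - lo (discs I.T) k,
    max (hi (discs I.S) k - lo (discs I.S) k) (hi (discs I.T) k - lo (discs I.T) k),
    hi (discs I.T) k - lo (discs I.S) k]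

/-- The slope of `width` on a zone. -/
def slope : Fin 3 → ℝ := ![-1, 0, 1]

/-! ### The side lengths as piecewise affine functions -/

theorem mem_zone_zero {x₁ x₂ x : ℝ} : x ∈ zone x₁ x₂ 0 ↔ x ≤ x₁ := Iff.rfl

theorem mem_zone_one {x₁ x₂ x : ℝ} : x ∈ zone x₁ x₂ 1 ↔ x₁ ≤ x ∧ x ≤ x₂ := Iff.rfl

theorem mem_zone_two {x₁ x₂ x : ℝ} : x ∈ zone x₁ x₂ 2 ↔ x₂ ≤ x := Iff.rfl

/-- In an outer zone, one end of the bounding interval comes from `S` and the other from `T`.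
Between the breakpoints, one of the two intervals contains the other, so the width is the larger of
the two lengths. -/
theorem Inst.width_eq {n : ℕ} (I : Inst n) (k : Fin 2) (i : Fin 3) {x : ℝ}
    (hx : x ∈ zone (I.brkLo k) (I.brkHi k) i) : I.width k x = slope i * x + I.offs k i := by
  fin_cases i
  all_goals
    simp only [zone, brkLo, brkHi, width, slope, offs, Fin.mk_zero, Fin.mk_one, Fin.reduceFinMk,
      Matrix.cons_val, mem_Iic, mem_Icc, mem_Ici, le_min_iff, min_le_iff, max_le_iff, le_max_iff]
      at hx ⊢
  · rw [max_eq_left (by linarith), min_eq_right (by linarith)]; ring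
  -- The two mixed cases are the two containments. In the first and the last case, `x` coincides
  -- with a breakpoint.
  · obtain ⟨h | h, h' | h'⟩ := hx
    · have : x = lo (discs I.S) k - lo (discs I.T) k := by linarith
      rw [min_eq_left (by linarith), this, ← max_sub_sub_right]; ring_nf
    · rw [min_eq_left (by linarith), max_eq_left (by linarith), max_eq_left (by linarith)]; ring
    · rw [min_eq_right (by linarith), max_eq_right (by linarith), max_eq_right (by linarith)]; ring
    · have : x = hi (discs I.S) k - hi (discs I.T) k := by linarith
      rw [max_eq_left (by linarith), this]
      rcases le_total (lo (discs I.S) k) (lo (discs I.T) k + (hi (discs I.S) k - hi (discs I.T) k))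
        with h | h
      · rw [min_eq_left h, max_eq_left (by linarith)]; ring
      · rw [min_eq_right h, max_eq_right (by linarith)]; ring
  · rw [max_eq_right (by linarith), min_eq_left (by linarith)]; ring

theorem exists_mem_zone {x₁ x₂ : ℝ} (x : ℝ) : ∃ i, x ∈ zone x₁ x₂ i := by
  rcases le_total x x₁ with h | h
  · exact ⟨0, h⟩
  rcases le_total x x₂ with h' | h'
  · exact ⟨1, h, h'⟩
  · exact ⟨2, h'⟩

theorem Inst.brkLo_le_brkHi {n : ℕ} (I : Inst n) (k : Fin 2) : I.brkLo k ≤ I.brkHi k :=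
  min_le_max

/-- Moving towards the central zone does not increase the width. -/
theorem Inst.width_le_of_mem_uIcc {n : ℕ} (I : Inst n) (k : Fin 2) {x y z : ℝ}
    (hz : z ∈ Icc (I.brkLo k) (I.brkHi k)) (hy : y ∈ uIcc x z) : I.width k y ≤ I.width k x := by
  have hbrk := I.brkLo_le_brkHi k
  obtain ⟨i, hi⟩ := exists_mem_zone (x₁ := I.brkLo k) (x₂ := I.brkHi k) x
  obtain ⟨j, hj⟩ := exists_mem_zone (x₁ := I.brkLo k) (x₂ := I.brkHi k) y
  rw [mem_uIcc] at hy
  -- Evaluating neighbouring affine formulas at the common breakpoint links their constants. After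
  -- that, points in different zones can be compared by linear arithmetic.
  have e0 := I.width_eq k 0 (mem_zone_zero.2 le_rfl)
  have e1 := I.width_eq k 1 (x := I.brkLo k) ⟨le_rfl, hbrk⟩
  have e2 := I.width_eq k 1 (x := I.brkHi k) ⟨hbrk, le_rfl⟩
  have e3 := I.width_eq k 2 (mem_zone_two.2 le_rfl)
  rw [I.width_eq k i hi, I.width_eq k j hj]
  fin_cases i <;> fin_cases j <;>
    simp [zone, slope] at hi hj e0 e1 e2 e3 hz ⊢ <;>
    obtain ⟨hy, hy'⟩ | ⟨hy, hy'⟩ := hy <;> linarith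

/-- A step of length `ε / 2`, cut off at the nearest breakpoint, stays in the same outer zone, where
the slope is -1 or 1. -/
theorem Inst.width_lt {n : ℕ} (I : Inst n) (k : Fin 2) {x : ℝ}
    (hx : x ∉ Icc (I.brkLo k) (I.brkHi k)) :
    ∀ ε > 0, ∃ y, |y - x| < ε ∧ I.width k y < I.width k x := by
  intro ε hε
  rcases lt_or_ge x (I.brkLo k) with h | h
  · refine ⟨min (x + ε / 2) (I.brkLo k), ?_, ?_⟩
    · rw [abs_lt]
      have : x < min (x + ε / 2) (I.brkLo k) := lt_min (by linarith) h
      constructor <;> linarith [min_le_left (x + ε / 2) (I.brkLo k)]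
    · rw [I.width_eq k 0 (x := x) h.le, I.width_eq k 0 (mem_zone_zero.2 (min_le_right _ _))]
      have : x < min (x + ε / 2) (I.brkLo k) := lt_min (by linarith) h
      simp only [slope, Matrix.cons_val]; linarith
  · have h' : I.brkHi k < x := by
      by_contra! h'
      exact hx ⟨h, h'⟩
    refine ⟨max (x - ε / 2) (I.brkHi k), ?_, ?_⟩
    · rw [abs_lt]
      have : max (x - ε / 2) (I.brkHi k) < x := max_lt (by linarith) h'
      constructor <;> linarith [le_max_left (x - ε / 2) (I.brkHi k)]
    · rw [I.width_eq k 2 (x := x) h'.le, I.width_eq k 2 (mem_zone_two.2 (le_max_right _ _))]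
      have : max (x - ε / 2) (I.brkHi k) < x := max_lt (by linarith) h'
      simp only [slope, Matrix.cons_val]; linarith

/-! ### The central region and the minima of the area -/

theorem Inst.mem_R₀ {n : ℕ} (I : Inst n) (v : Plane) :
    v ∈ I.R₀ ↔ ∀ k, v k ∈ Icc (I.brkLo k) (I.brkHi k) := by
  simp [Inst.R₀, Inst.region, zone, Fin.forall_fin_two]

/-- Along a segment towards `R₀`, both coordinates move monotonically to points of their central
intervals, so neither factor grows. The statement covers the whole segment because the walk may have
to stop where it leaves `Q`. -/
theorem Inst.area_lineMap_le {n : ℕ} (hn : 1 ≤ n) (I : Inst n) {v w : Plane} (hv : v ∈ I.R₀)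
    {t : ℝ} (ht : t ∈ Icc (0 : ℝ) 1) : I.area (AffineMap.lineMap w v t) ≤ I.area w := by
  rw [I.mem_R₀] at hv
  have key (k : Fin 2) : I.width k ((AffineMap.lineMap w v t : Plane) k) ≤ I.width k (w k) := by
    refine I.width_le_of_mem_uIcc k (hv k) ?_
    rw [← segment_eq_uIcc, segment_eq_image_lineMap]
    exact ⟨t, ht, by simp [AffineMap.lineMap_apply]⟩
  rw [I.area_eq hn, I.area_eq hn]
  have := fun k x => I.two_le_width hn k x
  exact mul_le_mul (key 0) (key 1) (by linarith [this 1 ((AffineMap.lineMap w v t : Plane) 1)])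
    (by linarith [this 0 (w 0)])

theorem Inst.area_le_of_mem_R₀ {n : ℕ} (hn : 1 ≤ n) (I : Inst n) {v : Plane} (hv : v ∈ I.R₀)
    (w : Plane) : I.area v ≤ I.area w := by
  simpa using I.area_lineMap_le hn hv (w := w) (t := 1) (by simp)

/-- One coordinate is changed so that its factor strictly drops. The other factor is at least 2, so
the product strictly drops as well. -/
theorem Inst.not_isLocalMin {n : ℕ} (hn : 1 ≤ n) (I : Inst n) {v : Plane} (hv : v ∉ I.R₀) :
    ¬ IsLocalMin I.area v := by
  intro h
  rw [I.mem_R₀] at hv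
  push Not at hv
  obtain ⟨k, hk⟩ := hv
  obtain ⟨ε, hε, hball⟩ := Metric.eventually_nhds_iff_ball.1 h
  obtain ⟨y, hy, hlt⟩ := I.width_lt k hk ε hε
  have hw := hball (v + EuclideanSpace.single k (y - v k)) (by
    rw [Metric.mem_ball, dist_eq_norm, add_sub_cancel_left, PiLp.norm_single]
    exact hy)
  rw [I.area_eq hn, I.area_eq hn] at hw
  have h0 := I.two_le_width hn 0 (v 0)
  have h1 := I.two_le_width hn 1 (v 1)
  fin_cases k <;> simp at hw hlt <;> nlinarith

theorem Inst.isLocalMin_iff {n : ℕ} (hn : 1 ≤ n) (I : Inst n) (v : Plane) :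
    IsLocalMin I.area v ↔ v ∈ I.R₀ :=
  ⟨fun h => by_contra fun hv => I.not_isLocalMin hn hv h,
    fun hv => Filter.Eventually.of_forall fun w => I.area_le_of_mem_R₀ hn hv w⟩

theorem Inst.area_region {n : ℕ} (hn : 1 ≤ n) (I : Inst n) (i j : Fin 3) {v : Plane}
    (hv : v ∈ I.region i j) :
    I.area v = (slope i * v 0 + I.offs 0 i) * (slope j * v 1 + I.offs 1 j) := by
  rw [I.area_eq hn, I.width_eq 0 i hv.1, I.width_eq 1 j hv.2]

/-! ### The boundary of a vippodrome as the graph of a function -/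

/-- The slope of the rays of a vippodrome boundary whose axis has length `l`. -/
noncomputable def raySlope (l : ℝ) : ℝ := Real.sqrt (l ^ 2 - 4) / 2

/-- The position at which the circular arc of a vippodrome boundary meets a ray. -/
noncomputable def junction (l : ℝ) : ℝ := 4 * raySlope l / l

/-- The function whose graph is the boundary of a vippodrome. -/
noncomputable def profile (l s : ℝ) : ℝ :=
  if s ≤ -junction l then -(raySlope l * s)
  else if junction l ≤ s then raySlope l * s else l - Real.sqrt (4 - s ^ 2)

theorem raySlope_nonneg (l : ℝ) : 0 ≤ raySlope l := by unfold raySlope; positivity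

/-- The rays are the tangents from the origin to the circle of radius 2 about `(0, l)`: the line `h
= r s` has distance `l / √(1 + r²)` from the centre, which equals 2 exactly for `r² = (l² - 4) / 4`.
-/
theorem raySlope_sq {l : ℝ} (hl : 2 ≤ l) : raySlope l ^ 2 = (l ^ 2 - 4) / 4 := by
  rw [raySlope, div_pow, Real.sq_sqrt (by nlinarith)]; norm_num

theorem junction_mul {l : ℝ} (hl : 2 ≤ l) : junction l * l = 4 * raySlope l := by
  unfold junction
  field_simp

theorem junction_nonneg {l : ℝ} (hl : 2 ≤ l) : 0 ≤ junction l :=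
  div_nonneg (mul_nonneg (by norm_num) (raySlope_nonneg l)) (by linarith)

/-- The point of tangency lies at height `l - 4 / l`, hence the number `4 / l`. -/
theorem junction_sq {l : ℝ} (hl : 2 ≤ l) : junction l ^ 2 = 4 - (4 / l) ^ 2 := by
  have := raySlope_sq hl
  rw [junction, div_pow, mul_pow, this]; field_simp

theorem sq_lt_four_of_abs_le_junction {l s : ℝ} (hl : 2 ≤ l) (hs : |s| ≤ junction l) :
    s ^ 2 < 4 := by
  have h1 := junction_sq hl
  have h2 : 0 < (4 / l) ^ 2 := by positivity
  have h3 := pow_le_pow_left₀ (abs_nonneg s) hs 2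
  rw [sq_abs] at h3
  linarith

theorem sqrt_junction {l : ℝ} (hl : 2 ≤ l) : Real.sqrt (4 - junction l ^ 2) = 4 / l := by
  rw [junction_sq hl, sub_sub_cancel, Real.sqrt_sq (by positivity)]

/-- Arc and ray meet at the point of tangency; this makes `profile` continuous. -/
theorem raySlope_mul_junction {l : ℝ} (hl : 2 ≤ l) :
    raySlope l * junction l = l - Real.sqrt (4 - junction l ^ 2) := by
  have := raySlope_sq hl
  rw [sqrt_junction hl, junction]
  field_simp
  linarith

theorem profile_left {l s : ℝ} (hs : s ≤ -junction l) : profile l s = -(raySlope l * s) :=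
  if_pos hs

theorem profile_right {l s : ℝ} (hl : 2 ≤ l) (hs : junction l ≤ s) :
    profile l s = raySlope l * s := by
  unfold profile
  split_ifs with h
  -- Both ray conditions can hold only if the junction is 0, which happens when the wedge is a
  -- half-plane; then `s = 0` and the formulas agree.
  · have := junction_nonneg hl
    have : s = 0 := by linarith
    simp [this]
  · rfl

theorem profile_mid {l s : ℝ} (hl : 2 ≤ l) (hs : |s| ≤ junction l) :
    profile l s = l - Real.sqrt (4 - s ^ 2) := by
  have := raySlope_mul_junction hl
  rw [abs_le] at hs
  unfold profile
  split_ifs with h h'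
  · have : s = -junction l := le_antisymm h hs.1
    rw [this, mul_neg, neg_neg, neg_sq, raySlope_mul_junction hl]
  · have : s = junction l := le_antisymm hs.2 h'
    rw [this, raySlope_mul_junction hl]
  · rfl

theorem continuous_profile {l : ℝ} (hl : 2 ≤ l) : Continuous (profile l) := by
  unfold profile
  refine Continuous.if_le (by fun_prop) ?_ continuous_id continuous_const ?_
  · refine Continuous.if_le (by fun_prop) (by fun_prop) continuous_const continuous_id ?_
    rintro s rfl
    exact raySlope_mul_junction hl
  · rintro s rfl
    split_ifs with h
    · have h1 := junction_nonneg hl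
      have : junction l = 0 := by linarith
      simp [this]
    · rw [mul_neg, neg_neg, neg_sq, raySlope_mul_junction hl]

/-- The union of the discs of radius `2` about the points `(0, l / t)`, scaled by `1 / t`, is the
region above the graph of `profile l`. -/
theorem exists_scaled_disc_iff {l : ℝ} (hl : 2 ≤ l) (s h : ℝ) :
    (∃ t ∈ Icc (0 : ℝ) 1, (t * s) ^ 2 + (t * h - l) ^ 2 < 4) ↔ profile l s < h := by
  have hr := raySlope_sq hl
  have hr0 := raySlope_nonneg l
  have hj := junction_mul hl
  have hj0 := junction_nonneg hl
  have hjs := junction_sq hl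
  rcases le_total |s| (junction l) with hs | hs
  · rw [profile_mid hl hs]
    have hs4 := sq_lt_four_of_abs_le_junction hl hs
    set r := Real.sqrt (4 - s ^ 2) with hrdef
    have hr2 : r ^ 2 = 4 - s ^ 2 := Real.sq_sqrt (by linarith)
    have hrpos : 0 < r := Real.sqrt_pos.2 (by linarith)
    constructor
    · rintro ⟨t, ⟨ht0, ht1⟩, ht⟩
      by_contra! hle
      -- Being between the two points of tangency means `r ≥ 4 / l`.
      have hrl : 4 ≤ l * r := by
        have h3 := pow_le_pow_left₀ (abs_nonneg s) hs 2
        rw [sq_abs, hjs] at h3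
        have : 4 / l ≤ r := by
          refine le_of_sq_le_sq ?_ hrpos.le |>.trans le_rfl
          linarith
        rw [div_le_iff₀ (by linarith)] at this
        linarith
      have h1 : t * h ≤ t * (l - r) := mul_le_mul_of_nonneg_left hle ht0
      have h2 : 0 ≤ l - t * (l - r) := by nlinarith
      have h3 : (l - t * (l - r)) ^ 2 ≤ (l - t * h) ^ 2 :=
        pow_le_pow_left₀ h2 (by linarith) 2
      -- With `s² = 4 - r²`, one has `(t s)² + (l - t (l - r))² - 4 = (1 - t)² (l² - 4) + 2 t (1 -
      -- t) (l r - 4)`, a sum of nonnegative terms.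
      have h4 : 0 ≤ (1 - t) ^ 2 * (l ^ 2 - 4) := mul_nonneg (sq_nonneg _) (by nlinarith)
      have h5 : 0 ≤ t * (1 - t) * (l * r - 4) :=
        mul_nonneg (mul_nonneg ht0 (by linarith)) (by linarith)
      nlinarith
    · intro hlt
      -- Up to height `l` the unscaled disc contains the point. Above it, the factor `l / h` brings
      -- the point to the height of the centre, and its position still has square less than 4.
      rcases le_total h l with hh | hh
      · refine ⟨1, by simp, ?_⟩
        have : (l - h) ^ 2 < r ^ 2 := pow_lt_pow_left₀ (by linarith) (by linarith) (by norm_num)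
        nlinarith
      · have hh0 : 0 < h := by linarith
        refine ⟨l / h, ⟨by positivity, (div_le_one hh0).2 hh⟩, ?_⟩
        have h1 : l / h * h = l := by field_simp
        have h2 : (l / h) ^ 2 ≤ 1 := pow_le_one₀ (by positivity) ((div_le_one hh0).2 hh)
        rw [h1, mul_pow]
        nlinarith [sq_nonneg s]
  · have hp : profile l s = raySlope l * |s| := by
      rcases abs_cases s with ⟨h1, h2⟩ | ⟨h1, h2⟩
      · rw [h1] at hs ⊢
        exact profile_right hl hs
      · rw [h1] at hs ⊢
        rw [profile_left (by linarith), mul_neg]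
    rw [hp]
    constructor
    · rintro ⟨t, ⟨ht0, ht1⟩, ht⟩
      by_contra! hle
      have h0 : t * h ≤ raySlope l * (t * |s|) := by nlinarith
      have h1 : (t * s) ^ 2 = (t * |s|) ^ 2 := by rw [mul_pow, mul_pow, sq_abs]
      rw [h1] at ht
      set x := t * |s|
      have hx0 : 0 ≤ x := by positivity
      -- Completion of the square. The remaining constant vanishes by tangency, so the ray avoids
      -- the open disc of radius 2.
      have hid : (raySlope l ^ 2 + 1) * (x ^ 2 + (raySlope l * x - l) ^ 2 - 4) =
        ((raySlope l ^ 2 + 1) * x - raySlope l * l) ^ 2 +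
          (l ^ 2 - 4 * (raySlope l ^ 2 + 1)) := by ring
      have hge : 4 ≤ x ^ 2 + (raySlope l * x - l) ^ 2 := by
        have : 0 ≤ (raySlope l ^ 2 + 1) * (x ^ 2 + (raySlope l * x - l) ^ 2 - 4) := by
          rw [hid, hr]; nlinarith [sq_nonneg (((l ^ 2 - 4) / 4 + 1) * x - raySlope l * l)]
        have := nonneg_of_mul_nonneg_right this (by positivity)
        linarith
      rcases le_total (raySlope l * x) l with hxl | hxl
      · nlinarith
      -- Beyond height `l` on the ray, the first coordinate alone is at least 2, because the slope
      -- is at most `l / 2`.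
      · have : 2 * l ≤ l ^ 2 := by nlinarith
        have hx2 : 2 ≤ x := by
          by_contra! hx2
          nlinarith
        nlinarith [sq_nonneg (t * h - l)]
    · intro hlt
      have hh0 : 0 < h := lt_of_le_of_lt (by positivity) hlt
      rcases eq_or_lt_of_le hj0 with h0 | h0
      · have hl2 : l = 2 := by
          rw [← h0] at hj
          have : raySlope l = 0 := by linarith
          rw [this] at hr
          nlinarith
        subst hl2
        have hpos : 0 < s ^ 2 + h ^ 2 := by positivity
        -- For `l = 2` the condition on a positive `t` reads `t (s² + h²) < 4 h`; the witness gives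
        -- even `t (s² + h²) ≤ h`, and the minimum keeps it in the unit interval.
        refine ⟨min 1 (h / (s ^ 2 + h ^ 2)), ⟨by positivity, min_le_left _ _⟩, ?_⟩
        set t := min 1 (h / (s ^ 2 + h ^ 2)) with ht
        have h1 : 0 < t := by positivity
        have h2 : t * (s ^ 2 + h ^ 2) ≤ h := (le_div_iff₀ hpos).1 (min_le_right _ _)
        nlinarith [mul_le_mul_of_nonneg_left h2 h1.le, mul_pos h1 hh0]
      · have h0 : 0 < |s| := h0.trans_le hs
        -- The factor `t₁` moves the point to the position of tangency, and `l / h` moves it to the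
        -- height of the centre. The smaller of the two factors works: in the first case the point
        -- lies above the point of tangency and not above the centre, in the second case it lies at
        -- horizontal distance less than 2 from the centre.
        set t₁ := junction l / |s| with ht₁
        have ht1s : t₁ * |s| = junction l := by rw [ht₁]; field_simp
        have ht1 : 0 < t₁ := by positivity
        rcases le_total (l / h) t₁ with ht | ht
        · refine ⟨l / h, ⟨by positivity, ht.trans ((div_le_one h0).2 hs)⟩, ?_⟩
          have h1 : l / h * h = l := by field_simp
          have h2 : l / h * |s| ≤ junction l := by rw [← ht1s]; gcongr
          have h3 := sq_lt_four_of_abs_le_junction hl (s := l / h * |s|)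
            (by rwa [abs_of_nonneg (by positivity)])
          rw [mul_pow, sq_abs, ← mul_pow] at h3
          rw [h1]; linarith
        · refine ⟨t₁, ⟨by positivity, (div_le_one h0).2 hs⟩, ?_⟩
          have h1 : t₁ * h ≤ l := (le_div_iff₀ hh0).1 ht
          rw [mul_pow, ← sq_abs s, ← mul_pow, ht1s, hjs]
          have h3 : raySlope l * junction l < t₁ * h := by
            rw [← ht1s]; nlinarith
          rw [raySlope_mul_junction hl, sqrt_junction hl] at h3
          nlinarith [show (l - t₁ * h) ^ 2 < (4 / l) ^ 2 from
            pow_lt_pow_left₀ (by linarith) (by linarith) (by norm_num)]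

/-! ### Vippodromes in coordinates -/

-- A hippodrome is the Minkowski sum of a segment and the open unit ball. A unit disc therefore
-- meets it exactly when its centre is at distance less than 2 from some point of the segment.
open scoped Pointwise in
theorem mem_hippodrome_iff (p q x : Plane) :
    (disc x ∩ hippodrome p q).Nonempty ↔
      ∃ t ∈ Icc (0 : ℝ) 1, dist x (AffineMap.lineMap p q t) < 2 := by
  have h : disc p ∪ disc q = ({p, q} : Set Plane) + Metric.ball (0 : Plane) 1 := by
    rw [insert_eq, union_add, singleton_add_ball, singleton_add_ball, add_zero, add_zero]; rfl
  rw [hippodrome, h, convexHull_add, convexHull_pair, (convex_ball _ _).convexHull_eq]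
  constructor
  · rintro ⟨y, hy, z, hz, e, he, rfl⟩
    rw [segment_eq_image_lineMap] at hz
    obtain ⟨t, ht, rfl⟩ := hz
    refine ⟨t, ht, ?_⟩
    set z : Plane := AffineMap.lineMap p q t
    have h1 : dist x (z + e) < 1 := by rw [dist_comm]; exact hy
    have h2 : dist (z + e) z < 1 := by simpa using he
    linarith [dist_triangle x (z + e) z]
  · rintro ⟨t, ht, hlt⟩
    have : ¬ Disjoint (Metric.ball x 1) (Metric.ball (AffineMap.lineMap p q t) 1) := by
      rw [disjoint_ball_ball_iff one_pos one_pos]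
      linarith
    obtain ⟨y, hy1, hy2⟩ := not_disjoint_iff.1 this
    refine ⟨y, hy1, AffineMap.lineMap p q t, ?_, y - AffineMap.lineMap p q t, ?_, by simp⟩
    · rw [segment_eq_image_lineMap]
      exact ⟨t, ht, rfl⟩
    · simpa [dist_eq_norm] using hy2

/-- The translation that brings the apex of the wedge of a vippodrome to the origin. -/
noncomputable def Inst.off {n : ℕ} (I : Inst n) (a b : Fin n) : Bool → Plane
  | true => I.target b - I.S b
  | false => I.target a - I.S a

/-- The length of the axis. -/
noncomputable def Inst.len {n : ℕ} (I : Inst n) (a b : Fin n) (τ : Bool) : ℝ :=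
  Real.sqrt (I.axis a b τ 0 ^ 2 + I.axis a b τ 1 ^ 2)

/-- The coordinate orthogonal to the axis. -/
noncomputable def Inst.sc {n : ℕ} (I : Inst n) (a b : Fin n) (τ : Bool) (v : Plane) : ℝ :=
  (I.axis a b τ 0 * (v 1 + I.off a b τ 1) - I.axis a b τ 1 * (v 0 + I.off a b τ 0)) / I.len a b τ

/-- The coordinate along the axis. -/
noncomputable def Inst.hc {n : ℕ} (I : Inst n) (a b : Fin n) (τ : Bool) (v : Plane) : ℝ :=
  (I.axis a b τ 0 * (v 0 + I.off a b τ 0) + I.axis a b τ 1 * (v 1 + I.off a b τ 1)) / I.len a b τ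

theorem norm_plane (v : Plane) : ‖v‖ = Real.sqrt (v 0 ^ 2 + v 1 ^ 2) := by
  rw [EuclideanSpace.norm_eq]
  simp

theorem Inst.len_eq_norm {n : ℕ} (I : Inst n) (a b : Fin n) (τ : Bool) :
    I.len a b τ = ‖I.axis a b τ‖ := (norm_plane _).symm

/-- Here the separation of the configurations enters: it guarantees that the apex lies outside the
open disc of radius 2, so that tangents exist. -/
theorem Inst.two_le_len {n : ℕ} (I : Inst n) {a b : Fin n} (hab : a ≠ b) (τ : Bool) :
    2 ≤ I.len a b τ := by
  rw [I.len_eq_norm]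
  cases τ
  · exact (I.validT _ _ (I.M.injective.ne hab)).trans_eq (dist_eq_norm _ _)
  · exact (I.validS _ _ hab).trans_eq (dist_eq_norm _ _)

theorem Inst.len_sq {n : ℕ} (I : Inst n) (a b : Fin n) (τ : Bool) :
    I.len a b τ ^ 2 = I.axis a b τ 0 ^ 2 + I.axis a b τ 1 ^ 2 :=
  Real.sq_sqrt (by positivity)

/-- Both types take the same form, which allows a uniform treatment. For the second type, the time
along the segment is reversed. -/
theorem Inst.mem_vippodrome_iff_exists {n : ℕ} (I : Inst n) (a b : Fin n) (τ : Bool) (v : Plane) :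
    v ∈ I.vippodrome a b τ ↔
      ∃ t ∈ Icc (0 : ℝ) 1, ‖t • (v + I.off a b τ) - I.axis a b τ‖ < 2 := by
  cases τ
  · change (disc (I.target b + v) ∩ hippodrome (I.S a) (I.target a + v)).Nonempty ↔ _
    rw [mem_hippodrome_iff]
    constructor <;>
    · rintro ⟨t, ⟨ht0, ht1⟩, ht⟩
      refine ⟨1 - t, ⟨by linarith, by linarith⟩, ?_⟩
      refine (Eq.trans_lt ?_ ht)
      rw [dist_eq_norm]
      congr 1
      simp only [AffineMap.lineMap_apply_module', Inst.off, Inst.axis]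
      module
  · change (disc (I.S a) ∩ hippodrome (I.S b) (I.target b + v)).Nonempty ↔ _
    rw [mem_hippodrome_iff]
    refine exists_congr fun t => and_congr_right fun _ => ?_
    rw [dist_comm, dist_eq_norm]
    have : (AffineMap.lineMap (I.S b) (I.target b + v) t : Plane) - I.S a =
        t • (v + I.off a b true) - I.axis a b true := by
      simp only [AffineMap.lineMap_apply_module', Inst.off, Inst.axis]
      module
    rw [this]

/-- `sc` and `hc` are the coordinates of the shifted point in the orthonormal frame of the axis,
where the axis vector becomes `(0, len)`. The claim is then `exists_scaled_disc_iff`. -/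
theorem Inst.mem_vippodrome_iff {n : ℕ} (I : Inst n) {a b : Fin n} (hab : a ≠ b) (τ : Bool)
    (v : Plane) :
    v ∈ I.vippodrome a b τ ↔ profile (I.len a b τ) (I.sc a b τ v) < I.hc a b τ v := by
  have hl := I.two_le_len hab τ
  rw [I.mem_vippodrome_iff_exists, ← exists_scaled_disc_iff hl]
  refine exists_congr fun t => and_congr_right fun _ => ?_
  have h := I.len_sq a b τ
  rw [norm_plane, Real.sqrt_lt' two_pos]
  have : (t * I.sc a b τ v) ^ 2 + (t * I.hc a b τ v - I.len a b τ) ^ 2 =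
      (t • (v + I.off a b τ) - I.axis a b τ : Plane) 0 ^ 2 +
      (t • (v + I.off a b τ) - I.axis a b τ : Plane) 1 ^ 2 := by
    simp only [PiLp.sub_apply, PiLp.smul_apply, PiLp.add_apply, smul_eq_mul, Inst.sc, Inst.hc]
    have h0 : I.len a b τ ≠ 0 := by linarith
    generalize I.len a b τ = l at *
    generalize I.axis a b τ 0 = d at *
    generalize I.axis a b τ 1 = e at *
    generalize v.ofLp 0 + (I.off a b τ).ofLp 0 = x
    generalize v.ofLp 1 + (I.off a b τ).ofLp 1 = y
    have e1 : (t * ((d * y - e * x) / l)) ^ 2 + (t * ((d * x + e * y) / l)) ^ 2 =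
        t ^ 2 * (x ^ 2 + y ^ 2) := by
      field_simp
      rw [h]; ring
    have e2 : t * ((d * x + e * y) / l) * l = t * (d * x + e * y) := by field_simp
    linear_combination e1 - 2 * e2 + h
  rw [this]; norm_num

/-- The point at position `s` of a vippodrome boundary. -/
noncomputable def Inst.curve {n : ℕ} (I : Inst n) (a b : Fin n) (τ : Bool) (s : ℝ) : Plane :=
  !₂[(I.axis a b τ 0 * profile (I.len a b τ) s - I.axis a b τ 1 * s) / I.len a b τ - I.off a b τ 0,
    (I.axis a b τ 1 * profile (I.len a b τ) s + I.axis a b τ 0 * s) / I.len a b τ - I.off a b τ 1]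

theorem Inst.sc_curve {n : ℕ} (I : Inst n) {a b : Fin n} (hab : a ≠ b) (τ : Bool) (s : ℝ) :
    I.sc a b τ (I.curve a b τ s) = s := by
  have h := I.len_sq a b τ
  have h0 : I.len a b τ ≠ 0 := by linarith [I.two_le_len hab τ]
  simp only [Inst.sc, Inst.curve, PiLp.toLp_apply, Matrix.cons_val, sub_add_cancel]
  field_simp
  rw [h]; ring

theorem Inst.hc_curve {n : ℕ} (I : Inst n) {a b : Fin n} (hab : a ≠ b) (τ : Bool) (s : ℝ) :
    I.hc a b τ (I.curve a b τ s) = profile (I.len a b τ) s := by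
  have h := I.len_sq a b τ
  have h0 : I.len a b τ ≠ 0 := by linarith [I.two_le_len hab τ]
  simp only [Inst.hc, Inst.curve, PiLp.toLp_apply, Matrix.cons_val, sub_add_cancel]
  field_simp
  rw [h]; ring

theorem Inst.eq_curve {n : ℕ} (I : Inst n) {a b : Fin n} (hab : a ≠ b) (τ : Bool) {v : Plane}
    (h : I.hc a b τ v = profile (I.len a b τ) (I.sc a b τ v)) :
    v = I.curve a b τ (I.sc a b τ v) := by
  have hl := I.len_sq a b τ
  have h0 : I.len a b τ ≠ 0 := by linarith [I.two_le_len hab τ]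
  ext k
  fin_cases k <;>
  · simp only [Fin.mk_zero, Fin.mk_one, Inst.curve, PiLp.toLp_apply, Matrix.cons_val]
    rw [← h, eq_sub_iff_add_eq, Inst.hc, Inst.sc]
    field_simp
    rw [hl]; ring

theorem Inst.continuous_sc {n : ℕ} (I : Inst n) (a b : Fin n) (τ : Bool) :
    Continuous (I.sc a b τ) := by
  unfold Inst.sc; fun_prop

theorem Inst.continuous_hc {n : ℕ} (I : Inst n) (a b : Fin n) (τ : Bool) :
    Continuous (I.hc a b τ) := by
  unfold Inst.hc; fun_prop

theorem Inst.vippodrome_eq {n : ℕ} (I : Inst n) {a b : Fin n} (hab : a ≠ b) (τ : Bool) :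
    I.vippodrome a b τ = {v | profile (I.len a b τ) (I.sc a b τ v) < I.hc a b τ v} :=
  Set.ext fun v => I.mem_vippodrome_iff hab τ v

theorem Inst.continuous_profile_sc {n : ℕ} (I : Inst n) {a b : Fin n} (hab : a ≠ b) (τ : Bool) :
    Continuous fun v => profile (I.len a b τ) (I.sc a b τ v) :=
  (continuous_profile (I.two_le_len hab τ)).comp (I.continuous_sc a b τ)

theorem Inst.isOpen_vippodrome {n : ℕ} (I : Inst n) {a b : Fin n} (hab : a ≠ b) (τ : Bool) :
    IsOpen (I.vippodrome a b τ) := by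
  rw [I.vippodrome_eq hab]
  exact isOpen_lt (I.continuous_profile_sc hab τ) (I.continuous_hc a b τ)

/-- The vippodrome is a strict epigraph of a continuous function. Each point of the graph is a limit
of points of the vippodrome, since a small shift along the axis increases `hc` and keeps `sc`. -/
theorem Inst.bdry_eq {n : ℕ} (I : Inst n) {a b : Fin n} (hab : a ≠ b) (τ : Bool) :
    I.bdry a b τ = range (I.curve a b τ) := by
  ext v
  constructor
  · intro hv
    rw [Inst.bdry, I.vippodrome_eq hab] at hv
    exact ⟨_, (I.eq_curve hab τ (frontier_lt_subset_eq (I.continuous_profile_sc hab τ)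
      (I.continuous_hc a b τ) hv).symm).symm⟩
  · rintro ⟨s, rfl⟩
    rw [Inst.bdry, (I.isOpen_vippodrome hab τ).frontier_eq]
    have h0 : I.len a b τ ≠ 0 := by linarith [I.two_le_len hab τ]
    have hpos : 0 < I.len a b τ := by linarith [I.two_le_len hab τ]
    refine ⟨?_, ?_⟩
    · have hlim : Filter.Tendsto (fun ε : ℝ => I.curve a b τ s + ε • I.axis a b τ) (𝓝[>] 0)
          (𝓝 (I.curve a b τ s)) := by
        have : Continuous (fun ε : ℝ => I.curve a b τ s + ε • I.axis a b τ) := by fun_prop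
        have := this.tendsto 0
        simp only [zero_smul, add_zero] at this
        exact this.mono_left nhdsWithin_le_nhds
      refine mem_closure_of_tendsto hlim ?_
      filter_upwards [self_mem_nhdsWithin] with ε hε
      have hε : 0 < ε := hε
      rw [I.mem_vippodrome_iff hab]
      have e1 : I.sc a b τ (I.curve a b τ s + ε • I.axis a b τ) = s := by
        conv_rhs => rw [← I.sc_curve hab τ s]
        simp only [Inst.sc, PiLp.add_apply, PiLp.smul_apply, smul_eq_mul]
        ring
      have e2 : I.hc a b τ (I.curve a b τ s + ε • I.axis a b τ) =
          profile (I.len a b τ) s + ε * I.len a b τ := by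
        rw [← I.hc_curve hab τ s]
        simp only [Inst.hc, PiLp.add_apply, PiLp.smul_apply, smul_eq_mul]
        have := I.len_sq a b τ
        field_simp
        rw [this]; ring
      rw [e1, e2]
      have := mul_pos hε hpos
      linarith
    · rw [I.mem_vippodrome_iff hab, I.sc_curve hab, I.hc_curve hab]
      exact lt_irrefl _

/-- `pos` is an increasing affine function of `sc`, so the order of the arcs in a tree is the order
of the parameter of `curve`. -/
theorem Inst.pos_eq {n : ℕ} (I : Inst n) {a b : Fin n} (hab : a ≠ b) (τ : Bool) (v : Plane) :
    I.pos a b τ v = I.len a b τ * I.sc a b τ v -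
      (I.axis a b τ 0 * I.off a b τ 1 - I.axis a b τ 1 * I.off a b τ 0) := by
  have h0 : I.len a b τ ≠ 0 := by linarith [I.two_le_len hab τ]
  simp only [Inst.pos, Inst.sc]
  field_simp
  ring

theorem Inst.pos_le_pos {n : ℕ} (I : Inst n) {a b : Fin n} (hab : a ≠ b) (τ : Bool) {v w : Plane} :
    I.pos a b τ v ≤ I.pos a b τ w ↔ I.sc a b τ v ≤ I.sc a b τ w := by
  have h0 : 0 < I.len a b τ := by linarith [I.two_le_len hab τ]
  rw [I.pos_eq hab, I.pos_eq hab, sub_le_sub_iff_right, mul_le_mul_iff_right₀ h0]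

/-! ### Valid translations -/

/-- The pair `a` must precede the pair `b` in every valid itinerary for `v`. -/
def Inst.Blocks {n : ℕ} (I : Inst n) (v : Plane) (a b : Fin n) : Prop :=
  ∃ τ, v ∈ I.vippodrome a b τ

theorem disjoint_disc_iff (p q : Plane) : Disjoint (disc p) (disc q) ↔ 2 ≤ dist q p := by
  rw [disc, disc, disjoint_ball_ball_iff one_pos one_pos, dist_comm]
  norm_num

/-- The first type records that the path of `b` hits the disc of `a` at its start, the second that
the path of `a` hits the disc of `b` at its target. In either case `a` has to move first. -/
theorem Inst.not_blocks_iff {n : ℕ} (I : Inst n) (v : Plane) (a b : Fin n) :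
    ¬ I.Blocks v a b ↔ ∀ t ∈ Icc (0 : ℝ) 1,
      Disjoint (disc (AffineMap.lineMap (I.S b) (I.target b + v) t)) (disc (I.S a)) ∧
      Disjoint (disc (AffineMap.lineMap (I.S a) (I.target a + v) t)) (disc (I.target b + v)) := by
  simp only [Inst.Blocks, Bool.exists_bool, not_or, disjoint_disc_iff]
  change ¬ (disc (I.target b + v) ∩ hippodrome (I.S a) (I.target a + v)).Nonempty ∧
    ¬ (disc (I.S a) ∩ hippodrome (I.S b) (I.target b + v)).Nonempty ↔ _
  rw [mem_hippodrome_iff, mem_hippodrome_iff]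
  push Not
  constructor
  · rintro ⟨h1, h2⟩ t ht
    exact ⟨h2 t ht, h1 t ht⟩
  · intro h
    exact ⟨fun t ht => (h t ht).2, fun t ht => (h t ht).1⟩

/-- Every requirement on an itinerary concerns two pairs only, so valid itineraries are exactly the
linear orders compatible with `Blocks`. -/
theorem Inst.mem_Q_iff {n : ℕ} (I : Inst n) (v : Plane) :
    v ∈ I.Q ↔ ∃ π : Equiv.Perm (Fin n), ∀ k l, k < l → ¬ I.Blocks v (π l) (π k) := by
  refine exists_congr fun π => ?_
  simp only [Inst.not_blocks_iff, Inst.ValidItinerary]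
  constructor
  · intro h k l hkl t ht
    exact ⟨(h k t ht).1 l hkl, (h l t ht).2 k hkl⟩
  · intro h k t ht
    exact ⟨fun l hl => (h k l hl t ht).1, fun l hl => (h l k hl t ht).2⟩

/-- Validity depends on the translation only through the set of vippodromes that contain it. -/
theorem Inst.mem_Q_congr {n : ℕ} (I : Inst n) {v w : Plane}
    (h : ∀ a b, a ≠ b → ∀ τ, v ∈ I.vippodrome a b τ ↔ w ∈ I.vippodrome a b τ) :
    v ∈ I.Q ↔ w ∈ I.Q := by
  rw [I.mem_Q_iff, I.mem_Q_iff]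
  refine exists_congr fun π => forall_congr' fun k => forall_congr' fun l =>
    forall_congr' fun hkl => not_congr (exists_congr fun τ => h _ _ ?_ τ)
  exact π.injective.ne hkl.ne'

/-- A valid translation that is not an interior point of the set of valid translations lies on a
vippodrome boundary. -/
theorem Inst.frontier_Q_subset {n : ℕ} (I : Inst n) {v : Plane} (hv : v ∈ frontier I.Q) :
    ∃ a b, a ≠ b ∧ ∃ τ, v ∈ I.bdry a b τ := by
  by_contra! hcon
  have key : ∀ᶠ w in 𝓝 v, ∀ a b, a ≠ b → ∀ τ,
      (v ∈ I.vippodrome a b τ ↔ w ∈ I.vippodrome a b τ) := by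
    rw [Filter.eventually_all]; intro a
    rw [Filter.eventually_all]; intro b
    rw [Filter.eventually_imp_distrib_left]; intro hab
    rw [Filter.eventually_all]; intro τ
    have hvb := hcon a b hab τ
    by_cases hin : v ∈ I.vippodrome a b τ
    · filter_upwards [(I.isOpen_vippodrome hab τ).mem_nhds hin] with w hw
      exact iff_of_true hin hw
    · have : v ∉ closure (I.vippodrome a b τ) := fun hc =>
        hvb (by rw [Inst.bdry, (I.isOpen_vippodrome hab τ).frontier_eq]; exact ⟨hc, hin⟩)
      filter_upwards [isClosed_closure.isOpen_compl.mem_nhds this] with w hw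
      exact iff_of_false hin fun h => hw (subset_closure h)
  have hQ : ∀ᶠ w in 𝓝 v, v ∈ I.Q ↔ w ∈ I.Q := key.mono fun w hw => I.mem_Q_congr hw
  rw [frontier_eq_closure_inter_closure] at hv
  obtain ⟨x, hx, hxQ⟩ := mem_closure_iff_nhds.1 hv.1 _ hQ
  obtain ⟨y, hy, hyQ⟩ := mem_closure_iff_nhds.1 hv.2 _ hQ
  exact hyQ (Iff.mp hy (Iff.mpr hx hxQ))

/-- Vippodromes are open, and `Q` is a finite union, over all orders, of intersections of their
complements. -/
theorem Inst.isClosed_Q {n : ℕ} (I : Inst n) : IsClosed I.Q := by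
  have : I.Q = ⋃ π : Equiv.Perm (Fin n), ⋂ k, ⋂ l, ⋂ _ : k < l, ⋂ τ,
      (I.vippodrome (π l) (π k) τ)ᶜ := by
    ext v
    simp only [I.mem_Q_iff, mem_iUnion, mem_iInter, Inst.Blocks, not_exists, mem_compl_iff]
  rw [this]
  refine isClosed_iUnion_of_finite fun π => isClosed_iInter fun k => isClosed_iInter fun l =>
    isClosed_iInter fun hkl => isClosed_iInter fun τ => ?_
  exact (I.isOpen_vippodrome (π.injective.ne hkl.ne') τ).isClosed_compl

/-- If a point of the central region is not valid, then every valid translation is at least as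
costly as one on a vippodrome boundary. -/
theorem Inst.exists_mem_bdry_area_le {n : ℕ} (hn : 1 ≤ n) (I : Inst n) {v₀ w : Plane}
    (hv₀ : v₀ ∈ I.R₀) (hv₀Q : v₀ ∉ I.Q) (hw : w ∈ I.Q) :
    ∃ a b, a ≠ b ∧ ∃ τ, ∃ v ∈ I.bdry a b τ, v ∈ I.Q ∧ I.area v ≤ I.area w := by
  have hseg : (segment ℝ w v₀ ∩ frontier I.Q).Nonempty := by
    by_contra hemp
    have hnot : ∀ x ∈ segment ℝ w v₀, x ∉ frontier I.Q := fun x hx hxf => hemp ⟨x, hx, hxf⟩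
    have hwi : w ∈ interior I.Q := by
      by_contra h
      exact hnot w (left_mem_segment ℝ _ _) ⟨subset_closure hw, h⟩
    -- A segment that misses the frontier would be covered by two disjoint open sets, both of which
    -- it meets; this contradicts connectedness.
    have hcover : segment ℝ w v₀ ⊆ interior I.Q ∪ I.Qᶜ := by
      intro x hx
      by_cases hxQ : x ∈ I.Q
      · exact .inl (by_contra fun h => hnot x hx ⟨subset_closure hxQ, h⟩)
      · exact .inr hxQ
    obtain ⟨x, -, hx1, hx2⟩ := (convex_segment w v₀).isPreconnected _ _ isOpen_interior
      I.isClosed_Q.isOpen_compl hcover ⟨w, left_mem_segment ℝ _ _, hwi⟩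
      ⟨v₀, right_mem_segment ℝ _ _, hv₀Q⟩
    exact hx2 (interior_subset hx1)
  obtain ⟨v, hv, hvf⟩ := hseg
  obtain ⟨a, b, hab, τ, hvb⟩ := I.frontier_Q_subset hvf
  refine ⟨a, b, hab, τ, v, hvb, I.isClosed_Q.frontier_subset hvf, ?_⟩
  rw [segment_eq_image_lineMap] at hv
  obtain ⟨t, ht, rfl⟩ := hv
  exact I.area_lineMap_le hn hv₀ ht

/-! ### Functions of the position along a boundary piece -/

/-- The coefficients of `x₀ + x₁ s + x₂ √(4 - s²)`. -/
structure Lin (α : Type) where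
  x₀ : α
  x₁ : α
  x₂ : α

/-- The coefficients of `a₀ + a₁ s + a₂ s² + (b₀ + b₁ s) √(4 - s²)`. -/
structure Quin (α : Type) where
  a₀ : α
  a₁ : α
  a₂ : α
  b₀ : α
  b₁ : α

noncomputable def Lin.val (p : Lin ℝ) (s : ℝ) : ℝ := p.x₀ + p.x₁ * s + p.x₂ * Real.sqrt (4 - s ^ 2)

noncomputable def Quin.val (q : Quin ℝ) (s : ℝ) : ℝ :=
  q.a₀ + q.a₁ * s + q.a₂ * s ^ 2 + (q.b₀ + q.b₁ * s) * Real.sqrt (4 - s ^ 2)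

/-- The real roots of the polynomial
`(a₀ + a₁ s + a₂ s²)² - (b₀ + b₁ s)² (4 - s²)`, which include the zeros of `q`. -/
noncomputable def Quin.root (q : Quin ℝ) (k : ℕ) : ℝ :=
  quarticRoot (q.a₀ * q.a₀ - 4 * (q.b₀ * q.b₀)) (2 * (q.a₀ * q.a₁) - 8 * (q.b₀ * q.b₁))
    (q.a₁ * q.a₁ + 2 * (q.a₀ * q.a₂) - 4 * (q.b₁ * q.b₁) + q.b₀ * q.b₀)
    (2 * (q.a₁ * q.a₂) + 2 * (q.b₀ * q.b₁)) (q.a₂ * q.a₂ + q.b₁ * q.b₁) k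

/-- A nonzero polynomial of degree at most 4 has at most four distinct roots, so four indices reach
all of them. The zero polynomial has to be excluded, since `quarticRoot` then only returns its
default value. -/
theorem exists_quarticRoot_eq {a₀ a₁ a₂ a₃ a₄ z : ℝ}
    (h : ¬ (a₀ = 0 ∧ a₁ = 0 ∧ a₂ = 0 ∧ a₃ = 0 ∧ a₄ = 0))
    (hz : a₀ + a₁ * z + a₂ * z ^ 2 + a₃ * z ^ 3 + a₄ * z ^ 4 = 0) :
    ∃ k < 4, quarticRoot a₀ a₁ a₂ a₃ a₄ k = z := by
  set P : Polynomial ℝ := Polynomial.C a₀ + Polynomial.C a₁ * Polynomial.X +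
    Polynomial.C a₂ * Polynomial.X ^ 2 + Polynomial.C a₃ * Polynomial.X ^ 3 +
    Polynomial.C a₄ * Polynomial.X ^ 4 with hP
  have hP0 : P ≠ 0 := by
    intro h0
    have hc (k : ℕ) : P.coeff k = 0 := by rw [h0]; simp
    have c0 := hc 0
    have c1 := hc 1
    have c2 := hc 2
    have c3 := hc 3
    have c4 := hc 4
    simp [hP, Polynomial.coeff_X, Polynomial.coeff_C] at c0 c1 c2 c3 c4
    exact h ⟨c0, c1, c2, c3, c4⟩
  have hmem : z ∈ P.roots.toFinset.sort := by
    rw [Finset.mem_sort, Multiset.mem_toFinset, Polynomial.mem_roots hP0]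
    simpa [hP, Polynomial.IsRoot] using hz
  obtain ⟨k, hk, hkz⟩ := List.mem_iff_getElem.1 hmem
  have hdeg : P.natDegree ≤ 4 := by rw [hP]; compute_degree
  have hlen : (P.roots.toFinset.sort).length ≤ 4 := by
    rw [Finset.length_sort]
    exact (Multiset.toFinset_card_le _).trans ((Polynomial.card_roots' P).trans hdeg)
  refine ⟨k, hk.trans_le hlen, ?_⟩
  rw [quarticRoot, ← hP, List.getD_eq_getElem _ _ hk, hkz]

/-- The function can be evaluated as intended on the `p`-th piece. -/
def Quin.Fits (q : Quin ℝ) (p : Fin 3) : Prop := p = 1 ∨ (q.b₀ = 0 ∧ q.b₁ = 0)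

/-- On the rays the function must not involve `√(4 - s²)`, which takes the default value 0 as soon
as `s² > 4`. -/
def Lin.Fits (q : Lin ℝ) (p : Fin 3) : Prop := p = 1 ∨ q.x₂ = 0

/-- The pieces of the boundary curve: a ray, a circular arc, and a ray. -/
def piece (l : ℝ) (p : Fin 3) : Set ℝ := zone (-junction l) (junction l) p

theorem sq_lt_four_of_mem_piece {l s : ℝ} (hl : 2 ≤ l) (hs : s ∈ piece l 1) : s ^ 2 < 4 :=
  sq_lt_four_of_abs_le_junction hl (abs_le.2 (mem_zone_one.1 hs))

/-- The polynomial vanishes identically only for `q = 0`: its leading coefficient `a₂² + b₁²` is a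
sum of squares, after which the coefficient of `s²` reduces to `a₁² + b₀²`, and finally the constant
term to `a₀²`. -/
theorem Quin.root_of_sq_eq {q : Quin ℝ} {z : ℝ}
    (h : (q.a₀ + q.a₁ * z + q.a₂ * z ^ 2) ^ 2 = (q.b₀ + q.b₁ * z) ^ 2 * (4 - z ^ 2)) :
    (∃ k < 4, q.root k = z) ∨ q = ⟨0, 0, 0, 0, 0⟩ := by
  by_cases h0 : q.a₀ * q.a₀ - 4 * (q.b₀ * q.b₀) = 0 ∧ 2 * (q.a₀ * q.a₁) - 8 * (q.b₀ * q.b₁) = 0 ∧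
    q.a₁ * q.a₁ + 2 * (q.a₀ * q.a₂) - 4 * (q.b₁ * q.b₁) + q.b₀ * q.b₀ = 0 ∧
    2 * (q.a₁ * q.a₂) + 2 * (q.b₀ * q.b₁) = 0 ∧ q.a₂ * q.a₂ + q.b₁ * q.b₁ = 0
  · right
    obtain ⟨a₀, a₁, a₂, b₀, b₁⟩ := q
    obtain ⟨h1, h2, h3, h4, h5⟩ := h0
    dsimp only at h1 h2 h3 h4 h5
    have e2 : a₂ = 0 := mul_self_eq_zero.1 (by nlinarith [mul_self_nonneg a₂, mul_self_nonneg b₁])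
    have e4 : b₁ = 0 := mul_self_eq_zero.1 (by nlinarith [mul_self_nonneg a₂, mul_self_nonneg b₁])
    subst e2 e4
    have e1 : a₁ = 0 := mul_self_eq_zero.1 (by nlinarith [mul_self_nonneg a₁, mul_self_nonneg b₀])
    have e3 : b₀ = 0 := mul_self_eq_zero.1 (by nlinarith [mul_self_nonneg a₁, mul_self_nonneg b₀])
    subst e1 e3
    have e0 : a₀ = 0 := mul_self_eq_zero.1 (by linarith)
    rw [e0]
  · left
    exact exists_quarticRoot_eq h0 (by linear_combination h)

theorem Quin.root_of_val_eq_zero {q : Quin ℝ} {p : Fin 3} (hq : q.Fits p) {l z : ℝ} (hl : 2 ≤ l)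
    (hz : z ∈ piece l p) (h : q.val z = 0) :
    (∃ k < 4, q.root k = z) ∨ q = ⟨0, 0, 0, 0, 0⟩ := by
  refine Quin.root_of_sq_eq ?_
  unfold Quin.val at h
  rcases hq with rfl | ⟨hb0, hb1⟩
  · have hr := Real.sq_sqrt (show 0 ≤ 4 - z ^ 2 by linarith [sq_lt_four_of_mem_piece hl hz])
    set r := Real.sqrt (4 - z ^ 2)
    linear_combination (q.a₀ + q.a₁ * z + q.a₂ * z ^ 2 - (q.b₀ + q.b₁ * z) * r) * h +
      (q.b₀ + q.b₁ * z) ^ 2 * hr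
  · rw [hb0, hb1] at h ⊢
    linear_combination (q.a₀ + q.a₁ * z + q.a₂ * z ^ 2) * h

/-! ### Constancy of signs between roots -/

theorem sign_eq_of_forall_ne_zero {f : ℝ → ℝ} {x y : ℝ} (hf : ContinuousOn f (uIcc x y))
    (h : ∀ z ∈ uIcc x y, f z ≠ 0) : SignType.sign (f x) = SignType.sign (f y) := by
  have h0 : (0 : ℝ) ∉ uIcc (f x) (f y) := fun h0 => by
    obtain ⟨z, hz, hz0⟩ := intermediate_value_uIcc hf h0
    exact h z hz hz0
  have hx := h x left_mem_uIcc
  have hy := h y right_mem_uIcc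
  rw [mem_uIcc] at h0
  rcases hx.lt_or_gt with hx | hx <;> rcases hy.lt_or_gt with hy | hy
  · rw [sign_neg hx, sign_neg hy]
  · exact absurd (.inl ⟨hx.le, hy.le⟩) h0
  · exact absurd (.inr ⟨hy.le, hx.le⟩) h0
  · rw [sign_pos hx, sign_pos hy]

theorem ordConnected_zone (x₁ x₂ : ℝ) (i : Fin 3) : OrdConnected (zone x₁ x₂ i) := by
  fin_cases i
  · exact ordConnected_Iic
  · exact ordConnected_Icc
  · exact ordConnected_Ici

theorem Quin.continuous_val (q : Quin ℝ) : Continuous q.val := by unfold Quin.val; fun_prop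

/-- Between its roots, the function keeps its sign. -/
theorem Quin.sign_val_eq {q : Quin ℝ} {p : Fin 3} (hq : q.Fits p) {l x y : ℝ} (hl : 2 ≤ l)
    (hx : x ∈ piece l p) (hy : y ∈ piece l p) (h : ∀ z ∈ uIcc x y, ∀ k < 4, q.root k ≠ z) :
    SignType.sign (q.val x) = SignType.sign (q.val y) := by
  by_cases h0 : q = ⟨0, 0, 0, 0, 0⟩
  · simp [h0, Quin.val]
  refine sign_eq_of_forall_ne_zero q.continuous_val.continuousOn fun z hz hz0 => ?_
  have hzp : z ∈ piece l p := (ordConnected_zone _ _ _).uIcc_subset hx hy hz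
  obtain ⟨k, hk, hkz⟩ | h0' := q.root_of_val_eq_zero hq hl hzp hz0
  · exact h z hz k hk hkz
  · exact h0 h0'

theorem sign_sub_eq_iff {x y a : ℝ} (h : SignType.sign (x - a) = SignType.sign (y - a)) :
    (x ≤ a ↔ y ≤ a) ∧ (a ≤ x ↔ a ≤ y) := by
  constructor
  · rw [← not_lt, ← not_lt, ← sub_pos, ← sub_pos (a := y), ← sign_eq_one_iff, h, sign_eq_one_iff]
  · rw [← not_lt, ← not_lt, ← sub_neg, ← sub_neg (a := y), ← sign_eq_neg_one_iff, h,
      sign_eq_neg_one_iff]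

theorem mem_zone_of_sign_eq {x y x₁ x₂ : ℝ} {i : Fin 3} (hx : x ∈ zone x₁ x₂ i)
    (h1 : SignType.sign (x - x₁) = SignType.sign (y - x₁))
    (h2 : SignType.sign (x - x₂) = SignType.sign (y - x₂)) : y ∈ zone x₁ x₂ i := by
  have h1 := sign_sub_eq_iff h1
  have h2 := sign_sub_eq_iff h2
  fin_cases i
  · exact h1.1.1 hx
  · exact ⟨h1.2.1 hx.1, h2.1.1 hx.2⟩
  · exact h2.2.1 hx

theorem mem_zone_of_notMem_uIcc {x y x₁ x₂ : ℝ} {i : Fin 3} (hx : x ∈ zone x₁ x₂ i)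
    (h1 : x₁ ∉ uIcc x y) (h2 : x₂ ∉ uIcc x y) : y ∈ zone x₁ x₂ i := by
  refine mem_zone_of_sign_eq hx ?_ ?_
  · exact sign_eq_of_forall_ne_zero (f := fun z => z - x₁) (by fun_prop)
      fun z hz hz0 => h1 (sub_eq_zero.1 hz0 ▸ hz)
  · exact sign_eq_of_forall_ne_zero (f := fun z => z - x₂) (by fun_prop)
      fun z hz hz0 => h2 (sub_eq_zero.1 hz0 ▸ hz)

/-! ### Arithmetic of coefficients -/

/-- `c + c₁ p + c₂ q`. -/
def Lin.comb (c c₁ : ℝ) (p : Lin ℝ) (c₂ : ℝ) (q : Lin ℝ) : Lin ℝ :=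
  ⟨c + c₁ * p.x₀ + c₂ * q.x₀, c₁ * p.x₁ + c₂ * q.x₁, c₁ * p.x₂ + c₂ * q.x₂⟩

theorem Lin.val_comb (c c₁ : ℝ) (p : Lin ℝ) (c₂ : ℝ) (q : Lin ℝ) (s : ℝ) :
    (Lin.comb c c₁ p c₂ q).val s = c + c₁ * p.val s + c₂ * q.val s := by
  simp only [Lin.val, Lin.comb]; ring

theorem Lin.fits_comb {c c₁ : ℝ} {p : Lin ℝ} {c₂ : ℝ} {q : Lin ℝ} {i : Fin 3} (hp : p.Fits i)
    (hq : q.Fits i) : (Lin.comb c c₁ p c₂ q).Fits i := by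
  rcases hp with h | h
  · exact .inl h
  rcases hq with h' | h'
  · exact .inl h'
  · right; simp [Lin.comb, h, h']

/-- `p + x` as a function of five coefficients. -/
def Lin.toQuin (p : Lin ℝ) (x : ℝ) : Quin ℝ := ⟨p.x₀ + x, p.x₁, 0, p.x₂, 0⟩

theorem Lin.val_toQuin (p : Lin ℝ) (x s : ℝ) : (p.toQuin x).val s = p.val s + x := by
  simp only [Lin.toQuin, Quin.val, Lin.val]; ring

theorem Lin.fits_toQuin {p : Lin ℝ} {x : ℝ} {i : Fin 3} (hp : p.Fits i) : (p.toQuin x).Fits i :=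
  hp.imp_right fun h => ⟨h, rfl⟩

/-- The product. -/
def Lin.mul (p r : Lin ℝ) : Quin ℝ :=
  ⟨p.x₀ * r.x₀ + 4 * (p.x₂ * r.x₂), p.x₀ * r.x₁ + p.x₁ * r.x₀, p.x₁ * r.x₁ - p.x₂ * r.x₂,
    p.x₀ * r.x₂ + p.x₂ * r.x₀, p.x₁ * r.x₂ + p.x₂ * r.x₁⟩

theorem Lin.fits_mul {p r : Lin ℝ} {i : Fin 3} (hp : p.Fits i) (hr : r.Fits i) :
    (p.mul r).Fits i := by
  rcases hp with h | h
  · exact .inl h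
  rcases hr with h' | h'
  · exact .inl h'
  · right; simp [Lin.mul, h, h']

/-- The product of the two square roots may be replaced by `4 - s²` on the arc, where the radicand
is positive. On a ray it does not occur, since one factor has no root term. -/
theorem Lin.val_mul {p r : Lin ℝ} {i : Fin 3} (hp : p.Fits i) {l s : ℝ}
    (hl : 2 ≤ l) (hs : s ∈ piece l i) : (p.mul r).val s = p.val s * r.val s := by
  simp only [Lin.mul, Quin.val, Lin.val]
  rcases hp with rfl | hp
  · have := Real.sq_sqrt (show 0 ≤ 4 - s ^ 2 by linarith [sq_lt_four_of_mem_piece hl hs])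
    linear_combination (-p.x₂ * r.x₂) * this
  · rw [hp]; ring

def Quin.add (q r : Quin ℝ) : Quin ℝ :=
  ⟨q.a₀ + r.a₀, q.a₁ + r.a₁, q.a₂ + r.a₂, q.b₀ + r.b₀, q.b₁ + r.b₁⟩

theorem Quin.val_add (q r : Quin ℝ) (s : ℝ) : (q.add r).val s = q.val s + r.val s := by
  simp only [Quin.add, Quin.val]; ring

theorem Quin.fits_add {q r : Quin ℝ} {i : Fin 3} (hq : q.Fits i) (hr : r.Fits i) :
    (q.add r).Fits i := by
  rcases hq with h | h
  · exact .inl h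
  rcases hr with h' | h'
  · exact .inl h'
  · right; simp [Quin.add, h, h']

/-- The numerator of the derivative. -/
def Quin.crit (q : Quin ℝ) : Quin ℝ := ⟨4 * q.b₁, 0 - q.b₀, 0 - 2 * q.b₁, q.a₁, 2 * q.a₂⟩

/-- Multiplying the derivative by `√(4 - s²) > 0` keeps its sign and leads back to a function with
five coefficients. Critical points are thus again found as roots of a quartic. -/
theorem Quin.hasDerivAt_mid (q : Quin ℝ) {s : ℝ} (hs : s ^ 2 < 4) :
    HasDerivAt q.val (q.crit.val s / Real.sqrt (4 - s ^ 2)) s := by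
  have hr := Real.sq_sqrt (show 0 ≤ 4 - s ^ 2 by linarith)
  have hpos : 0 < Real.sqrt (4 - s ^ 2) := Real.sqrt_pos.2 (by linarith)
  have h2 : HasDerivAt (fun s : ℝ => s ^ 2) (2 * s) s := by simpa using hasDerivAt_pow 2 s
  have h1 : HasDerivAt (fun s : ℝ => 4 - s ^ 2) (-(2 * s)) s := h2.const_sub 4
  have h3 := h1.sqrt (by linarith : 4 - s ^ 2 ≠ 0)
  have h4 := (((hasDerivAt_id s).const_mul q.a₁).const_add q.a₀).add (h2.const_mul q.a₂)
  have h5 := (((hasDerivAt_id s).const_mul q.b₁).const_add q.b₀).mul h3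
  have h6 := h4.add h5
  refine h6.congr_deriv ?_
  simp only [Quin.crit, Quin.val, id]
  set r := Real.sqrt (4 - s ^ 2)
  field_simp
  linear_combination (q.b₁) * hr

theorem Quin.hasDerivAt_ray {q : Quin ℝ} (h0 : q.b₀ = 0) (h1 : q.b₁ = 0) (s : ℝ) :
    HasDerivAt q.val (q.a₁ + 2 * q.a₂ * s) s := by
  have h2 : HasDerivAt (fun s : ℝ => s ^ 2) (2 * s) s := by simpa using hasDerivAt_pow 2 s
  have h4 := (((hasDerivAt_id s).const_mul q.a₁).const_add q.a₀).add (h2.const_mul q.a₂)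
  have : q.val = (fun s => q.a₀ + q.a₁ * id s) + fun s => q.a₂ * s ^ 2 := by
    funext s; simp [Quin.val, h0, h1]
  rw [this]
  exact h4.congr_deriv (by ring)

/-! ### The pieces of a vippodrome boundary -/

/-- The coefficients of `profile` on the pieces. -/
noncomputable def profileLin (l : ℝ) : Fin 3 → Lin ℝ :=
  ![⟨0, 0 - raySlope l, 0⟩, ⟨l, 0, 0 - 1⟩, ⟨0, raySlope l, 0⟩]

theorem profile_eq_val {l s : ℝ} (hl : 2 ≤ l) {p : Fin 3} (hs : s ∈ piece l p) :
    profile l s = (profileLin l p).val s := by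
  fin_cases p
  · rw [profile_left hs]; simp [profileLin, Lin.val]
  · rw [profile_mid hl (abs_le.2 hs)]; simp [profileLin, Lin.val]; ring
  · rw [profile_right hl hs]; simp [profileLin, Lin.val]

theorem profileLin_fits (l : ℝ) (p : Fin 3) : (profileLin l p).Fits p := by
  fin_cases p <;> simp [Lin.Fits, profileLin]

/-- The coefficients of the `k`-th coordinate on the `p`-th piece of a boundary curve. -/
noncomputable def Inst.curveLin {n : ℕ} (I : Inst n) (a b : Fin n) (τ : Bool) (p : Fin 3) :
    Fin 2 → Lin ℝ :=
  let l := I.len a b τ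
  let q := profileLin l p
  ![⟨I.axis a b τ 0 * q.x₀ / l - I.off a b τ 0,
      (I.axis a b τ 0 * q.x₁ - I.axis a b τ 1) / l, I.axis a b τ 0 * q.x₂ / l⟩,
    ⟨I.axis a b τ 1 * q.x₀ / l - I.off a b τ 1,
      (I.axis a b τ 1 * q.x₁ + I.axis a b τ 0) / l, I.axis a b τ 1 * q.x₂ / l⟩]

theorem Inst.curve_apply {n : ℕ} (I : Inst n) {a b : Fin n} (hab : a ≠ b) (τ : Bool) {p : Fin 3}
    {s : ℝ} (hs : s ∈ piece (I.len a b τ) p) (k : Fin 2) :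
    I.curve a b τ s k = (I.curveLin a b τ p k).val s := by
  have hl := I.two_le_len hab τ
  fin_cases k <;>
  · simp [Inst.curve, Inst.curveLin, profile_eq_val hl hs, Lin.val]
    ring

theorem Inst.curveLin_fits {n : ℕ} (I : Inst n) (a b : Fin n) (τ : Bool) (p : Fin 3)
    (k : Fin 2) : (I.curveLin a b τ p k).Fits p := by
  refine (profileLin_fits (I.len a b τ) p).imp_right fun h => ?_
  fin_cases k <;> simp [Inst.curveLin, h]

theorem Inst.continuous_curve {n : ℕ} (I : Inst n) {a b : Fin n} (hab : a ≠ b) (τ : Bool) :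
    Continuous (I.curve a b τ) := by
  have := continuous_profile (I.two_le_len hab τ)
  unfold Inst.curve
  refine (PiLp.continuous_toLp 2 _).comp (continuous_pi fun k => ?_)
  fin_cases k <;> simp <;> fun_prop

/-! ### Breakpoints -/

/-- The functions whose zeros divide a piece of the boundary into intervals on which the area is
monotone: the crossings with the lines between the regions, and the critical points. -/
noncomputable def Inst.areaQuins {n : ℕ} (I : Inst n) (a b : Fin n) (τ : Bool) (p : Fin 3) :
    List (Quin ℝ) :=
  [(I.curveLin a b τ p 0).toQuin (0 - I.brkLo 0), (I.curveLin a b τ p 0).toQuin (0 - I.brkHi 0),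
    (I.curveLin a b τ p 1).toQuin (0 - I.brkLo 1), (I.curveLin a b τ p 1).toQuin (0 - I.brkHi 1)] ++
  (List.finRange 3).flatMap fun i => (List.finRange 3).map fun j =>
    ((Lin.comb (I.offs 0 i) (slope i) (I.curveLin a b τ p 0) 0 (I.curveLin a b τ p 0)).mul
      (Lin.comb (I.offs 1 j) (slope j) (I.curveLin a b τ p 1) 0 (I.curveLin a b τ p 1))).crit

/-- The breakpoints on a boundary curve. -/
noncomputable def Inst.breakpoints {n : ℕ} (I : Inst n) (a b : Fin n) (τ : Bool) : List ℝ :=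
  [0 - junction (I.len a b τ), junction (I.len a b τ)] ++
  (List.finRange 3).flatMap fun p => (I.areaQuins a b τ p).flatMap fun q =>
    (List.range 4).map fun k => q.root k

theorem Inst.continuous_width {n : ℕ} (I : Inst n) (k : Fin 2) : Continuous (I.width k) := by
  unfold Inst.width; fun_prop

/-- Coercivity ensures that a descent along an unbounded ray cannot continue for ever. Each width
grows at least like the absolute value of its coordinate, the position is bounded by the sum of the
two shifted coordinates in absolute value, and the product of two numbers that are at least 2 is at
least their sum. -/
theorem Inst.exists_abs_sub_le_area {n : ℕ} (hn : 1 ≤ n) (I : Inst n) {a b : Fin n} (hab : a ≠ b)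
    (τ : Bool) : ∃ c, ∀ s, |s| - c ≤ I.area (I.curve a b τ s) := by
  have hw (k : Fin 2) : ∃ c, ∀ x, |x| - c ≤ I.width k x := by
    refine ⟨|hi (discs I.T) k - lo (discs I.S) k| + |hi (discs I.S) k - lo (discs I.T) k|,
      fun x => ?_⟩
    unfold Inst.width
    have h1 := le_max_left (hi (discs I.S) k) (hi (discs I.T) k + x)
    have h2 := le_max_right (hi (discs I.S) k) (hi (discs I.T) k + x)
    have h3 := min_le_left (lo (discs I.S) k) (lo (discs I.T) k + x)
    have h4 := min_le_right (lo (discs I.S) k) (lo (discs I.T) k + x)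
    have h5 := neg_abs_le (hi (discs I.T) k - lo (discs I.S) k)
    have h6 := neg_abs_le (hi (discs I.S) k - lo (discs I.T) k)
    have h7 := abs_nonneg (hi (discs I.T) k - lo (discs I.S) k)
    have h8 := abs_nonneg (hi (discs I.S) k - lo (discs I.T) k)
    rcases abs_cases x with ⟨h, -⟩ | ⟨h, -⟩ <;> rw [h] <;> linarith
  obtain ⟨c₀, h0⟩ := hw 0
  obtain ⟨c₁, h1⟩ := hw 1
  refine ⟨c₀ + c₁ + |I.off a b τ 0| + |I.off a b τ 1|, fun s => ?_⟩
  set v := I.curve a b τ s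
  have hs : |s| ≤ |v 0 + I.off a b τ 0| + |v 1 + I.off a b τ 1| := by
    have hl : 0 < I.len a b τ := by linarith [I.two_le_len hab τ]
    have hd := I.len_sq a b τ
    have hd0 : |I.axis a b τ 0| ≤ I.len a b τ := abs_le_of_sq_le_sq (by nlinarith) hl.le
    have hd1 : |I.axis a b τ 1| ≤ I.len a b τ := abs_le_of_sq_le_sq (by nlinarith) hl.le
    rw [← I.sc_curve hab τ s, Inst.sc, abs_div, abs_of_pos hl, div_le_iff₀ hl]
    refine (abs_sub _ _).trans ?_
    rw [abs_mul, abs_mul]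
    nlinarith [mul_le_mul_of_nonneg_right hd0 (abs_nonneg (v 1 + I.off a b τ 1)),
      mul_le_mul_of_nonneg_right hd1 (abs_nonneg (v 0 + I.off a b τ 0))]
  have := abs_add_le (v 0) (I.off a b τ 0)
  have := abs_add_le (v 1) (I.off a b τ 1)
  rw [I.area_eq hn]
  nlinarith [I.two_le_width hn 0 (v 0), I.two_le_width hn 1 (v 1), h0 (v 0), h1 (v 1)]

/-- A coercive function which has no critical point off a finite set does not increase on the way
from a point to one of its neighbours in the finite set. -/
theorem exists_descent {f : ℝ → ℝ} (hf : Continuous f) {c : ℝ} (hc : ∀ s, |s| - c ≤ f s)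
    (B : Finset ℝ) {s : ℝ}
    (h : (∀ z, (∀ w ∈ uIcc z s, w ∉ B) → DifferentiableAt ℝ f z ∧ 0 ≤ deriv f z) ∨
      (∀ z, (∀ w ∈ uIcc z s, w ∉ B) → DifferentiableAt ℝ f z ∧ deriv f z ≤ 0)) :
    ∃ p ∈ B, ∀ z ∈ uIcc p s, f z ≤ f s := by
  rcases h with h | h
  · by_cases hB : (B.filter (· ≤ s)).Nonempty
    · obtain ⟨p, hp, hmax⟩ := (B.filter (· ≤ s)).exists_max_image id hB
      rw [Finset.mem_filter] at hp
      have hfree : ∀ z ∈ Ioo p s, ∀ w ∈ uIcc z s, w ∉ B := by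
        intro z hz w hw hwB
        rw [uIcc_of_le hz.2.le] at hw
        have := hmax w (Finset.mem_filter.2 ⟨hwB, hw.2⟩)
        simp only [id] at this
        linarith [hz.1, hw.1]
      have hmono : MonotoneOn f (Icc p s) := by
        refine monotoneOn_of_deriv_nonneg (convex_Icc p s) hf.continuousOn ?_ ?_
        · rw [interior_Icc]
          exact fun z hz => (h z (hfree z hz)).1.differentiableWithinAt
        · rw [interior_Icc]
          exact fun z hz => (h z (hfree z hz)).2
      refine ⟨p, hp.1, fun z hz => ?_⟩
      rw [uIcc_of_le hp.2] at hz
      exact hmono hz (right_mem_Icc.2 hp.2) hz.2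
    · exfalso
      have hfree : ∀ z ∈ Iic s, ∀ w ∈ uIcc z s, w ∉ B := by
        intro z hz w hw hwB
        rw [uIcc_of_le hz] at hw
        exact hB ⟨w, Finset.mem_filter.2 ⟨hwB, hw.2⟩⟩
      have hmono : MonotoneOn f (Iic s) := by
        refine monotoneOn_of_deriv_nonneg (convex_Iic s) hf.continuousOn ?_ ?_
        · exact fun z hz => (h z (hfree z (interior_subset hz))).1.differentiableWithinAt
        · exact fun z hz => (h z (hfree z (interior_subset hz))).2
      -- So far out that the lower bound `|z| - c` exceeds `f s`, contradicting monotonicity.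
      set z := min s (-(|f s| + |c| + 1)) with hz
      have hzs : z ≤ s := min_le_left _ _
      have h1 := hmono (mem_Iic.2 hzs) (mem_Iic.2 le_rfl) hzs
      have h2 := hc z
      have h3 : z ≤ -(|f s| + |c| + 1) := min_le_right _ _
      linarith [neg_abs_le z, neg_le_abs z, le_abs_self (f s), le_abs_self c]
  · by_cases hB : (B.filter (s ≤ ·)).Nonempty
    · obtain ⟨p, hp, hmin⟩ := (B.filter (s ≤ ·)).exists_min_image id hB
      rw [Finset.mem_filter] at hp
      have hfree : ∀ z ∈ Ioo s p, ∀ w ∈ uIcc z s, w ∉ B := by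
        intro z hz w hw hwB
        rw [uIcc_of_ge hz.1.le] at hw
        have := hmin w (Finset.mem_filter.2 ⟨hwB, hw.1⟩)
        simp only [id] at this
        linarith [hz.2, hw.2]
      have hanti : AntitoneOn f (Icc s p) := by
        refine antitoneOn_of_deriv_nonpos (convex_Icc s p) hf.continuousOn ?_ ?_
        · rw [interior_Icc]
          exact fun z hz => (h z (hfree z hz)).1.differentiableWithinAt
        · rw [interior_Icc]
          exact fun z hz => (h z (hfree z hz)).2
      refine ⟨p, hp.1, fun z hz => ?_⟩
      rw [uIcc_of_ge hp.2] at hz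
      exact hanti (left_mem_Icc.2 hp.2) hz hz.1
    · exfalso
      have hfree : ∀ z ∈ Ici s, ∀ w ∈ uIcc z s, w ∉ B := by
        intro z hz w hw hwB
        rw [uIcc_of_ge hz] at hw
        exact hB ⟨w, Finset.mem_filter.2 ⟨hwB, hw.1⟩⟩
      have hanti : AntitoneOn f (Ici s) := by
        refine antitoneOn_of_deriv_nonpos (convex_Ici s) hf.continuousOn ?_ ?_
        · exact fun z hz => (h z (hfree z (interior_subset hz))).1.differentiableWithinAt
        · exact fun z hz => (h z (hfree z (interior_subset hz))).2
      set z := max s (|f s| + |c| + 1) with hz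
      have hzs : s ≤ z := le_max_left _ _
      have h1 := hanti (mem_Ici.2 le_rfl) (mem_Ici.2 hzs) hzs
      have h2 := hc z
      have h3 : |f s| + |c| + 1 ≤ z := le_max_right _ _
      linarith [le_abs_self z, le_abs_self (f s), le_abs_self c]

/-- With this, an identity that holds on a breakpoint-free interval holds near each of its points,
so derivatives can be transferred. -/
theorem eventually_uIcc_notMem (B : Finset ℝ) {s z : ℝ} (hz : ∀ w ∈ uIcc z s, w ∉ B) :
    ∀ᶠ z' in 𝓝 z, ∀ w ∈ uIcc z' s, w ∉ B := by
  have hopen : IsOpen ((B : Set ℝ)ᶜ) := B.finite_toSet.isClosed.isOpen_compl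
  obtain ⟨ε, hε, hball⟩ := Metric.isOpen_iff.1 hopen z
    (fun h => hz z left_mem_uIcc (Finset.mem_coe.1 h))
  filter_upwards [Metric.ball_mem_nhds z hε] with z' hz' w hw hwB
  rcases uIcc_subset_uIcc_union_uIcc (b := z) hw with h | h
  · refine hball ?_ (Finset.mem_coe.2 hwB)
    have : OrdConnected (Metric.ball z ε) := (convex_ball z ε).ordConnected
    exact this.uIcc_subset hz' (Metric.mem_ball_self hε) h
  · exact hz w h hwB

/-- Without crossing a breakpoint, the curve stays on one piece and in one region; there the area is
a single function with five coefficients whose derivative keeps its sign. Descending against that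
sign reaches a breakpoint, by coercivity. The inequality is needed on the whole interval, because
the breakpoint may be invalid and the best valid point may be an arc end on the way. -/
theorem Inst.exists_breakpoint {n : ℕ} (hn : 1 ≤ n) (I : Inst n) {a b : Fin n} (hab : a ≠ b)
    (τ : Bool) (s : ℝ) : ∃ p ∈ I.breakpoints a b τ, ∀ z ∈ uIcc p s,
      I.area (I.curve a b τ z) ≤ I.area (I.curve a b τ s) := by
  classical
  set B : Finset ℝ := (I.breakpoints a b τ).toFinset with hB
  by_cases hs : s ∈ B
  · refine ⟨s, List.mem_toFinset.1 hs, fun z hz => ?_⟩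
    rw [uIcc_self, mem_singleton_iff] at hz
    rw [hz]
  have hl := I.two_le_len hab τ
  obtain ⟨c, hc⟩ := I.exists_abs_sub_le_area hn hab τ
  have hcont : Continuous fun z => I.area (I.curve a b τ z) := by
    simp only [I.area_eq hn]
    have h0 := I.continuous_width 0
    have h1 := I.continuous_width 1
    have h2 (k : Fin 2) : Continuous fun z => I.curve a b τ z k :=
      (PiLp.continuous_apply 2 _ k).comp (I.continuous_curve hab τ)
    exact (h0.comp (h2 0)).mul (h1.comp (h2 1))
  have hj1 : 0 - junction (I.len a b τ) ∈ B := List.mem_toFinset.2 (by simp [Inst.breakpoints])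
  have hj2 : junction (I.len a b τ) ∈ B := List.mem_toFinset.2 (by simp [Inst.breakpoints])
  rw [zero_sub] at hj1
  obtain ⟨p, hp⟩ : ∃ p, s ∈ piece (I.len a b τ) p := exists_mem_zone s
  have hpiece {z : ℝ} (hz : ∀ w ∈ uIcc z s, w ∉ B) : z ∈ piece (I.len a b τ) p := by
    rw [uIcc_comm] at hz
    exact mem_zone_of_notMem_uIcc hp (fun h => hz _ h hj1) (fun h => hz _ h hj2)
  have hroot {q : Quin ℝ} (hq : q ∈ I.areaQuins a b τ p) {k : ℕ} (hk : k < 4) :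
      q.root k ∈ B := by
    refine List.mem_toFinset.2 (List.mem_append_right _ ?_)
    exact List.mem_flatMap.2 ⟨p, List.mem_finRange p, List.mem_flatMap.2 ⟨q, hq,
      List.mem_map.2 ⟨k, List.mem_range.2 hk, rfl⟩⟩⟩
  have hsign {q : Quin ℝ} (hq : q ∈ I.areaQuins a b τ p) (hfit : q.Fits p) {z : ℝ}
      (hz : ∀ w ∈ uIcc z s, w ∉ B) : SignType.sign (q.val s) = SignType.sign (q.val z) := by
    refine (q.sign_val_eq hfit hl (hpiece hz) hp fun w hw k hk h => ?_).symm
    exact hz w hw (h ▸ hroot hq hk)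
  obtain ⟨i, hi⟩ := exists_mem_zone (x₁ := I.brkLo 0) (x₂ := I.brkHi 0) (I.curve a b τ s 0)
  obtain ⟨j, hj⟩ := exists_mem_zone (x₁ := I.brkLo 1) (x₂ := I.brkHi 1) (I.curve a b τ s 1)
  have hfit (k : Fin 2) := I.curveLin_fits a b τ p k
  have hregion {z : ℝ} (hz : ∀ w ∈ uIcc z s, w ∉ B) : I.curve a b τ z ∈ I.region i j := by
    have h1 := hsign (q := (I.curveLin a b τ p 0).toQuin (0 - I.brkLo 0))
      (by simp [Inst.areaQuins]) (Lin.fits_toQuin (hfit 0)) hz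
    have h2 := hsign (q := (I.curveLin a b τ p 0).toQuin (0 - I.brkHi 0))
      (by simp [Inst.areaQuins]) (Lin.fits_toQuin (hfit 0)) hz
    have h3 := hsign (q := (I.curveLin a b τ p 1).toQuin (0 - I.brkLo 1))
      (by simp [Inst.areaQuins]) (Lin.fits_toQuin (hfit 1)) hz
    have h4 := hsign (q := (I.curveLin a b τ p 1).toQuin (0 - I.brkHi 1))
      (by simp [Inst.areaQuins]) (Lin.fits_toQuin (hfit 1)) hz
    simp only [Lin.val_toQuin, ← I.curve_apply hab τ (hpiece hz), ← I.curve_apply hab τ hp,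
      zero_sub, ← sub_eq_add_neg] at h1 h2 h3 h4
    exact ⟨mem_zone_of_sign_eq hi h1 h2, mem_zone_of_sign_eq hj h3 h4⟩
  set P := Lin.comb (I.offs 0 i) (slope i) (I.curveLin a b τ p 0) 0 (I.curveLin a b τ p 0)
  set R := Lin.comb (I.offs 1 j) (slope j) (I.curveLin a b τ p 1) 0 (I.curveLin a b τ p 1)
  have hPfit : P.Fits p := Lin.fits_comb (hfit 0) (hfit 0)
  have hRfit : R.Fits p := Lin.fits_comb (hfit 1) (hfit 1)
  have hq : (P.mul R).crit ∈ I.areaQuins a b τ p := by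
    refine List.mem_append_right _ (List.mem_flatMap.2 ⟨i, List.mem_finRange i,
      List.mem_map.2 ⟨j, List.mem_finRange j, rfl⟩⟩)
  have harea {z : ℝ} (hz : ∀ w ∈ uIcc z s, w ∉ B) :
      I.area (I.curve a b τ z) = (P.mul R).val z := by
    rw [I.area_region hn i j (hregion hz), Lin.val_mul hPfit hl (hpiece hz), Lin.val_comb,
      Lin.val_comb, I.curve_apply hab τ (hpiece hz), I.curve_apply hab τ (hpiece hz)]
    ring
  have heq {z : ℝ} (hz : ∀ w ∈ uIcc z s, w ∉ B) :
      (fun z => I.area (I.curve a b τ z)) =ᶠ[𝓝 z] (P.mul R).val :=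
    (eventually_uIcc_notMem B hz).mono fun z' hz' => harea hz'
  have hmulfit : (P.mul R).Fits p := Lin.fits_mul hPfit hRfit
  have hBs : ∀ w ∈ uIcc s s, w ∉ B := by
    intro w hw
    rw [uIcc_self, mem_singleton_iff] at hw
    rwa [hw]
  -- the derivative has the sign of `g`, which is constant
  obtain ⟨g, hg, hder⟩ : ∃ g : ℝ → SignType,
      (∀ z, (∀ w ∈ uIcc z s, w ∉ B) → g z = g s) ∧
      ∀ z, (∀ w ∈ uIcc z s, w ∉ B) → ∃ d, HasDerivAt (fun z => I.area (I.curve a b τ z)) d z ∧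
        SignType.sign d = g z := by
    by_cases hp1 : p = 1
    · subst hp1
      refine ⟨fun z => SignType.sign ((P.mul R).crit.val z), fun z hz =>
        (hsign hq (.inl rfl) hz).symm, fun z hz => ?_⟩
      have hz4 := sq_lt_four_of_mem_piece hl (hpiece hz)
      refine ⟨_, ((P.mul R).hasDerivAt_mid hz4).congr_of_eventuallyEq (heq hz), ?_⟩
      rw [div_eq_mul_inv, sign_mul, sign_pos (inv_pos.2 (Real.sqrt_pos.2 (by linarith))), mul_one]
    · have hb := hmulfit.resolve_left hp1
      refine ⟨fun z => SignType.sign ((P.mul R).a₁ + 2 * (P.mul R).a₂ * z), fun z hz => ?_,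
        fun z hz => ⟨_, (Quin.hasDerivAt_ray hb.1 hb.2 z).congr_of_eventuallyEq (heq hz), rfl⟩⟩
      by_cases h0 : (P.mul R).a₁ = 0 ∧ (P.mul R).a₂ = 0
      · simp [h0.1, h0.2]
      · refine sign_eq_of_forall_ne_zero
          (f := fun z => (P.mul R).a₁ + 2 * (P.mul R).a₂ * z) (by fun_prop) fun w hw hw0 => ?_
        -- On a ray the value of `crit` does not represent the derivative. Its polynomial is `-(a₁ +
        -- 2 a₂ s)² (4 - s²)`, however, and this still vanishes at the critical point.
        obtain ⟨k, hk, hkw⟩ | hcon := (P.mul R).crit.root_of_sq_eq (z := w) (by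
          simp only [Quin.crit, hb.1, hb.2]
          linear_combination (-(4 - w ^ 2) * ((P.mul R).a₁ + 2 * (P.mul R).a₂ * w)) * hw0)
        · exact hz w hw (hkw ▸ hroot hq hk)
        · simp only [Quin.crit, Quin.mk.injEq] at hcon
          exact h0 ⟨hcon.2.2.2.1, by linarith [hcon.2.2.2.2]⟩
  obtain ⟨p, hpB, hfin⟩ : ∃ p ∈ B, ∀ z ∈ uIcc p s,
      I.area (I.curve a b τ z) ≤ I.area (I.curve a b τ s) := by
    refine exists_descent hcont hc B ?_
    rcases le_total 0 (g s) with h | h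
    · refine .inl fun z hz => ?_
      obtain ⟨d, hd, hdz⟩ := hder z hz
      refine ⟨hd.differentiableAt, ?_⟩
      rw [hd.deriv, ← sign_nonneg_iff, hdz, hg z hz]
      exact h
    · refine .inr fun z hz => ?_
      obtain ⟨d, hd, hdz⟩ := hder z hz
      refine ⟨hd.differentiableAt, ?_⟩
      rw [hd.deriv, ← sign_nonpos_iff, hdz, hg z hz]
      exact h
  exact ⟨p, List.mem_toFinset.1 hpB, hfin⟩

/-! ### The number of arcs -/

/-- The functions whose signs determine whether `profile l s < h`. -/
noncomputable def crossQuins (l : ℝ) (s h : Lin ℝ) : List (Quin ℝ) :=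
  let m := Lin.comb (-l) 0 s 1 h
  [s.toQuin (junction l), s.toQuin (-junction l), (Lin.comb 0 (raySlope l) s 1 h).toQuin 0,
    (Lin.comb 0 (-raySlope l) s 1 h).toQuin 0, m.toQuin 0,
    ((s.mul s).add (m.mul m)).add ⟨-4, 0, 0, 0, 0⟩]

/-- Written with polynomial sign conditions only: on the arc, the comparison with `l - √(4 - s²)`
holds if `h` exceeds `l` or if the point lies in the disc of radius 2 about `(0, l)`. This avoids a
nested root when `s` and `h` themselves contain one. -/
theorem profile_lt_iff {l s h : ℝ} (hl : 2 ≤ l) : profile l s < h ↔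
    (s + junction l ≤ 0 ∧ 0 < raySlope l * s + h) ∨
    (¬ s + junction l ≤ 0 ∧ 0 ≤ s + -junction l ∧ 0 < -raySlope l * s + h) ∨
    (¬ s + junction l ≤ 0 ∧ ¬ 0 ≤ s + -junction l ∧
      (0 < -l + h ∨ s * s + (-l + h) * (-l + h) + -4 < 0)) := by
  by_cases h1 : s ≤ -junction l
  · have h1' : s + junction l ≤ 0 := by linarith
    simp only [profile_left h1, h1', true_and, not_true, false_and, or_false]
    constructor <;> intro h <;> linarith
  have h1' : ¬ s + junction l ≤ 0 := fun h => h1 (by linarith)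
  by_cases h2 : junction l ≤ s
  · have h2' : 0 ≤ s + -junction l := by linarith
    simp only [profile_right hl h2, h1', h2', not_true, not_false_eq_true, true_and, false_and,
      or_false, false_or]
    constructor <;> intro h <;> linarith
  have h2' : ¬ 0 ≤ s + -junction l := fun h => h2 (by linarith)
  have habs : |s| ≤ junction l := abs_le.2 ⟨by linarith, by linarith⟩
  have hs4 := sq_lt_four_of_abs_le_junction hl habs
  simp only [profile_mid hl habs, h1', h2', not_false_eq_true, true_and, false_and, false_or]
  have hr : 0 < Real.sqrt (4 - s ^ 2) := Real.sqrt_pos.2 (by linarith)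
  constructor
  · intro hlt
    by_cases h3 : 0 < -l + h
    · exact .inl h3
    · right
      have := (Real.lt_sqrt (by linarith : 0 ≤ l - h)).1 (by linarith)
      nlinarith
  · rintro (hlt | hlt)
    · linarith
    · rcases lt_or_ge l h with h3 | h3
      · linarith
      · have := (Real.lt_sqrt (by linarith : 0 ≤ l - h)).2
          (show (l - h) ^ 2 < 4 - s ^ 2 by nlinarith)
        linarith

theorem sign_iff {x y : ℝ} (h : SignType.sign x = SignType.sign y) :
    (x ≤ 0 ↔ y ≤ 0) ∧ (0 ≤ x ↔ 0 ≤ y) ∧ (x < 0 ↔ y < 0) ∧ (0 < x ↔ 0 < y) := by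
  have h' := sign_sub_eq_iff (a := 0) (by simpa using h)
  exact ⟨h'.1, h'.2, by simpa using not_congr h'.2, by simpa using not_congr h'.1⟩

/-- Here `l` belongs to the curve that is followed and `l'` to the vippodrome that is entered or
left. All conditions in `profile_lt_iff` are signs of functions in `crossQuins`, which cannot change
without a root. -/
theorem profile_lt_congr {l l' x y : ℝ} (hl : 2 ≤ l) (hl' : 2 ≤ l') {s h : Lin ℝ} {p : Fin 3}
    (hs : s.Fits p) (hh : h.Fits p) (hx : x ∈ piece l p) (hy : y ∈ piece l p)
    (hroot : ∀ q ∈ crossQuins l' s h, ∀ k < 4, ∀ z ∈ uIcc x y, q.root k ≠ z) :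
    profile l' (s.val x) < h.val x ↔ profile l' (s.val y) < h.val y := by
  have hsign {q : Quin ℝ} (hq : q ∈ crossQuins l' s h) (hfit : q.Fits p) :=
    sign_iff (q.sign_val_eq hfit hl hx hy fun z hz k hk => hroot q hq k hk z hz)
  have hm : (Lin.comb (-l') 0 s 1 h).Fits p := Lin.fits_comb hs hh
  have h1 := hsign (q := s.toQuin (junction l')) (by simp [crossQuins]) (Lin.fits_toQuin hs)
  have h2 := hsign (q := s.toQuin (-junction l')) (by simp [crossQuins]) (Lin.fits_toQuin hs)
  have h3 := hsign (q := (Lin.comb 0 (raySlope l') s 1 h).toQuin 0) (by simp [crossQuins])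
    (Lin.fits_toQuin (Lin.fits_comb hs hh))
  have h4 := hsign (q := (Lin.comb 0 (-raySlope l') s 1 h).toQuin 0) (by simp [crossQuins])
    (Lin.fits_toQuin (Lin.fits_comb hs hh))
  have h5 := hsign (q := (Lin.comb (-l') 0 s 1 h).toQuin 0) (by simp [crossQuins])
    (Lin.fits_toQuin hm)
  have h6 := hsign (q := ((s.mul s).add ((Lin.comb (-l') 0 s 1 h).mul
    (Lin.comb (-l') 0 s 1 h))).add ⟨-4, 0, 0, 0, 0⟩) (by simp [crossQuins])
    (Quin.fits_add (Quin.fits_add (Lin.fits_mul hs hs) (Lin.fits_mul hm hm)) (.inr ⟨rfl, rfl⟩))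
  have hc (z : ℝ) : (⟨-4, 0, 0, 0, 0⟩ : Quin ℝ).val z = -4 := by simp [Quin.val]
  simp only [Quin.val_add, Lin.val_mul hs hl hx, Lin.val_mul hs hl hy, Lin.val_mul hm hl hx,
    Lin.val_mul hm hl hy, Lin.val_toQuin, Lin.val_comb, add_zero, zero_mul, one_mul, zero_add, hc]
    at h1 h2 h3 h4 h5 h6
  rw [profile_lt_iff hl', profile_lt_iff hl', h1.1, h2.2.1, h3.2.2.2, h4.2.2.2, h5.2.2.2,
    h6.2.2.1]

/-- The coefficients of `sc` for the vippodrome `(a', b', τ')` along a piece of the boundary of the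
vippodrome `(a, b, τ)`. -/
noncomputable def Inst.scLin {n : ℕ} (I : Inst n) (a b : Fin n) (τ : Bool) (p : Fin 3)
    (a' b' : Fin n) (τ' : Bool) : Lin ℝ :=
  let l := I.len a' b' τ'
  let d := I.axis a' b' τ'
  let o := I.off a' b' τ'
  Lin.comb ((d 0 * o 1 - d 1 * o 0) / l) (-d 1 / l) (I.curveLin a b τ p 0) (d 0 / l)
    (I.curveLin a b τ p 1)

/-- The coefficients of `hc` for the vippodrome `(a', b', τ')` along a piece of the boundary of the
vippodrome `(a, b, τ)`. -/
noncomputable def Inst.hcLin {n : ℕ} (I : Inst n) (a b : Fin n) (τ : Bool) (p : Fin 3)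
    (a' b' : Fin n) (τ' : Bool) : Lin ℝ :=
  let l := I.len a' b' τ'
  let d := I.axis a' b' τ'
  let o := I.off a' b' τ'
  Lin.comb ((d 0 * o 0 + d 1 * o 1) / l) (d 0 / l) (I.curveLin a b τ p 0) (d 1 / l)
    (I.curveLin a b τ p 1)

theorem Inst.sc_curve_eq {n : ℕ} (I : Inst n) {a b : Fin n} (hab : a ≠ b) (τ : Bool) {p : Fin 3}
    {s : ℝ} (hs : s ∈ piece (I.len a b τ) p) (a' b' : Fin n) (τ' : Bool) :
    I.sc a' b' τ' (I.curve a b τ s) = (I.scLin a b τ p a' b' τ').val s := by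
  rw [Inst.scLin, Lin.val_comb, ← I.curve_apply hab τ hs, ← I.curve_apply hab τ hs, Inst.sc]
  ring

theorem Inst.hc_curve_eq {n : ℕ} (I : Inst n) {a b : Fin n} (hab : a ≠ b) (τ : Bool) {p : Fin 3}
    {s : ℝ} (hs : s ∈ piece (I.len a b τ) p) (a' b' : Fin n) (τ' : Bool) :
    I.hc a' b' τ' (I.curve a b τ s) = (I.hcLin a b τ p a' b' τ').val s := by
  rw [Inst.hcLin, Lin.val_comb, ← I.curve_apply hab τ hs, ← I.curve_apply hab τ hs, Inst.hc]
  ring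

/-- A finite set of positions between which the boundary curve neither enters nor leaves `Q`. -/
noncomputable def Inst.changes {n : ℕ} (I : Inst n) (a b : Fin n) (τ : Bool) : List ℝ :=
  [-junction (I.len a b τ), junction (I.len a b τ)] ++
  (List.finRange 3).flatMap fun p => (List.finRange n).flatMap fun a' =>
    (List.finRange n).flatMap fun b' => [true, false].flatMap fun τ' =>
      (crossQuins (I.len a' b' τ') (I.scLin a b τ p a' b' τ')
        (I.hcLin a b τ p a' b' τ')).flatMap fun q => (List.range 4).map fun k => q.root k

/-- Each of the `n²` index pairs contributes 3 pieces, 2 types, 6 functions and 4 roots, that is,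
144 positions. The two junctions are added. -/
theorem Inst.length_changes {n : ℕ} (I : Inst n) (a b : Fin n) (τ : Bool) :
    (I.changes a b τ).length = 2 + 144 * (n * n) := by
  simp [Inst.changes, List.length_flatMap, crossQuins]
  ring

theorem Inst.mem_Q_curve_congr {n : ℕ} (I : Inst n) {a b : Fin n} (hab : a ≠ b) (τ : Bool)
    {x y : ℝ} (h : ∀ z ∈ uIcc x y, z ∉ I.changes a b τ) :
    I.curve a b τ x ∈ I.Q ↔ I.curve a b τ y ∈ I.Q := by
  have hl := I.two_le_len hab τ
  obtain ⟨p, hp⟩ : ∃ p, x ∈ piece (I.len a b τ) p := exists_mem_zone x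
  have hy : y ∈ piece (I.len a b τ) p := mem_zone_of_notMem_uIcc hp
    (fun hz => h _ hz (by simp [Inst.changes])) (fun hz => h _ hz (by simp [Inst.changes]))
  refine I.mem_Q_congr fun a' b' hab' τ' => ?_
  rw [I.mem_vippodrome_iff hab', I.mem_vippodrome_iff hab', I.sc_curve_eq hab τ hp,
    I.sc_curve_eq hab τ hy, I.hc_curve_eq hab τ hp, I.hc_curve_eq hab τ hy]
  have hfit (k : Fin 2) := I.curveLin_fits a b τ p k
  refine profile_lt_congr hl (I.two_le_len hab' τ') (Lin.fits_comb (hfit 0) (hfit 1))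
    (Lin.fits_comb (hfit 0) (hfit 1)) hp hy fun q hq k hk z hz hqz => h z hz ?_
  refine List.mem_append_right _ ?_
  simp only [List.mem_flatMap, List.mem_map, List.mem_range, List.mem_finRange, true_and]
  exact ⟨p, a', b', τ', by cases τ' <;> simp, q, hq, k, hk, hqz⟩

/-- Each gap between consecutive arcs contains a position of `F`, and different gaps give different
positions. For the induction, only positions after the start of the first arc are counted, and `Q`
is described only from there on. -/
theorem length_le_card_of_listsArcs {f : ℝ → Plane} {pos : Plane → ℝ} {Q : Set Plane}
    (hpos : ∀ s t, pos (f s) ≤ pos (f t) ↔ s ≤ t) {F : Finset ℝ}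
    (hF : ∀ x y, (∀ z ∈ uIcc x y, z ∉ F) → (f x ∈ Q ↔ f y ∈ Q)) (L : List Arc) (J : Arc)
    (hmem : ∀ K ∈ J :: L, (∀ p ∈ K.1, p ∈ range f) ∧ (∀ q ∈ K.2, q ∈ range f) ∧
      ∀ p ∈ K.1, ∀ q ∈ K.2, pos p ≤ pos q)
    (hpair : (J :: L).Pairwise fun J K => ∃ q ∈ J.2, ∃ p ∈ K.1, pos q < pos p)
    (hQ : ∀ v ∈ range f, (∀ p ∈ J.1, pos p ≤ pos v) → (v ∈ Q ↔ ∃ K ∈ J :: L, OnArc pos K v)) :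
    L.length ≤ (F.filter fun x => ∀ p ∈ J.1, pos p ≤ pos (f x)).card := by
  induction L generalizing J with
  | nil => simp
  | cons K L ih =>
    rw [List.pairwise_cons] at hpair
    obtain ⟨hJ, hpair⟩ := hpair
    obtain ⟨q, hq, p, hp, hlt⟩ := hJ K (by simp)
    have hpq : ∀ p ∈ J.1, pos p ≤ pos q := fun p' hp' => (hmem J (by simp)).2.2 p' hp' q hq
    have hKle : ∀ v, (∀ p ∈ K.1, pos p ≤ pos v) → pos q < pos v := fun v hv =>
      hlt.trans_le (hv p hp)
    have hih := ih K (fun M hM => hmem M (List.mem_cons_of_mem _ hM)) hpair (by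
      intro v hv hKv
      rw [hQ v hv fun p' hp' => (hpq p' hp').trans (hKle v hKv).le]
      constructor
      · rintro ⟨M, hM, hMv⟩
        rcases List.mem_cons.1 hM with rfl | hM
        · exact absurd (hMv.2 q hq) (not_le.2 (hKle v hKv))
        · exact ⟨M, hM, hMv⟩
      · rintro ⟨M, hM, hMv⟩
        exact ⟨M, List.mem_cons_of_mem _ hM, hMv⟩)
    obtain ⟨x, rfl⟩ := (hmem J (by simp)).2.1 q hq
    obtain ⟨y, rfl⟩ := (hmem K (by simp)).1 p hp
    have hposlt (s t) : pos (f s) < pos (f t) ↔ s < t := by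
      rw [← not_le, hpos, not_le]
    have hxy : x < y := (hposlt _ _).1 hlt
    -- Otherwise the midpoint of the gap would lie in `Q` like the end `x`, but no arc contains it.
    -- The strict inequality `z < y` ensures that `z` is not counted again for the following arcs.
    obtain ⟨z, hzF, hxz, hzy⟩ : ∃ z ∈ F, x ≤ z ∧ z < y := by
      by_contra! hcon
      have hm1 : x < (x + y) / 2 := by linarith
      have hm2 : (x + y) / 2 < y := by linarith
      have hiff := hF x ((x + y) / 2) fun z hz hzF => by
        rw [uIcc_of_le hm1.le] at hz
        linarith [hcon z hzF hz.1, hz.2]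
      have hx : f x ∈ Q := (hQ _ ⟨x, rfl⟩ hpq).2 ⟨J, by simp, hpq, fun q' hq' => by
        rw [Option.mem_unique hq' hq]⟩
      obtain ⟨M, hM, hMv⟩ := (hQ _ ⟨_, rfl⟩ fun p' hp' => (hpq p' hp').trans
        ((hpos _ _).2 hm1.le)).1 (hiff.1 hx)
      rcases List.mem_cons.1 hM with rfl | hM
      · exact absurd (hMv.2 _ hq) (not_le.2 ((hposlt _ _).2 hm1))
      · have hlow : pos (f y) ≤ pos (f ((x + y) / 2)) := by
          rcases List.mem_cons.1 hM with rfl | hM'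
          · exact hMv.1 _ hp
          · obtain ⟨q', hq', p', hp', hlt'⟩ := (List.pairwise_cons.1 hpair).1 M hM'
            exact ((hmem K (by simp)).2.2 _ hp q' hq').trans (hlt'.le.trans (hMv.1 p' hp'))
        rw [hpos] at hlow
        linarith
    have hnot : z ∉ F.filter fun x => ∀ p ∈ K.1, pos p ≤ pos (f x) := fun hz =>
      absurd ((Finset.mem_filter.1 hz).2 _ hp) (not_le.2 ((hposlt _ _).2 hzy))
    have hsub : insert z (F.filter fun x => ∀ p ∈ K.1, pos p ≤ pos (f x)) ⊆
        F.filter fun x => ∀ p ∈ J.1, pos p ≤ pos (f x) := by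
      intro w hw
      rcases Finset.mem_insert.1 hw with rfl | hw
      · exact Finset.mem_filter.2 ⟨hzF, fun p' hp' => (hpq p' hp').trans ((hpos _ _).2 hxz)⟩
      · obtain ⟨hwF, hw⟩ := Finset.mem_filter.1 hw
        exact Finset.mem_filter.2 ⟨hwF, fun p' hp' => (hpq p' hp').trans (hKle _ hw).le⟩
    have := Finset.card_le_card hsub
    rw [Finset.card_insert_of_notMem hnot] at this
    rw [List.length_cons]
    omega

theorem Inst.pos_curve_le {n : ℕ} (I : Inst n) {a b : Fin n} (hab : a ≠ b) (τ : Bool) (s t : ℝ) :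
    I.pos a b τ (I.curve a b τ s) ≤ I.pos a b τ (I.curve a b τ t) ↔ s ≤ t := by
  rw [I.pos_le_pos hab, I.sc_curve hab, I.sc_curve hab]

theorem Inst.length_le_of_listsArcs {n : ℕ} (I : Inst n) {a b : Fin n} (hab : a ≠ b) (τ : Bool)
    {L : List Arc} (h : ListsArcs (I.bdry a b τ) I.Q (I.pos a b τ) L) :
    L.length ≤ 3 + 144 * (n * n) := by
  classical
  rw [I.bdry_eq hab] at h
  cases L with
  | nil => simp
  | cons J L =>
    have := length_le_card_of_listsArcs (I.pos_curve_le hab τ)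
      (F := (I.changes a b τ).toFinset)
      (fun x y hxy => I.mem_Q_curve_congr hab τ fun z hz hzc =>
        hxy z hz (List.mem_toFinset.2 hzc)) L J h.1 h.2.1 fun v hv _ => h.2.2 v hv
    rw [List.length_cons]
    exact Nat.succ_le_succ (this.trans (Finset.card_filter_le _ _ |>.trans
      ((List.toFinset_card_le _).trans (I.length_changes a b τ).le))) |>.trans (by omega)

theorem length_inorder {α : Type} (t : BinaryTree α) : (inorder t).length = t.numNodes := by
  induction t with
  | nil => rfl
  | node x l r hl hr => simp [inorder, hl, hr]; omega

/-- The number of arcs is quadratic in `n`, so balance makes every search path logarithmic. -/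
theorem Inst.height_le {n : ℕ} (I : Inst n) {a b : Fin n} (hab : a ≠ b) (τ : Bool) {c : ℕ}
    {t : BinaryTree Arc} (h : IsDQ c (I.bdry a b τ) I.Q (I.pos a b τ) t) :
    t.height ≤ c * Nat.log 2 (4 + 144 * (n * n)) := by
  refine h.2.trans (Nat.mul_le_mul_left c (Nat.log_mono_right ?_))
  have := I.length_le_of_listsArcs hab τ h.1
  rw [length_inorder] at this
  omega

/-! ### Reasoning about programs -/

section Expressions

instance : Add NExp := ⟨NExp.add⟩
instance (k : ℕ) : OfNat NExp k := ⟨NExp.lit k⟩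
instance : Add RExp := ⟨RExp.add⟩
instance : Sub RExp := ⟨RExp.sub⟩
instance : Mul RExp := ⟨RExp.mul⟩
instance : Div RExp := ⟨RExp.div⟩
instance (k : ℕ) : OfNat RExp k := ⟨RExp.lit k⟩

variable (σ : State)

@[simp] theorem NExp.eval_add (e f : NExp) : (e + f).eval σ = e.eval σ + f.eval σ := rfl
@[simp] theorem NExp.eval_ofNat (k : ℕ) :
    (ofNat(k) : NExp).eval σ = (OfNat.ofNat k : ℕ) := rfl
@[simp] theorem NExp.eval_var (x : ℕ) : (NExp.var x).eval σ = σ.nv x := rfl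
@[simp] theorem NExp.eval_get (x : ℕ) (e : NExp) : (NExp.get x e).eval σ = σ.na x (e.eval σ) := rfl
@[simp] theorem NExp.eval_sub (e f : NExp) : (NExp.sub e f).eval σ = e.eval σ - f.eval σ := rfl
@[simp] theorem RExp.eval_add (e f : RExp) : (e + f).eval σ = e.eval σ + f.eval σ := rfl
@[simp] theorem RExp.eval_sub (e f : RExp) : (e - f).eval σ = e.eval σ - f.eval σ := rfl
@[simp] theorem RExp.eval_mul (e f : RExp) : (e * f).eval σ = e.eval σ * f.eval σ := rfl
@[simp] theorem RExp.eval_div (e f : RExp) : (e / f).eval σ = e.eval σ / f.eval σ := rfl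
@[simp] theorem RExp.eval_ofNat (k : ℕ) :
    (ofNat(k) : RExp).eval σ = ((OfNat.ofNat k : ℕ) : ℝ) := rfl
@[simp] theorem RExp.eval_var (x : ℕ) : (RExp.var x).eval σ = σ.rv x := rfl
@[simp] theorem RExp.eval_get (x : ℕ) (e : NExp) : (RExp.get x e).eval σ = σ.ra x (e.eval σ) := rfl
@[simp] theorem RExp.eval_sqrt (e : RExp) : (RExp.sqrt e).eval σ = Real.sqrt (e.eval σ) := rfl
@[simp] theorem RExp.eval_root (a b c d e : RExp) (k : ℕ) : (RExp.root a b c d e k).eval σ =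
    quarticRoot (a.eval σ) (b.eval σ) (c.eval σ) (d.eval σ) (e.eval σ) k := rfl

/-- The maximum of two reals. -/
def RExp.max (e f : RExp) : RExp := (e + f + .sqrt ((f - e) * (f - e))) / 2

/-- The minimum of two reals. -/
def RExp.min (e f : RExp) : RExp := (e + f - .sqrt ((f - e) * (f - e))) / 2

-- The formula is `(x + y + |y - x|) / 2`, with the absolute value obtained as the square root of a
-- square, so no branching is needed.
@[simp] theorem RExp.eval_max (e f : RExp) :
    (RExp.max e f).eval σ = Max.max (e.eval σ) (f.eval σ) := by
  simp only [RExp.max, eval_div, eval_add, eval_sqrt, eval_mul, eval_sub, eval_ofNat,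
    Real.sqrt_mul_self_eq_abs]
  rcases le_total (e.eval σ) (f.eval σ) with h | h
  · rw [max_eq_right h, abs_of_nonneg (by linarith)]; push_cast; ring
  · rw [max_eq_left h, abs_of_nonpos (by linarith)]; push_cast; ring

@[simp] theorem RExp.eval_min (e f : RExp) :
    (RExp.min e f).eval σ = Min.min (e.eval σ) (f.eval σ) := by
  simp only [RExp.min, eval_div, eval_add, eval_sqrt, eval_mul, eval_sub, eval_ofNat,
    Real.sqrt_mul_self_eq_abs]
  rcases le_total (e.eval σ) (f.eval σ) with h | h
  · rw [min_eq_left h, abs_of_nonneg (by linarith)]; push_cast; ring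
  · rw [min_eq_right h, abs_of_nonpos (by linarith)]; push_cast; ring

/-- Strict comparison of integers. -/
def BExp.ltN (e f : NExp) : BExp := .neg (.leN f e)

/-- Strict comparison of reals. -/
def BExp.ltR (e f : RExp) : BExp := .neg (.leR f e)

@[simp] theorem BExp.holds_leN (e f : NExp) :
    (BExp.leN e f).holds σ ↔ e.eval σ ≤ f.eval σ := Iff.rfl
@[simp] theorem BExp.holds_leR (e f : RExp) :
    (BExp.leR e f).holds σ ↔ e.eval σ ≤ f.eval σ := Iff.rfl
@[simp] theorem BExp.holds_conj (b c : BExp) : (b.conj c).holds σ ↔ b.holds σ ∧ c.holds σ := Iff.rfl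
@[simp] theorem BExp.holds_ltN (e f : NExp) : (BExp.ltN e f).holds σ ↔ e.eval σ < f.eval σ :=
  not_le
@[simp] theorem BExp.holds_ltR (e f : RExp) : (BExp.ltR e f).holds σ ↔ e.eval σ < f.eval σ :=
  not_le

end Expressions

/-- The sequence of a list of programs. -/
def seqs : List Cmd → Cmd
  | [] => .skip
  | p :: l => .seq p (seqs l)

/-- The programs without loops. -/
def Cmd.flat : Cmd → Bool
  | .seq p q => p.flat && q.flat
  | .cond _ p q => p.flat && q.flat
  | .loop _ _ => false
  | _ => true

open Classical in
/-- The final state of a program without loops. -/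
noncomputable def Cmd.run : Cmd → State → State
  | .skip, σ => σ
  | .setN x e, σ => { σ with nv := Function.update σ.nv x (e.eval σ) }
  | .setR x e, σ => { σ with rv := Function.update σ.rv x (e.eval σ) }
  | .storeN arr i e, σ => { σ with
      na := Function.update σ.na arr (Function.update (σ.na arr) (i.eval σ) (e.eval σ)) }
  | .storeR arr i e, σ => { σ with
      ra := Function.update σ.ra arr (Function.update (σ.ra arr) (i.eval σ) (e.eval σ)) }
  | .seq p q, σ => q.run (p.run σ)
  | .cond b p q, σ => if b.holds σ then p.run σ else q.run σ
  -- A dummy value: programs with loops are excluded by `flat` wherever `run` is used.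
  | .loop _ _, σ => σ

/-- A bound for the running time of a program without loops. -/
def Cmd.bound : Cmd → ℕ
  | .skip => 1
  | .setN _ e => e.cost + 1
  | .setR _ e => e.cost + 1
  | .storeN _ i e => i.cost + e.cost + 1
  | .storeR _ i e => i.cost + e.cost + 1
  | .seq p q => p.bound + q.bound
  | .cond b p q => b.cost + (p.bound + q.bound)
  | .loop _ _ => 0

theorem Cmd.exec_run (p : Cmd) (hp : p.flat = true) (σ : State) :
    ∃ k, Exec p σ k (p.run σ) ∧ k ≤ p.bound := by
  induction p generalizing σ with
  | skip => exact ⟨_, .skip σ, le_rfl⟩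
  | setN x e => exact ⟨_, .setN σ x e, le_rfl⟩
  | setR x e => exact ⟨_, .setR σ x e, le_rfl⟩
  | storeN x i e => exact ⟨_, .storeN σ x i e, le_rfl⟩
  | storeR x i e => exact ⟨_, .storeR σ x i e, le_rfl⟩
  | seq p q ihp ihq =>
    simp only [Cmd.flat, Bool.and_eq_true] at hp
    obtain ⟨k, hk, hkb⟩ := ihp hp.1 σ
    obtain ⟨l, hl, hlb⟩ := ihq hp.2 (p.run σ)
    exact ⟨_, .seq hk hl, Nat.add_le_add hkb hlb⟩
  | cond b p q ihp ihq =>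
    simp only [Cmd.flat, Bool.and_eq_true] at hp
    by_cases hb : b.holds σ
    · obtain ⟨k, hk, hkb⟩ := ihp hp.1 σ
      refine ⟨_, .condTrue hb (by rwa [Cmd.run, if_pos hb]), ?_⟩
      simp only [Cmd.bound]; omega
    · obtain ⟨k, hk, hkb⟩ := ihq hp.2 σ
      refine ⟨_, .condFalse hb (by rwa [Cmd.run, if_neg hb]), ?_⟩
      simp only [Cmd.bound]; omega
  | loop b p => simp [Cmd.flat] at hp

/-- The program does not write the integer register `x`. -/
def Cmd.keepsN (x : ℕ) : Cmd → Bool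
  | .setN y _ => x != y
  | .seq p q => p.keepsN x && q.keepsN x
  | .cond _ p q => p.keepsN x && q.keepsN x
  | .loop _ p => p.keepsN x
  | _ => true

/-- The program does not write the real register `x`. -/
def Cmd.keepsR (x : ℕ) : Cmd → Bool
  | .setR y _ => x != y
  | .seq p q => p.keepsR x && q.keepsR x
  | .cond _ p q => p.keepsR x && q.keepsR x
  | .loop _ p => p.keepsR x
  | _ => true

/-- The program does not write the integer array `x`. -/
def Cmd.keepsNA (x : ℕ) : Cmd → Bool
  | .storeN y _ _ => x != y
  | .seq p q => p.keepsNA x && q.keepsNA x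
  | .cond _ p q => p.keepsNA x && q.keepsNA x
  | .loop _ p => p.keepsNA x
  | _ => true

/-- The program does not write real arrays. -/
def Cmd.keepsRA : Cmd → Bool
  | .storeR _ _ _ => false
  | .seq p q => p.keepsRA && q.keepsRA
  | .cond _ p q => p.keepsRA && q.keepsRA
  | .loop _ p => p.keepsRA
  | _ => true

/-- The two states agree on what the program does not write. -/
structure Keeps (p : Cmd) (σ σ' : State) : Prop where
  nv : ∀ x, p.keepsN x = true → σ'.nv x = σ.nv x
  rv : ∀ x, p.keepsR x = true → σ'.rv x = σ.rv x
  na : ∀ x, p.keepsNA x = true → σ'.na x = σ.na x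
  ra : p.keepsRA = true → σ'.ra = σ.ra

/-- The frame rule. Whether a register is written is a Boolean computed from the program text, so
invariants pass through a command by evaluating that Boolean. -/
theorem Exec.keeps {p : Cmd} {σ σ' : State} {k : ℕ} (h : Exec p σ k σ') : Keeps p σ σ' := by
  induction h with
  | skip => exact ⟨fun _ _ => rfl, fun _ _ => rfl, fun _ _ => rfl, fun _ => rfl⟩
  | setN σ x e =>
    refine ⟨fun y hy => ?_, fun _ _ => rfl, fun _ _ => rfl, fun _ => rfl⟩
    exact Function.update_of_ne (by simpa [Cmd.keepsN] using hy) _ _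
  | setR σ x e =>
    refine ⟨fun _ _ => rfl, fun y hy => ?_, fun _ _ => rfl, fun _ => rfl⟩
    exact Function.update_of_ne (by simpa [Cmd.keepsR] using hy) _ _
  | storeN σ x i e =>
    refine ⟨fun _ _ => rfl, fun _ _ => rfl, fun y hy => ?_, fun _ => rfl⟩
    exact Function.update_of_ne (by simpa [Cmd.keepsNA] using hy) _ _
  | storeR σ x i e =>
    refine ⟨fun _ _ => rfl, fun _ _ => rfl, fun _ _ => rfl, fun h => ?_⟩
    simp [Cmd.keepsRA] at h
  | seq _ _ ih1 ih2 =>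
    constructor <;> intros <;>
      simp_all [Cmd.keepsN, Cmd.keepsR, Cmd.keepsNA, Cmd.keepsRA, ih1.nv, ih1.rv, ih1.na, ih1.ra,
        ih2.nv, ih2.rv, ih2.na, ih2.ra]
  | condTrue _ _ ih =>
    constructor <;> intros <;>
      simp_all [Cmd.keepsN, Cmd.keepsR, Cmd.keepsNA, Cmd.keepsRA, ih.nv, ih.rv, ih.na, ih.ra]
  | condFalse _ _ ih =>
    constructor <;> intros <;>
      simp_all [Cmd.keepsN, Cmd.keepsR, Cmd.keepsNA, Cmd.keepsRA, ih.nv, ih.rv, ih.na, ih.ra]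
  | loopDone => exact ⟨fun _ _ => rfl, fun _ _ => rfl, fun _ _ => rfl, fun _ => rfl⟩
  | loopStep _ _ _ ih1 ih2 =>
    constructor
    · intro x hx
      rw [ih2.nv x hx, ih1.nv x hx]
    · intro x hx
      rw [ih2.rv x hx, ih1.rv x hx]
    · intro x hx
      rw [ih2.na x hx, ih1.na x hx]
    · intro hx
      rw [ih2.ra hx, ih1.ra hx]

/-- Started in the state `σ`, the program halts after at most `B` steps in a state with the
property `P`. -/
def Halts (p : Cmd) (σ : State) (B : ℕ) (P : State → Prop) : Prop :=
  ∃ k σ', Exec p σ k σ' ∧ k ≤ B ∧ P σ'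

/-- As in the rules below, the continuation receives the frame information `Keeps` besides the
postcondition, so postconditions need not mention what is left unchanged. -/
theorem Halts.mono {p : Cmd} {σ : State} {B B' : ℕ} {P P' : State → Prop} (h : Halts p σ B P)
    (hB : B ≤ B') (hP : ∀ σ', Keeps p σ σ' → P σ' → P' σ') : Halts p σ B' P' := by
  obtain ⟨k, σ', he, hk, hσ⟩ := h
  exact ⟨k, σ', he, hk.trans hB, hP σ' he.keeps hσ⟩

theorem Halts.of_flat {p : Cmd} (hp : p.flat = true) {σ : State} {P : State → Prop}
    (h : Keeps p σ (p.run σ) → P (p.run σ)) : Halts p σ p.bound P := by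
  obtain ⟨k, hk, hkb⟩ := p.exec_run hp σ
  exact ⟨k, _, hk, hkb, h hk.keeps⟩

theorem Halts.seq {p q : Cmd} {σ : State} {B B' : ℕ} {P R : State → Prop} (h : Halts p σ B P)
    (h' : ∀ σ', Keeps p σ σ' → P σ' → Halts q σ' B' R) : Halts (.seq p q) σ (B + B') R := by
  obtain ⟨k, σ', he, hk, hσ⟩ := h
  obtain ⟨k', σ'', he', hk', hσ'⟩ := h' σ' he.keeps hσ
  exact ⟨_, σ'', .seq he he', Nat.add_le_add hk hk', hσ'⟩

theorem Halts.cond {b : BExp} {p q : Cmd} {σ : State} {B : ℕ} {P : State → Prop}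
    (hp : b.holds σ → Halts p σ B P) (hq : ¬ b.holds σ → Halts q σ B P) :
    Halts (.cond b p q) σ (b.cost + B) P := by
  by_cases hb : b.holds σ
  · obtain ⟨k, σ', he, hk, hσ⟩ := hp hb
    exact ⟨_, σ', .condTrue hb he, Nat.add_le_add_left hk _, hσ⟩
  · obtain ⟨k, σ', he, hk, hσ⟩ := hq hb
    exact ⟨_, σ', .condFalse hb he, Nat.add_le_add_left hk _, hσ⟩

theorem Halts.loop_done {b : BExp} {p : Cmd} {σ : State} {P : State → Prop} (hb : ¬ b.holds σ)
    (h : P σ) : Halts (.loop b p) σ b.cost P :=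
  ⟨_, σ, .loopDone hb, le_rfl, h⟩

theorem Halts.loop_step {b : BExp} {p : Cmd} {σ : State} {B B' : ℕ} {P R : State → Prop}
    (hb : b.holds σ) (h : Halts p σ B P)
    (h' : ∀ σ', Keeps p σ σ' → P σ' → Halts (.loop b p) σ' B' R) :
    Halts (.loop b p) σ (b.cost + B + B') R := by
  obtain ⟨k, σ', he, hk, hσ⟩ := h
  obtain ⟨k', σ'', he', hk', hσ'⟩ := h' σ' he.keeps hσ
  exact ⟨_, σ'', .loopStep hb he he', by omega, hσ'⟩

/-- `for x < n do p`, where `n` is the content of the integer register `0`. -/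
def forCmd (x : ℕ) (p : Cmd) : Cmd :=
  .seq (.setN x 0) (.loop (.ltN (.var x) (.var 0)) (.seq p (.setN x (.var x + 1))))

/-- `P i` is the invariant before round `i`; `hstab` says that it does not depend on the counter.
Each round costs 4 for the test and 4 for the increment on top of the body. The extra round in the
bound pays for the initialization and the last test. -/
theorem Halts.forCmd {x : ℕ} {p : Cmd} {n B : ℕ} {P : ℕ → State → Prop} (hx0 : 0 ≠ x)
    (hpx : p.keepsN x = true) (hp0 : p.keepsN 0 = true)
    (hstab : ∀ i σ σ', Keeps (.setN x 0) σ σ' → P i σ → P i σ')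
    (hbody : ∀ i < n, ∀ σ, σ.nv 0 = n → σ.nv x = i → P i σ → Halts p σ B (P (i + 1)))
    {σ : State} (hn : σ.nv 0 = n) (h0 : P 0 σ) :
    Halts (forCmd x p) σ ((n + 1) * (B + 8)) (P n) := by
  have main : ∀ m i, i + m = n → ∀ σ : State, σ.nv 0 = n → σ.nv x = i → P i σ →
      Halts (.loop (.ltN (.var x) (.var 0)) (.seq p (.setN x (.var x + 1)))) σ
        (m * (B + 8) + 4) (P n) := by
    intro m
    induction m with
    | zero =>
      intro i hi σ h0 hx hP
      refine (Halts.loop_done (P := P n) ?_ ?_).mono ?_ fun _ _ h => h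
      · simp [h0, hx]; omega
      · rwa [← hi]
      · simp [BExp.ltN, BExp.cost, NExp.cost]
    | succ m ih =>
      intro i hi σ h0 hx hP
      refine (Halts.loop_step (B := B + 4) (B' := m * (B + 8) + 4)
        (P := fun σ' => σ'.nv 0 = n ∧ σ'.nv x = i + 1 ∧ P (i + 1) σ')
        ?_ ?_ fun σ' _ h => ih (i + 1) (by omega) σ' h.1 h.2.1 h.2.2).mono ?_ fun _ _ h => h
      · simp [h0, hx]; omega
      · refine (hbody i (by omega) σ h0 hx hP).seq fun σ' hk hP' => ?_
        refine ⟨_, _, .setN σ' x _, le_of_eq rfl, ?_, ?_, ?_⟩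
        · simp [Function.update_of_ne hx0, hk.nv 0 hp0, h0]
        · simp [hk.nv x hpx, hx]
        · refine hstab _ σ' _ ⟨fun y hy => ?_, fun _ _ => rfl, fun _ _ => rfl, fun _ => rfl⟩ hP'
          exact Function.update_of_ne (by simpa [Cmd.keepsN] using hy) _ _
      · have : (BExp.ltN (.var x) (.var 0)).cost = 4 := rfl
        rw [this, add_mul]; omega
  have h2 : Halts (.setN x 0) σ 2 (fun σ' => σ'.nv 0 = n ∧ σ'.nv x = 0 ∧ P 0 σ') := by
    refine ⟨_, _, .setN σ x 0, le_of_eq rfl, ?_, ?_, ?_⟩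
    · simp [Function.update_of_ne hx0, hn]
    · simp
    · exact hstab _ σ _ (Exec.setN σ x 0).keeps h0
  refine (h2.seq fun σ' _ h => main n 0 (by omega) σ' h.1 h.2.1 h.2.2).mono ?_ fun _ _ h => h
  rw [add_mul]; omega

theorem seqs_keepsN {x : ℕ} {l : List Cmd} (h : ∀ p ∈ l, p.keepsN x = true) :
    (seqs l).keepsN x = true := by
  induction l with
  | nil => rfl
  | cons p l ih => simp_all [seqs, Cmd.keepsN]

theorem seqs_keepsR {x : ℕ} {l : List Cmd} (h : ∀ p ∈ l, p.keepsR x = true) :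
    (seqs l).keepsR x = true := by
  induction l with
  | nil => rfl
  | cons p l ih => simp_all [seqs, Cmd.keepsR]

theorem seqs_keepsNA {x : ℕ} {l : List Cmd} (h : ∀ p ∈ l, p.keepsNA x = true) :
    (seqs l).keepsNA x = true := by
  induction l with
  | nil => rfl
  | cons p l ih => simp_all [seqs, Cmd.keepsNA]

theorem seqs_keepsRA {l : List Cmd} (h : ∀ p ∈ l, p.keepsRA = true) :
    (seqs l).keepsRA = true := by
  induction l with
  | nil => rfl
  | cons p l ih => simp_all [seqs, Cmd.keepsRA]

/-! ### Expressions for the geometric quantities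

Real registers: `0, 1, 2` best translation and its area, `3, …, 10` sides of the bounding
rectangles, `11, …, 17` data of a vippodrome, `18` a position, `19, …, 22` the point at this
position, `23, 24, 25` a candidate and its area.

Integer registers: `1` whether a translation has been found, `2, 3` two pairs, `4` index of their
trees, `5` the current node, `6` the root, `7` whether sorting is possible, `8` result of a test,
`9` the pair to be placed next, `10` a counter. -/

/-- The registers hold the sides of the bounding rectangles. -/
def Inst.ExtentAt {n : ℕ} (I : Inst n) (σ : State) : Prop :=
  ∀ k : Fin 2, σ.rv (3 + 4 * k) = lo (discs I.S) k ∧ σ.rv (4 + 4 * k) = hi (discs I.S) k ∧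
    σ.rv (5 + 4 * k) = lo (discs I.T) k ∧ σ.rv (6 + 4 * k) = hi (discs I.T) k

/-- The registers hold the data of the vippodrome `(a, b, τ)`. -/
structure Inst.VippodromeAt {n : ℕ} (I : Inst n) (a b : Fin n) (τ : Bool) (σ : State) : Prop where
  d₀ : σ.rv 11 = I.axis a b τ 0
  d₁ : σ.rv 12 = I.axis a b τ 1
  o₀ : σ.rv 13 = I.off a b τ 0
  o₁ : σ.rv 14 = I.off a b τ 1
  l : σ.rv 15 = I.len a b τ
  r : σ.rv 16 = raySlope (I.len a b τ)
  j : σ.rv 17 = junction (I.len a b τ)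

def widthExp (k : Fin 2) (x : RExp) : RExp :=
  RExp.max (.var (4 + 4 * k)) (.var (6 + 4 * k) + x) -
    RExp.min (.var (3 + 4 * k)) (.var (5 + 4 * k) + x)

def areaExp (x y : RExp) : RExp := widthExp 0 x * widthExp 1 y

def brkLoExp (k : Fin 2) : RExp :=
  RExp.min (.var (3 + 4 * k) - .var (5 + 4 * k)) (.var (4 + 4 * k) - .var (6 + 4 * k))

def brkHiExp (k : Fin 2) : RExp :=
  RExp.max (.var (3 + 4 * k) - .var (5 + 4 * k)) (.var (4 + 4 * k) - .var (6 + 4 * k))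

def offsExp (k : Fin 2) : Fin 3 → RExp :=
  ![.var (4 + 4 * k) - .var (5 + 4 * k),
    RExp.max (.var (4 + 4 * k) - .var (3 + 4 * k)) (.var (6 + 4 * k) - .var (5 + 4 * k)),
    .var (6 + 4 * k) - .var (3 + 4 * k)]

def slopeExp : Fin 3 → RExp := ![0 - 1, 0, 1]

theorem eval_widthExp {n : ℕ} {I : Inst n} {σ : State} (h : I.ExtentAt σ) (k : Fin 2) (x : RExp) :
    (widthExp k x).eval σ = I.width k (x.eval σ) := by
  simp [widthExp, Inst.width, h k]

theorem eval_areaExp {n : ℕ} (hn : 1 ≤ n) {I : Inst n} {σ : State} (h : I.ExtentAt σ) {v : Plane}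
    {x y : RExp} (hx : x.eval σ = v 0) (hy : y.eval σ = v 1) :
    (areaExp x y).eval σ = I.area v := by
  rw [areaExp, RExp.eval_mul, eval_widthExp h, eval_widthExp h, hx, hy, I.area_eq hn]

theorem eval_brkLoExp {n : ℕ} {I : Inst n} {σ : State} (h : I.ExtentAt σ) (k : Fin 2) :
    (brkLoExp k).eval σ = I.brkLo k := by
  simp [brkLoExp, Inst.brkLo, h k]

theorem eval_brkHiExp {n : ℕ} {I : Inst n} {σ : State} (h : I.ExtentAt σ) (k : Fin 2) :
    (brkHiExp k).eval σ = I.brkHi k := by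
  simp [brkHiExp, Inst.brkHi, h k]

theorem eval_offsExp {n : ℕ} {I : Inst n} {σ : State} (h : I.ExtentAt σ) (k : Fin 2) (i : Fin 3) :
    (offsExp k i).eval σ = I.offs k i := by
  fin_cases i <;> simp [offsExp, Inst.offs, h k]

theorem eval_slopeExp (σ : State) (i : Fin 3) : (slopeExp i).eval σ = slope i := by
  fin_cases i <;> simp [slopeExp, slope]

noncomputable def Lin.eval (σ : State) (p : Lin RExp) : Lin ℝ :=
  ⟨p.x₀.eval σ, p.x₁.eval σ, p.x₂.eval σ⟩

noncomputable def Quin.eval (σ : State) (q : Quin RExp) : Quin ℝ :=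
  ⟨q.a₀.eval σ, q.a₁.eval σ, q.a₂.eval σ, q.b₀.eval σ, q.b₁.eval σ⟩

def Lin.combExp (c c₁ : RExp) (p : Lin RExp) : Lin RExp := ⟨c + c₁ * p.x₀, c₁ * p.x₁, c₁ * p.x₂⟩

def Lin.toQuinExp (p : Lin RExp) (x : RExp) : Quin RExp := ⟨p.x₀ + x, p.x₁, 0, p.x₂, 0⟩

def Lin.mulExp (p r : Lin RExp) : Quin RExp :=
  ⟨p.x₀ * r.x₀ + 4 * (p.x₂ * r.x₂), p.x₀ * r.x₁ + p.x₁ * r.x₀, p.x₁ * r.x₁ - p.x₂ * r.x₂,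
    p.x₀ * r.x₂ + p.x₂ * r.x₀, p.x₁ * r.x₂ + p.x₂ * r.x₁⟩

def Quin.critExp (q : Quin RExp) : Quin RExp :=
  ⟨4 * q.b₁, 0 - q.b₀, 0 - 2 * q.b₁, q.a₁, 2 * q.a₂⟩

def Quin.rootExp (q : Quin RExp) (k : ℕ) : RExp :=
  .root (q.a₀ * q.a₀ - 4 * (q.b₀ * q.b₀)) (2 * (q.a₀ * q.a₁) - 8 * (q.b₀ * q.b₁))
    (q.a₁ * q.a₁ + 2 * (q.a₀ * q.a₂) - 4 * (q.b₁ * q.b₁) + q.b₀ * q.b₀)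
    (2 * (q.a₁ * q.a₂) + 2 * (q.b₀ * q.b₁)) (q.a₂ * q.a₂ + q.b₁ * q.b₁) k

/-- The second operand of `Lin.comb` has the factor 0 here, so `q` is arbitrary. -/
theorem Lin.eval_combExp (σ : State) (c c₁ : RExp) (p q : Lin RExp) :
    (Lin.combExp c c₁ p).eval σ = Lin.comb (c.eval σ) (c₁.eval σ) (p.eval σ) 0 (q.eval σ) := by
  simp [Lin.combExp, Lin.comb, Lin.eval]

theorem Lin.eval_toQuinExp (σ : State) (p : Lin RExp) (x : RExp) :
    (p.toQuinExp x).eval σ = (p.eval σ).toQuin (x.eval σ) := by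
  simp [Lin.toQuinExp, Lin.toQuin, Lin.eval, Quin.eval]

theorem Lin.eval_mulExp (σ : State) (p r : Lin RExp) :
    (p.mulExp r).eval σ = (p.eval σ).mul (r.eval σ) := by
  simp [Lin.mulExp, Lin.mul, Lin.eval, Quin.eval]

theorem Quin.eval_critExp (σ : State) (q : Quin RExp) : q.critExp.eval σ = (q.eval σ).crit := by
  simp [Quin.critExp, Quin.crit, Quin.eval]

theorem Quin.eval_rootExp (σ : State) (q : Quin RExp) (k : ℕ) :
    (q.rootExp k).eval σ = (q.eval σ).root k := by
  simp [Quin.rootExp, Quin.root, Quin.eval]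

def profileLinExp : Fin 3 → Lin RExp :=
  ![⟨0, 0 - .var 16, 0⟩, ⟨.var 15, 0, 0 - 1⟩, ⟨0, .var 16, 0⟩]

def curveLinExp (p : Fin 3) : Fin 2 → Lin RExp :=
  let q := profileLinExp p
  ![⟨.var 11 * q.x₀ / .var 15 - .var 13, (.var 11 * q.x₁ - .var 12) / .var 15,
      .var 11 * q.x₂ / .var 15⟩,
    ⟨.var 12 * q.x₀ / .var 15 - .var 14, (.var 12 * q.x₁ + .var 11) / .var 15,
      .var 12 * q.x₂ / .var 15⟩]

theorem eval_profileLinExp {n : ℕ} {I : Inst n} {a b : Fin n} {τ : Bool} {σ : State}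
    (h : I.VippodromeAt a b τ σ) (p : Fin 3) :
    (profileLinExp p).eval σ = profileLin (I.len a b τ) p := by
  fin_cases p <;> simp [profileLinExp, profileLin, Lin.eval, h.r, h.l]

theorem eval_curveLinExp {n : ℕ} {I : Inst n} {a b : Fin n} {τ : Bool} {σ : State}
    (h : I.VippodromeAt a b τ σ) (p : Fin 3) (k : Fin 2) :
    (curveLinExp p k).eval σ = I.curveLin a b τ p k := by
  have hp := eval_profileLinExp h p
  fin_cases k <;>
    simp [curveLinExp, Inst.curveLin, ← hp, Lin.eval, h.d₀, h.d₁, h.o₀, h.o₁, h.l]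

def areaQuinsExp (p : Fin 3) : List (Quin RExp) :=
  [(curveLinExp p 0).toQuinExp (0 - brkLoExp 0), (curveLinExp p 0).toQuinExp (0 - brkHiExp 0),
    (curveLinExp p 1).toQuinExp (0 - brkLoExp 1), (curveLinExp p 1).toQuinExp (0 - brkHiExp 1)] ++
  (List.finRange 3).flatMap fun i => (List.finRange 3).map fun j =>
    ((Lin.combExp (offsExp 0 i) (slopeExp i) (curveLinExp p 0)).mulExp
      (Lin.combExp (offsExp 1 j) (slopeExp j) (curveLinExp p 1))).critExp

/-- A fixed list that does not depend on the instance. Hence the number of searches per curve, and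
the cost of each expression, are absolute constants. -/
def breakpointsExp : List RExp :=
  [0 - .var 17, .var 17] ++
  (List.finRange 3).flatMap fun p => (areaQuinsExp p).flatMap fun q =>
    (List.range 4).map fun k => q.rootExp k

theorem map_eval_areaQuinsExp {n : ℕ} {I : Inst n} {a b : Fin n} {τ : Bool} {σ : State}
    (hE : I.ExtentAt σ) (h : I.VippodromeAt a b τ σ) (p : Fin 3) :
    (areaQuinsExp p).map (Quin.eval σ) = I.areaQuins a b τ p := by
  simp only [areaQuinsExp, Inst.areaQuins, List.map_append, List.map_cons, List.map_nil,
    List.map_flatMap, List.map_map, Function.comp_def, Lin.eval_toQuinExp, eval_curveLinExp h,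
    RExp.eval_sub, RExp.eval_ofNat, eval_brkLoExp hE, eval_brkHiExp hE, Quin.eval_critExp,
    Lin.eval_mulExp, eval_offsExp hE, eval_slopeExp, Nat.cast_zero,
    Lin.eval_combExp σ _ _ (curveLinExp p 0) (curveLinExp p 0),
    Lin.eval_combExp σ _ _ (curveLinExp p 1) (curveLinExp p 1)]

theorem map_eval_breakpointsExp {n : ℕ} {I : Inst n} {a b : Fin n} {τ : Bool} {σ : State}
    (hE : I.ExtentAt σ) (h : I.VippodromeAt a b τ σ) :
    breakpointsExp.map (RExp.eval σ) = I.breakpoints a b τ := by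
  simp only [breakpointsExp, Inst.breakpoints, List.map_append, List.map_cons, List.map_nil,
    List.map_flatMap, List.map_map, Function.comp_def, ← map_eval_areaQuinsExp hE h,
    RExp.eval_sub, RExp.eval_ofNat, RExp.eval_var, h.j, Nat.cast_zero, List.flatMap_map,
    Quin.eval_rootExp]

/-! ### Programs for the geometric quantities -/

def startExp (k : ℕ) (x : ℕ) : RExp := .get k (.var x)

def targetExp (k : ℕ) (x : ℕ) : RExp := .get (2 + k) (.get 0 (.var x))

def axisExp (k : ℕ) : Bool → RExp
  | true => startExp k 2 - startExp k 3
  | false => targetExp k 2 - targetExp k 3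

def offExp (k : ℕ) : Bool → RExp
  | true => targetExp k 3 - startExp k 3
  | false => targetExp k 2 - startExp k 2

/-- Load the data of the vippodrome of the pairs in the integer registers `2` and `3`. -/
def loadCmd (τ : Bool) : Cmd :=
  seqs [.setR 11 (axisExp 0 τ), .setR 12 (axisExp 1 τ), .setR 13 (offExp 0 τ),
    .setR 14 (offExp 1 τ), .setR 15 (.sqrt (.var 11 * .var 11 + .var 12 * .var 12)),
    .setR 16 (.sqrt (.var 15 * .var 15 - 4) / 2), .setR 17 (4 * .var 16 / .var 15)]

theorem loadCmd_spec {n c : ℕ} {I : Inst n} {a b : Fin n} {σ : State} (hI : InputOK c I σ)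
    (ha : σ.nv 2 = a) (hb : σ.nv 3 = b) (τ : Bool) :
    I.VippodromeAt a b τ ((loadCmd τ).run σ) := by
  have h := hI.2.1
  cases τ <;>
  · constructor <;>
    simp [loadCmd, seqs, Cmd.run, Function.update, axisExp, offExp, startExp, targetExp, ha, hb, h,
      Inst.axis, Inst.off, Inst.target, Inst.len, raySlope, junction, pow_two]

/-- Compute the value of `profile` at the position in register `18`. -/
def profileCmd : Cmd :=
  .cond (.leR (.var 18) (0 - .var 17)) (.setR 19 (0 - .var 16 * .var 18))
    (.cond (.leR (.var 17) (.var 18)) (.setR 19 (.var 16 * .var 18))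
      (.setR 19 (.var 15 - .sqrt (4 - .var 18 * .var 18))))

theorem profileCmd_spec {n : ℕ} {I : Inst n} {a b : Fin n} {τ : Bool} {σ : State}
    (h : I.VippodromeAt a b τ σ) :
    (profileCmd.run σ).rv 19 = profile (I.len a b τ) (σ.rv 18) := by
  simp only [profileCmd, Cmd.run, BExp.holds_leR, RExp.eval_sub, RExp.eval_var, RExp.eval_ofNat,
    profile, h.j, Nat.cast_zero, zero_sub]
  split_ifs <;> simp [h.r, h.l, pow_two]

/-- Compute the point of the boundary curve at the position in register `18`. -/
def pointCmd : Cmd :=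
  seqs [profileCmd, .setR 20 ((.var 11 * .var 19 - .var 12 * .var 18) / .var 15 - .var 13),
    .setR 21 ((.var 12 * .var 19 + .var 11 * .var 18) / .var 15 - .var 14),
    .setR 22 (.var 11 * .var 21 - .var 12 * .var 20)]

/-- The registers hold the point at position `s` of the boundary curve. -/
def Inst.PointAt {n : ℕ} (I : Inst n) (a b : Fin n) (τ : Bool) (s : ℝ) (σ : State) : Prop :=
  σ.rv 20 = I.curve a b τ s 0 ∧ σ.rv 21 = I.curve a b τ s 1 ∧
    σ.rv 22 = I.pos a b τ (I.curve a b τ s)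

theorem Cmd.keeps_run {p : Cmd} (hp : p.flat = true) (σ : State) : Keeps p σ (p.run σ) :=
  have ⟨_, h, _⟩ := p.exec_run hp σ
  h.keeps

/-- The program preserves the data of a vippodrome. -/
def Cmd.keepsVippodrome (p : Cmd) : Bool := (List.range' 11 7).all p.keepsR

/-- The program preserves the sides of the bounding rectangles. -/
def Cmd.keepsExtent (p : Cmd) : Bool := (List.range' 3 8).all p.keepsR

/-- The program preserves the input. -/
def Cmd.keepsInput (p : Cmd) : Bool := p.keepsN 0 && (List.range 6).all p.keepsNA && p.keepsRA

theorem Inst.VippodromeAt.keeps {n : ℕ} {I : Inst n} {a b : Fin n} {τ : Bool} {σ σ' : State}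
    {p : Cmd} (h : I.VippodromeAt a b τ σ) (hk : Keeps p σ σ') (hp : p.keepsVippodrome = true) :
    I.VippodromeAt a b τ σ' := by
  have hp' : ∀ x ∈ List.range' 11 7, σ'.rv x = σ.rv x := fun x hx =>
    hk.rv x (List.all_eq_true.1 hp x hx)
  obtain ⟨h1, h2, h3, h4, h5, h6, h7⟩ := h
  constructor <;> rw [hp' _ (by decide)] <;> assumption

theorem Inst.ExtentAt.keeps {n : ℕ} {I : Inst n} {σ σ' : State}
    {p : Cmd} (h : I.ExtentAt σ) (hk : Keeps p σ σ') (hp : p.keepsExtent = true) :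
    I.ExtentAt σ' := by
  have hp' : ∀ x ∈ List.range' 3 8, σ'.rv x = σ.rv x := fun x hx =>
    hk.rv x (List.all_eq_true.1 hp x hx)
  intro k
  have := h k
  fin_cases k <;>
    rwa [hp' _ (by decide), hp' _ (by decide), hp' _ (by decide), hp' _ (by decide)]

/-- A stored tree is read from integer arrays with names below 6 and from real arrays; the working
arrays of the sorting have the names 6 and 7. -/
theorem TreeAt.congr {σ σ' : State} {t : BinaryTree Arc} {p : ℕ} (h : TreeAt σ t p)
    (hna : ∀ x < 6, σ'.na x = σ.na x) (hra : σ'.ra = σ.ra) : TreeAt σ' t p := by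
  induction t generalizing p with
  | nil => exact h
  | node J l r ihl ihr =>
    obtain ⟨h0, h1, h2, h3, h4⟩ := h
    refine ⟨h0, ?_, ?_, ?_, ?_⟩
    · rwa [hna 4 (by norm_num), hra]
    · rwa [hna 5 (by norm_num), hra]
    · rw [hna 2 (by norm_num)]
      exact ihl h3
    · rw [hna 3 (by norm_num)]
      exact ihr h4

theorem Keeps.na_eq {p : Cmd} {σ σ' : State} (hk : Keeps p σ σ') (hp : p.keepsInput = true) :
    σ'.nv 0 = σ.nv 0 ∧ (∀ x < 6, σ'.na x = σ.na x) ∧ σ'.ra = σ.ra := by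
  simp only [Cmd.keepsInput, Bool.and_eq_true, List.all_eq_true, List.mem_range] at hp
  exact ⟨hk.nv 0 hp.1.1, fun x hx => hk.na x (hp.1.2 x hx), hk.ra hp.2⟩

theorem InputOK.keeps {n c : ℕ} {I : Inst n} {σ σ' : State} {p : Cmd} (h : InputOK c I σ)
    (hk : Keeps p σ σ') (hp : p.keepsInput = true) : InputOK c I σ' := by
  obtain ⟨h0, hna, hra⟩ := hk.na_eq hp
  obtain ⟨h1, h2, h3⟩ := h
  refine ⟨h0.trans h1, fun i => ?_, fun a b hab τ => ?_⟩
  · rw [hra, hna 0 (by norm_num)]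
    exact h2 i
  · obtain ⟨t, ht, htree⟩ := h3 a b hab τ
    refine ⟨t, ht, ?_⟩
    rw [hna 1 (by norm_num)]
    exact htree.congr hna hra

theorem pointCmd_spec {n : ℕ} {I : Inst n} {a b : Fin n} {τ : Bool} {σ : State}
    (h : I.VippodromeAt a b τ σ) : I.PointAt a b τ (σ.rv 18) (pointCmd.run σ) := by
  have hk := Cmd.keeps_run (p := profileCmd) rfl σ
  have h' := h.keeps hk rfl
  have h18 := hk.rv 18 rfl
  simp only [Inst.PointAt, pointCmd, seqs, Cmd.run]
  simp [Function.update, profileCmd_spec h, h'.d₀, h'.d₁, h'.o₀, h'.o₁, h'.l, h18, Inst.curve,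
    Inst.pos]

/-! ### Searching the trees -/

/-- The registers hold a valid translation and its area, or nothing. -/
def Inst.BestAt {n : ℕ} (I : Inst n) (σ : State) : Prop :=
  σ.nv 1 = 0 ∨ σ.nv 1 = 1 ∧ ∃ v ∈ I.Q, σ.rv 0 = v 0 ∧ σ.rv 1 = v 1 ∧ σ.rv 2 = I.area v

/-- A translation of area at most `x` has been found. -/
def Found (x : ℝ) (σ : State) : Prop := σ.nv 1 = 1 ∧ σ.rv 2 ≤ x

theorem Found.mono {x y : ℝ} {σ : State} (h : Found x σ) (hxy : x ≤ y) : Found y σ :=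
  ⟨h.1, h.2.trans hxy⟩

/-- The best translation has not become worse. -/
def Improves (σ σ' : State) : Prop := ∀ x, Found x σ → Found x σ'

/-- Take the point with the given coordinates into account. -/
def candidateCmd (x y : RExp) : Cmd :=
  seqs [.setR 23 x, .setR 24 y, .setR 25 (areaExp (.var 23) (.var 24)),
    .cond (.conj (.leN 1 (.var 1)) (.leR (.var 2) (.var 25))) .skip
      (seqs [.setN 1 1, .setR 0 (.var 23), .setR 1 (.var 24), .setR 2 (.var 25)])]

/-- The hypothesis on `y` allows any content of register `23`, because that register is overwritten
before `y` is evaluated. -/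
theorem candidateCmd_spec {n : ℕ} (hn : 1 ≤ n) {I : Inst n} {σ : State} (hE : I.ExtentAt σ)
    (hB : I.BestAt σ) {w : Plane} (hw : w ∈ I.Q) {x y : RExp} (hx : x.eval σ = w 0)
    (hy : ∀ z, y.eval { σ with rv := Function.update σ.rv 23 z } = w 1) :
    Halts (candidateCmd x y) σ (candidateCmd x y).bound fun σ' =>
      I.BestAt σ' ∧ Improves σ σ' ∧ Found (I.area w) σ' := by
  refine Halts.of_flat rfl fun _ => ?_
  set σ₁ : State := { σ with rv := Function.update (Function.update σ.rv 23 (w 0)) 24 (w 1) }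
    with hσ₁
  set σ₂ : State := { σ₁ with rv := Function.update σ₁.rv 25 (I.area w) } with hσ₂
  have hE₁ : I.ExtentAt σ₁ := by
    intro k
    have := hE k
    fin_cases k <;> simpa [hσ₁, Function.update] using this
  have hrun : (candidateCmd x y).run σ =
      (Cmd.seq (.cond (.conj (.leN 1 (.var 1)) (.leR (.var 2) (.var 25))) .skip
        (seqs [.setN 1 1, .setR 0 (.var 23), .setR 1 (.var 24), .setR 2 (.var 25)])) .skip).run
          σ₂ := by
    have hA : (areaExp (.var 23) (.var 24)).eval σ₁ = I.area w :=
      eval_areaExp hn hE₁ (by simp [hσ₁, Function.update]) (by simp [hσ₁, Function.update])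
    have : (Cmd.seq (.setR 23 x) (.seq (.setR 24 y)
        (.setR 25 (areaExp (.var 23) (.var 24))))).run σ = σ₂ := by
      simp only [Cmd.run, hx, hy]
      rw [← hσ₁, hA]
    rw [← this]
    rfl
  rw [hrun]
  have e1 : σ₂.nv = σ.nv := rfl
  have e2 : σ₂.rv 2 = σ.rv 2 := by simp [hσ₂, hσ₁, Function.update]
  have e25 : σ₂.rv 25 = I.area w := by simp [hσ₂]
  have e0 : σ₂.rv 0 = σ.rv 0 := by simp [hσ₂, hσ₁, Function.update]
  have e1' : σ₂.rv 1 = σ.rv 1 := by simp [hσ₂, hσ₁, Function.update]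
  simp only [Cmd.run, BExp.holds_conj, BExp.holds_leN, BExp.holds_leR, NExp.eval_ofNat,
    NExp.eval_var, RExp.eval_var, e1, e2, e25]
  by_cases h : 1 ≤ σ.nv 1 ∧ σ.rv 2 ≤ I.area w
  · rw [if_pos h]
    refine ⟨?_, ?_, ?_⟩
    · rw [Inst.BestAt, e0, e1', e2, e1]
      exact hB
    · rintro x ⟨h1, h2⟩
      exact ⟨h1, by rwa [e2]⟩
    · refine ⟨?_, by rw [e2]; exact h.2⟩
      rw [e1]
      rcases hB with h0 | h0
      · omega
      · exact h0.1
  · rw [if_neg h]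
    simp only [seqs, Cmd.run]
    refine ⟨.inr ⟨by simp, w, hw, ?_, ?_, ?_⟩, ?_, ?_⟩
    · simp [Function.update, hσ₂, hσ₁]
    · simp [Function.update, hσ₂, hσ₁]
    · simp [Function.update, hσ₂, hσ₁]
    · rintro x ⟨h1, h2⟩
      have : I.area w < σ.rv 2 := by
        by_contra! hcon
        exact h ⟨h1.ge, hcon⟩
      refine ⟨by simp, ?_⟩
      simp [Function.update, hσ₂, hσ₁]
      linarith
    · exact ⟨by simp, by simp [Function.update, hσ₂, hσ₁]⟩

/-- The position of an endpoint stored at the current node. -/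
def endPosExp (x y : ℕ) : RExp :=
  .var 11 * .get y (.var 5) - .var 12 * .get x (.var 5)

/-- One step of the search: compare the point with the arc at the current node. -/
def searchStep : Cmd :=
  .cond (.conj (.leN 1 (.get 4 (.var 5))) (.ltR (.var 22) (endPosExp 4 5)))
    (.seq (candidateCmd (.get 4 (.var 5)) (.get 5 (.var 5))) (.setN 5 (.get 2 (.var 5))))
    (.cond (.conj (.leN 1 (.get 5 (.var 5))) (.ltR (endPosExp 6 7) (.var 22)))
      (.seq (candidateCmd (.get 6 (.var 5)) (.get 7 (.var 5))) (.setN 5 (.get 3 (.var 5))))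
      (.seq (candidateCmd (.var 20) (.var 21)) (.setN 5 0)))

/-- Take into account the ends of the arcs on the search path of the point in the registers. -/
def searchLoop : Cmd := .loop (.leN 1 (.var 5)) searchStep

theorem endAt_some {f : ℕ} {x y : ℝ} {e : Option Plane} (h : EndAt f x y e) (hf : 1 ≤ f) :
    ∃ p, e = some p ∧ x = p 0 ∧ y = p 1 := by
  cases e with
  | none => exact absurd h (by change ¬ f = 0; omega)
  | some p => exact ⟨p, rfl, h.2⟩

theorem endAt_none {f : ℕ} {x y : ℝ} {e : Option Plane} (h : EndAt f x y e) (hf : ¬ 1 ≤ f) :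
    e = none := by
  cases e with
  | none => rfl
  | some p => exact absurd h.1.ge hf

theorem Inst.PointAt.keeps {n : ℕ} {I : Inst n} {a b : Fin n} {τ : Bool} {s : ℝ} {σ σ' : State}
    {p : Cmd} (h : I.PointAt a b τ s σ) (hk : Keeps p σ σ')
    (hp : (p.keepsR 20 && p.keepsR 21 && p.keepsR 22) = true) : I.PointAt a b τ s σ' := by
  simp only [Bool.and_eq_true] at hp
  unfold Inst.PointAt
  rw [hk.rv 20 hp.1.1, hk.rv 21 hp.1.2, hk.rv 22 hp.2]
  exact h

theorem seq_setN_spec {p : Cmd} {σ : State} {B : ℕ} {P : State → Prop} {x : ℕ} {e : NExp} {m : ℕ}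
    (h : Halts p σ B P) (he : ∀ σ', Keeps p σ σ' → e.eval σ' = m)
    (hP : ∀ σ σ', Keeps (.setN x e) σ σ' → P σ → P σ') :
    Halts (.seq p (.setN x e)) σ (B + (e.cost + 1)) fun σ' => P σ' ∧ σ'.nv x = m := by
  refine h.seq fun σ' hk hσ' => ?_
  refine Halts.of_flat (p := .setN x e) rfl fun hk' => ⟨hP _ _ hk' hσ', ?_⟩
  simp [Cmd.run, he σ' hk]

theorem Inst.BestAt.congr {n : ℕ} {I : Inst n} {σ σ' : State} (h : I.BestAt σ)
    (h1 : σ'.nv 1 = σ.nv 1) (h0 : σ'.rv = σ.rv) : I.BestAt σ' := by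
  unfold Inst.BestAt
  rwa [h1, h0]

theorem Found.congr {x : ℝ} {σ σ' : State} (h : Found x σ)
    (h1 : σ'.nv 1 = σ.nv 1) (h0 : σ'.rv = σ.rv) : Found x σ' := by
  unfold Found
  rwa [h1, h0]

theorem Keeps.rv_eq {x : ℕ} {e : NExp} {σ σ' : State} (h : Keeps (.setN x e) σ σ') :
    σ'.rv = σ.rv := funext fun _ => h.rv _ rfl

/-- If `s` lies before the arc `J` at the node, the left end of `J` lies between `s` and every point
of `J` and of the right subtree; recording it settles all of these, and the search goes on to the
left. The other direction is symmetric. If `s` lies on `J`, the point itself is valid and lies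
between `s` and everything. Only the implication from arcs to `Q` is assumed, since it passes to
subtrees. -/
theorem searchLoop_spec {n : ℕ} (hn : 1 ≤ n) {I : Inst n} {a b : Fin n} (hab : a ≠ b) {τ : Bool}
    {s : ℝ} (t : BinaryTree Arc)
    (hmem : ∀ J ∈ inorder t, (∀ p ∈ J.1, p ∈ I.bdry a b τ) ∧ (∀ q ∈ J.2, q ∈ I.bdry a b τ) ∧
      ∀ p ∈ J.1, ∀ q ∈ J.2, I.pos a b τ p ≤ I.pos a b τ q)
    (hpair : (inorder t).Pairwise fun J K => ∃ q ∈ J.2, ∃ p ∈ K.1, I.pos a b τ q < I.pos a b τ p)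
    (hQ : ∀ v ∈ I.bdry a b τ, (∃ J ∈ inorder t, OnArc (I.pos a b τ) J v) → v ∈ I.Q)
    {σ : State} (hE : I.ExtentAt σ) (hV : I.VippodromeAt a b τ σ) (hP : I.PointAt a b τ s σ)
    (hB : I.BestAt σ) (ht : TreeAt σ t (σ.nv 5)) :
    Halts searchLoop σ (t.height * (searchStep.bound + 3) + 3) fun σ' =>
      I.BestAt σ' ∧ Improves σ σ' ∧ ∀ v ∈ I.bdry a b τ,
        (∃ J ∈ inorder t, OnArc (I.pos a b τ) J v) →
          ∃ z ∈ uIcc s (I.sc a b τ v), Found (I.area (I.curve a b τ z)) σ' := by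
  induction t generalizing σ with
  | nil =>
    refine (Halts.loop_done ?_ ⟨hB, fun _ h => h, ?_⟩).mono (by simp [BExp.cost, NExp.cost])
      fun _ _ h => h
    · have : σ.nv 5 = 0 := ht
      simp [this]
    · simp [inorder]
  | node J l r ihl ihr =>
    obtain ⟨h0, hlo, hhi, htl, htr⟩ := ht
    rw [inorder] at hmem hpair hQ ⊢
    obtain ⟨hpl, hpr, hplr⟩ := List.pairwise_append.1 hpair
    rw [List.pairwise_cons] at hpr
    have hmJ := hmem J (by simp)
    have ihl' := @ihl (fun K hK => hmem K (by simp [hK])) hpl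
      (fun v hv ⟨K, hK, hKv⟩ => hQ v hv ⟨K, by simp [hK], hKv⟩)
    have ihr' := @ihr (fun K hK => hmem K (by simp [hK])) hpr.2
      (fun v hv ⟨K, hK, hKv⟩ => hQ v hv ⟨K, by simp [hK], hKv⟩)
    clear ihl ihr
    have hcurve {w : Plane} (hw : w ∈ I.bdry a b τ) : I.curve a b τ (I.sc a b τ w) = w := by
      rw [I.bdry_eq hab] at hw
      obtain ⟨z, rfl⟩ := hw
      rw [I.sc_curve hab]
    have hposc (z : ℝ) (w : Plane) :
        I.pos a b τ (I.curve a b τ z) ≤ I.pos a b τ w ↔ z ≤ I.sc a b τ w := by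
      rw [I.pos_le_pos hab, I.sc_curve hab]
    have hposc' (z : ℝ) (w : Plane) :
        I.pos a b τ w ≤ I.pos a b τ (I.curve a b τ z) ↔ I.sc a b τ w ≤ z := by
      rw [I.pos_le_pos hab, I.sc_curve hab]
    have hpos {w : Plane} {x y : ℝ} (hx : x = w 0) (hy : y = w 1) :
        σ.rv 11 * y - σ.rv 12 * x = I.pos a b τ w := by
      rw [hx, hy, hV.d₀, hV.d₁, Inst.pos]
    have hcurveQ : (OnArc (I.pos a b τ) J (I.curve a b τ s)) → I.curve a b τ s ∈ I.Q := fun h =>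
      hQ _ (by rw [I.bdry_eq hab]; exact ⟨s, rfl⟩) ⟨J, by simp, h⟩
    -- the three outcomes of the comparison
    let P : State → Prop := fun σ' => I.BestAt σ' ∧ Improves σ σ' ∧
      ((TreeAt σ l (σ'.nv 5) ∧ ∃ p ∈ J.1, s ≤ I.sc a b τ p ∧ Found (I.area p) σ') ∨
      (TreeAt σ r (σ'.nv 5) ∧ ∃ p ∈ J.2, I.sc a b τ p ≤ s ∧ Found (I.area p) σ') ∨
      (σ'.nv 5 = 0 ∧ Found (I.area (I.curve a b τ s)) σ'))
    have hstep : Halts searchStep σ searchStep.bound P := by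
      refine (Halts.cond (B := searchStep.bound -
        (BExp.conj (.leN 1 (.get 4 (.var 5))) (.ltR (.var 22) (endPosExp 4 5))).cost)
        (fun hb => ?_) fun hb => (Halts.cond (B := searchStep.bound -
        (BExp.conj (.leN 1 (.get 4 (.var 5))) (.ltR (.var 22) (endPosExp 4 5))).cost -
        (BExp.conj (.leN 1 (.get 5 (.var 5))) (.ltR (endPosExp 6 7) (.var 22))).cost)
        (fun hb' => ?_) fun hb' => ?_).mono ?_ fun _ _ h => h).mono ?_ fun _ _ h => h
      · simp only [BExp.holds_conj, BExp.holds_leN, BExp.holds_ltR, endPosExp, NExp.eval_ofNat,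
          NExp.eval_get, NExp.eval_var, RExp.eval_sub, RExp.eval_mul, RExp.eval_var,
          RExp.eval_get] at hb
        obtain ⟨p, hp, hx, hy⟩ := endAt_some hlo hb.1
        have hp : p ∈ J.1 := hp
        have hlt := hb.2
        rw [hpos hx hy, hP.2.2] at hlt
        have hpQ : p ∈ I.Q := hQ p (hmJ.1 p hp) ⟨J, by simp, fun p' hp' => by
          rw [Option.mem_unique hp' hp], fun q hq => hmJ.2.2 p hp q hq⟩
        refine (seq_setN_spec (m := σ.na 2 (σ.nv 5))
          (candidateCmd_spec hn hE hB hpQ (x := .get 4 (.var 5)) (y := .get 5 (.var 5))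
          (by simpa using hx) (by simpa using hy)) ?_ ?_).mono ?_ ?_
        · intro σ' hk
          simp [hk.na 2 rfl, hk.nv 5 rfl]
        · rintro σ₁ σ₂ hk ⟨h1, h2, h3⟩
          exact ⟨h1.congr (hk.nv 1 rfl) hk.rv_eq, fun x hx =>
            (h2 x hx).congr (hk.nv 1 rfl) hk.rv_eq, h3.congr (hk.nv 1 rfl) hk.rv_eq⟩
        · simp only [searchStep, Cmd.bound]; omega
        · rintro σ' hk ⟨⟨h1, h2, h3⟩, h4⟩
          refine ⟨h1, h2, .inl ⟨by rwa [h4], p, hp, ?_, h3⟩⟩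
          exact (hposc _ _).1 hlt.le
      · simp only [BExp.holds_conj, BExp.holds_leN, BExp.holds_ltR, endPosExp, NExp.eval_ofNat,
          NExp.eval_get, NExp.eval_var, RExp.eval_sub, RExp.eval_mul, RExp.eval_var,
          RExp.eval_get] at hb'
        obtain ⟨p, hp, hx, hy⟩ := endAt_some hhi hb'.1
        have hp : p ∈ J.2 := hp
        have hlt := hb'.2
        rw [hpos hx hy, hP.2.2] at hlt
        have hpQ : p ∈ I.Q := hQ p (hmJ.2.1 p hp) ⟨J, by simp, fun q hq => hmJ.2.2 q hq p hp,
          fun p' hp' => by rw [Option.mem_unique hp' hp]⟩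
        refine (seq_setN_spec (m := σ.na 3 (σ.nv 5))
          (candidateCmd_spec hn hE hB hpQ (x := .get 6 (.var 5)) (y := .get 7 (.var 5))
          (by simpa using hx) (by simpa using hy)) ?_ ?_).mono ?_ ?_
        · intro σ' hk
          simp [hk.na 3 rfl, hk.nv 5 rfl]
        · rintro σ₁ σ₂ hk ⟨h1, h2, h3⟩
          exact ⟨h1.congr (hk.nv 1 rfl) hk.rv_eq, fun x hx =>
            (h2 x hx).congr (hk.nv 1 rfl) hk.rv_eq, h3.congr (hk.nv 1 rfl) hk.rv_eq⟩
        · simp only [searchStep, Cmd.bound]; omega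
        · rintro σ' hk ⟨⟨h1, h2, h3⟩, h4⟩
          refine ⟨h1, h2, .inr (.inl ⟨by rwa [h4], p, hp, ?_, h3⟩)⟩
          exact (hposc' _ _).1 hlt.le
      · simp only [BExp.holds_conj, BExp.holds_leN, BExp.holds_ltR, endPosExp, NExp.eval_ofNat,
          NExp.eval_get, NExp.eval_var, RExp.eval_sub, RExp.eval_mul, RExp.eval_var,
          RExp.eval_get, not_and, not_lt] at hb hb'
        have hon : OnArc (I.pos a b τ) J (I.curve a b τ s) := by
          constructor
          · intro p hp
            by_cases hf : 1 ≤ σ.na 4 (σ.nv 5)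
            · obtain ⟨p', hp', hx, hy⟩ := endAt_some hlo hf
              rw [Option.mem_unique hp hp', ← hP.2.2, ← hpos hx hy]
              exact hb hf
            · rw [endAt_none hlo hf] at hp
              simp at hp
          · intro p hp
            by_cases hf : 1 ≤ σ.na 5 (σ.nv 5)
            · obtain ⟨p', hp', hx, hy⟩ := endAt_some hhi hf
              rw [Option.mem_unique hp hp', ← hP.2.2, ← hpos hx hy]
              exact hb' hf
            · rw [endAt_none hhi hf] at hp
              simp at hp
        refine (seq_setN_spec (m := 0)
          (candidateCmd_spec hn hE hB (hcurveQ hon) (x := .var 20) (y := .var 21)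
          (by simpa using hP.1) (by simpa [Function.update] using hP.2.1)) ?_ ?_).mono ?_ ?_
        · intro σ' hk
          simp
        · rintro σ₁ σ₂ hk ⟨h1, h2, h3⟩
          exact ⟨h1.congr (hk.nv 1 rfl) hk.rv_eq, fun x hx =>
            (h2 x hx).congr (hk.nv 1 rfl) hk.rv_eq, h3.congr (hk.nv 1 rfl) hk.rv_eq⟩
        · simp only [searchStep, Cmd.bound]; omega
        · rintro σ' hk ⟨⟨h1, h2, h3⟩, h4⟩
          exact ⟨h1, h2, .inr (.inr ⟨h4, h3⟩)⟩
      · simp only [searchStep, Cmd.bound]; omega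
      · simp only [searchStep, Cmd.bound]; omega
    refine (Halts.loop_step (B' := max l.height r.height * (searchStep.bound + 3) + 3)
      (by simp; omega) hstep fun σ' hk hσ' => ?_).mono ?_ fun _ _ h => h
    · obtain ⟨hB', hI', hcase⟩ := hσ'
      have hE' := hE.keeps hk rfl
      have hV' := hV.keeps hk rfl
      have hP' := hP.keeps hk rfl
      obtain ⟨-, hna, hra⟩ := hk.na_eq rfl
      rcases hcase with ⟨htree, p, hp, hsp, hf⟩ | ⟨htree, p, hp, hsp, hf⟩ | ⟨hz, hf⟩
      · refine (ihl' hE' hV' hP' hB' (htree.congr hna hra)).mono ?_ ?_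
        · gcongr
          exact le_max_left _ _
        · rintro σ'' - ⟨h1, h2, h3⟩
          refine ⟨h1, fun x hx => h2 x (hI' x hx), fun v hv ⟨K, hK, hKv⟩ => ?_⟩
          -- The recorded end serves every discarded arc point to its right.
          have hright (hle : I.pos a b τ p ≤ I.pos a b τ v) :
              ∃ z ∈ uIcc s (I.sc a b τ v), Found (I.area (I.curve a b τ z)) σ'' := by
            rw [I.pos_le_pos hab] at hle
            refine ⟨I.sc a b τ p, ?_, ?_⟩
            · rw [uIcc_of_le (hsp.trans hle)]
              exact ⟨hsp, hle⟩
            · rw [hcurve (hmJ.1 p hp)]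
              exact h2 _ hf
          rw [List.mem_append, List.mem_cons] at hK
          rcases hK with hK | rfl | hK
          · exact h3 v hv ⟨K, hK, hKv⟩
          · exact hright (hKv.1 p hp)
          · obtain ⟨q, hq, p', hp', hlt⟩ := hpr.1 K hK
            exact hright ((hmJ.2.2 p hp q hq).trans (hlt.le.trans (hKv.1 p' hp')))
      · refine (ihr' hE' hV' hP' hB' (htree.congr hna hra)).mono ?_ ?_
        · gcongr
          exact le_max_right _ _
        · rintro σ'' - ⟨h1, h2, h3⟩
          refine ⟨h1, fun x hx => h2 x (hI' x hx), fun v hv ⟨K, hK, hKv⟩ => ?_⟩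
          have hleft (hle : I.pos a b τ v ≤ I.pos a b τ p) :
              ∃ z ∈ uIcc s (I.sc a b τ v), Found (I.area (I.curve a b τ z)) σ'' := by
            rw [I.pos_le_pos hab] at hle
            refine ⟨I.sc a b τ p, ?_, ?_⟩
            · rw [uIcc_of_ge (hle.trans hsp)]
              exact ⟨hle, hsp⟩
            · rw [hcurve (hmJ.2.1 p hp)]
              exact h2 _ hf
          rw [List.mem_append, List.mem_cons] at hK
          rcases hK with hK | rfl | hK
          · obtain ⟨q, hq, p', hp', hlt⟩ := hplr K hK J (by simp)
            exact hleft ((hKv.2 q hq).trans (hlt.le.trans (hmJ.2.2 p' hp' p hp)))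
          · exact hleft (hKv.2 p hp)
          · exact h3 v hv ⟨K, hK, hKv⟩
      · refine (Halts.loop_done ?_ ⟨hB', hI', fun v hv _ => ⟨s, left_mem_uIcc, hf⟩⟩).mono ?_
          fun _ _ h => h
        · simp [hz]
        · simp [BExp.cost, NExp.cost]
    · have : (BExp.leN 1 (.var 5)).cost = 3 := rfl
      rw [this, BinaryTree.height, add_mul]; omega

/-- Search for the point at the position given by the expression. -/
def searchCmd (e : RExp) : Cmd :=
  seqs [.setR 18 e, pointCmd, .setN 5 (.var 6), searchLoop]

theorem searchCmd_spec {n : ℕ} (hn : 1 ≤ n) {I : Inst n} {a b : Fin n} (hab : a ≠ b) {τ : Bool}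
    {t : BinaryTree Arc} (ht : ListsArcs (I.bdry a b τ) I.Q (I.pos a b τ) (inorder t)) {σ : State}
    (hE : I.ExtentAt σ) (hV : I.VippodromeAt a b τ σ) (hB : I.BestAt σ)
    (htree : TreeAt σ t (σ.nv 6)) (e : RExp) :
    Halts (searchCmd e) σ ((e.cost + 1) + (pointCmd.bound +
      (2 + ((t.height * (searchStep.bound + 3) + 3) + 1)))) fun σ' =>
      I.BestAt σ' ∧ Improves σ σ' ∧ ∀ v ∈ I.bdry a b τ, v ∈ I.Q →
        ∃ z ∈ uIcc (e.eval σ) (I.sc a b τ v), Found (I.area (I.curve a b τ z)) σ' := by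
  refine Halts.seq (P := fun σ' => σ'.rv 18 = e.eval σ)
    (Halts.of_flat (p := .setR 18 e) rfl fun _ => by simp [Cmd.run]) fun σ₁ hk₁ h₁ => ?_
  have hV₁ := hV.keeps hk₁ rfl
  refine Halts.seq (P := I.PointAt a b τ (e.eval σ)) (Halts.of_flat rfl fun _ => h₁ ▸
    pointCmd_spec hV₁) fun σ₂ hk₂ h₂ => ?_
  refine Halts.seq (P := fun σ' => σ'.nv 5 = σ.nv 6) (Halts.of_flat (p := .setN 5 (.var 6)) rfl
    fun _ => by simp [Cmd.run, hk₂.nv 6 rfl, hk₁.nv 6 rfl]) fun σ₃ hk₃ h₃ => ?_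
  have hE₃ := ((hE.keeps hk₁ rfl).keeps hk₂ rfl).keeps hk₃ rfl
  have hV₃ := (hV₁.keeps hk₂ rfl).keeps hk₃ rfl
  have hP₃ := h₂.keeps hk₃ rfl
  have hfound (x : ℝ) : Found x σ → Found x σ₃ := by
    unfold Found
    rw [hk₃.nv 1 rfl, hk₂.nv 1 rfl, hk₁.nv 1 rfl, hk₃.rv 2 rfl, hk₂.rv 2 rfl, hk₁.rv 2 rfl]
    exact id
  have hB₃ : I.BestAt σ₃ := by
    unfold Inst.BestAt
    rw [hk₃.nv 1 rfl, hk₂.nv 1 rfl, hk₁.nv 1 rfl, hk₃.rv 0 rfl, hk₂.rv 0 rfl, hk₁.rv 0 rfl,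
      hk₃.rv 1 rfl, hk₂.rv 1 rfl, hk₁.rv 1 rfl, hk₃.rv 2 rfl, hk₂.rv 2 rfl, hk₁.rv 2 rfl]
    exact hB
  obtain ⟨-, hna₁, hra₁⟩ := hk₁.na_eq rfl
  obtain ⟨-, hna₂, hra₂⟩ := hk₂.na_eq rfl
  obtain ⟨-, hna₃, hra₃⟩ := hk₃.na_eq rfl
  have htree₃ : TreeAt σ₃ t (σ₃.nv 5) := by
    rw [h₃]
    exact ((htree.congr hna₁ hra₁).congr hna₂ hra₂).congr hna₃ hra₃
  refine (searchLoop_spec hn hab t ht.1 ht.2.1 (fun v hv h => (ht.2.2 v hv).2 h) hE₃ hV₃ hP₃ hB₃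
    htree₃).seq fun σ₄ _ h₄ => Halts.of_flat (p := .skip) rfl fun _ => ?_
  exact ⟨h₄.1, fun x hx => h₄.2.1 x (hfound x hx), fun v hv hvQ =>
    h₄.2.2 v hv ((ht.2.2 v hv).1 hvQ)⟩

/-! ### The sweep over all boundary curves -/

theorem Improves.trans {σ₁ σ₂ σ₃ : State} (h : Improves σ₁ σ₂) (h' : Improves σ₂ σ₃) :
    Improves σ₁ σ₃ := fun x hx => h' x (h x hx)

theorem Keeps.improves {p : Cmd} {σ σ' : State} (hk : Keeps p σ σ')
    (hp : (p.keepsN 1 && p.keepsR 2) = true) : Improves σ σ' := by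
  simp only [Bool.and_eq_true] at hp
  intro x hx
  unfold Found
  rwa [hk.nv 1 hp.1, hk.rv 2 hp.2]

theorem Inst.BestAt.keeps {n : ℕ} {I : Inst n} {p : Cmd} {σ σ' : State} (h : I.BestAt σ)
    (hk : Keeps p σ σ') (hp : (p.keepsN 1 && p.keepsR 0 && p.keepsR 1 && p.keepsR 2) = true) :
    I.BestAt σ' := by
  simp only [Bool.and_eq_true] at hp
  unfold Inst.BestAt
  rwa [hk.nv 1 hp.1.1.1, hk.rv 0 hp.1.1.2, hk.rv 1 hp.1.2, hk.rv 2 hp.2]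

/-- A bound for the cost of the search for a breakpoint in a tree of height `0`. -/
def searchCost (e : RExp) : ℕ := e.cost + pointCmd.bound + searchStep.bound + 10

/-- Each expression is evaluated in the intermediate state in which its search begins. Of this state
only the geometric data are recorded, and they determine the value of every breakpoint expression.
-/
theorem searchAll_spec {n : ℕ} (hn : 1 ≤ n) {I : Inst n} {a b : Fin n} (hab : a ≠ b) {τ : Bool}
    {t : BinaryTree Arc} (ht : ListsArcs (I.bdry a b τ) I.Q (I.pos a b τ) (inorder t)) {H : ℕ}
    (hH : t.height ≤ H) (l : List RExp) {σ : State} (hE : I.ExtentAt σ)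
    (hV : I.VippodromeAt a b τ σ) (hB : I.BestAt σ) (htree : TreeAt σ t (σ.nv 6)) :
    Halts (seqs (l.map searchCmd)) σ ((l.map searchCost).sum * (H + 1) + 1) fun σ' =>
      I.BestAt σ' ∧ Improves σ σ' ∧ ∀ e ∈ l, ∃ σ₁, I.ExtentAt σ₁ ∧ I.VippodromeAt a b τ σ₁ ∧
        ∀ v ∈ I.bdry a b τ, v ∈ I.Q →
          ∃ z ∈ uIcc (e.eval σ₁) (I.sc a b τ v), Found (I.area (I.curve a b τ z)) σ' := by
  induction l generalizing σ with
  | nil =>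
    exact (Halts.of_flat (p := .skip) rfl fun _ => ⟨hB, fun _ h => h, by simp⟩).mono
      (by simp [Cmd.bound]) fun _ _ h => h
  | cons e l ih =>
    refine (Halts.seq (B' := (l.map searchCost).sum * (H + 1) + 1)
      (searchCmd_spec hn hab ht hE hV hB htree e) fun σ' hk h => ?_).mono ?_ fun _ _ h => h
    · obtain ⟨-, hna, hra⟩ := hk.na_eq rfl
      refine (ih (hE.keeps hk rfl) (hV.keeps hk rfl) h.1
        (by rw [hk.nv 6 rfl]; exact htree.congr hna hra)).mono le_rfl fun σ'' _ h' => ?_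
      refine ⟨h'.1, h.2.1.trans h'.2.1, fun e' he' => ?_⟩
      rcases List.mem_cons.1 he' with rfl | he'
      · refine ⟨σ, hE, hV, fun v hv hvQ => ?_⟩
        obtain ⟨z, hz, hf⟩ := h.2.2 v hv hvQ
        exact ⟨z, hz, h'.2.1 _ hf⟩
      · exact h'.2.2 e' he'
    · rw [List.map_cons, List.sum_cons, add_mul]
      have : e.cost + 1 + (pointCmd.bound + (2 + (t.height * (searchStep.bound + 3) + 3 + 1))) ≤
          searchCost e * (H + 1) := by
        have h1 := Nat.mul_le_mul_right (searchStep.bound + 3) hH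
        have h2 : searchCost e * (H + 1) = H * (searchStep.bound + 3) +
          H * (e.cost + pointCmd.bound + 7) + searchCost e := by
          unfold searchCost; ring
        rw [h2]
        unfold searchCost
        omega
      omega

/-- Take into account what the tree of the boundary of type `τ` of the pairs in the integer
registers `2` and `3` says about the breakpoints. -/
def curveCmd (τ : Bool) : Cmd :=
  .seq (loadCmd τ) (.seq (.setN 6 (.get 1 (.var 4 + .lit τ.toNat)))
    (seqs (breakpointsExp.map searchCmd)))

/-- The cost of `curveCmd`, up to a factor that depends on the heights of the trees. -/
def curveCost : ℕ :=
  (loadCmd true).bound + (loadCmd false).bound + (breakpointsExp.map searchCost).sum + 7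

/-- For a valid point at position `x`, `Inst.exists_breakpoint` gives a breakpoint from which the
area up to `x` never exceeds its value at `x`. The search for this breakpoint finds a candidate at
least as good as some point of that interval. -/
theorem curveCmd_spec {n c : ℕ} (hn : 1 ≤ n) {I : Inst n} {a b : Fin n} (hab : a ≠ b) (τ : Bool)
    {σ : State} (hI : InputOK c I σ) (hE : I.ExtentAt σ) (hB : I.BestAt σ) (ha : σ.nv 2 = a)
    (hb : σ.nv 3 = b) (h4 : σ.nv 4 = 2 * (n * a + b)) :
    Halts (curveCmd τ) σ (curveCost * (c * Nat.log 2 (4 + 144 * (n * n)) + 1)) fun σ' =>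
      I.BestAt σ' ∧ Improves σ σ' ∧ ∀ v ∈ I.bdry a b τ, v ∈ I.Q → Found (I.area v) σ' := by
  set H := c * Nat.log 2 (4 + 144 * (n * n))
  obtain ⟨t, ht, htree⟩ := hI.2.2 a b hab τ
  have hload : (loadCmd τ).flat = true ∧ (loadCmd τ).keepsExtent = true ∧
      (loadCmd τ).keepsInput = true ∧ (loadCmd τ).keepsN 1 = true ∧ (loadCmd τ).keepsN 4 = true ∧
      (loadCmd τ).keepsR 0 = true ∧ (loadCmd τ).keepsR 1 = true ∧ (loadCmd τ).keepsR 2 = true := by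
    cases τ <;> decide
  obtain ⟨hl1, hl2, hl3, hl4, hl5, hl6, hl7, hl8⟩ := hload
  have h1 : (NExp.get 1 (.var 4 + .lit τ.toNat)).cost = 4 := rfl
  have h2 : (loadCmd τ).bound ≤ (loadCmd true).bound + (loadCmd false).bound := by
    cases τ <;> omega
  refine Halts.mono (B := (loadCmd τ).bound +
    (5 + ((breakpointsExp.map searchCost).sum * (H + 1) + 1)))
    (P := fun σ' => I.BestAt σ' ∧ Improves σ σ' ∧ ∀ v ∈ I.bdry a b τ, v ∈ I.Q →
      Found (I.area v) σ') ?_ ?_ fun _ _ h => h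
  · refine (Halts.of_flat (P := I.VippodromeAt a b τ) hl1 fun _ => loadCmd_spec hI ha hb τ).seq
      fun σ₁ hk₁ h₁ => ?_
    refine (Halts.of_flat (P := fun σ' => TreeAt σ' t (σ'.nv 6))
      (p := .setN 6 (.get 1 (.var 4 + .lit τ.toNat))) rfl fun hk => ?_).seq fun σ₂ hk₂ h₂ => ?_
    · obtain ⟨-, hna₁, hra₁⟩ := hk₁.na_eq hl3
      obtain ⟨-, hna, hra⟩ := hk.na_eq rfl
      have := (htree.congr hna₁ hra₁).congr hna hra
      simpa [Cmd.run, hna₁, hk₁.nv 4 hl5, h4, NExp.eval] using this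
    refine (searchAll_spec hn hab ht.1 (I.height_le hab τ ht) breakpointsExp
      ((hE.keeps hk₁ hl2).keeps hk₂ rfl) (h₁.keeps hk₂ rfl)
      ((hB.keeps hk₁ (by simp [hl4, hl6, hl7, hl8])).keeps hk₂ rfl) h₂).mono le_rfl
      fun σ' _ h => ⟨h.1, ?_, fun v hv hvQ => ?_⟩
    · exact ((hk₁.improves (by simp [hl4, hl8])).trans (hk₂.improves rfl)).trans h.2.1
    · obtain ⟨x, hx⟩ : ∃ x, v = I.curve a b τ x := by
        rw [I.bdry_eq hab] at hv
        obtain ⟨x, rfl⟩ := hv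
        exact ⟨x, rfl⟩
      subst hx
      obtain ⟨p, hp, hle⟩ := I.exists_breakpoint hn hab τ x
      have hE₁ := hE.keeps hk₁ hl2
      rw [← map_eval_breakpointsExp hE₁ h₁, List.mem_map] at hp
      obtain ⟨e, he, rfl⟩ := hp
      obtain ⟨σ₃, hE₃, hV₃, h3⟩ := h.2.2 e he
      obtain ⟨z, hz, hf⟩ := h3 _ hv hvQ
      -- In both states the list of values is the list of breakpoints of the same curve.
      have heq : e.eval σ₃ = e.eval σ₁ := List.map_inj_left.1
        ((map_eval_breakpointsExp hE₃ hV₃).trans (map_eval_breakpointsExp hE₁ h₁).symm) e he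
      rw [heq, I.sc_curve hab] at hz
      exact hf.mono (hle z hz)
  · unfold curveCost
    generalize (loadCmd true).bound + (loadCmd false).bound = x at h2 ⊢
    generalize (loadCmd τ).bound = y at h2 ⊢
    generalize (breakpointsExp.map searchCost).sum = z
    nlinarith [Nat.zero_le (x * H)]

/-- Take into account the two boundary curves of the pairs in the integer registers `2` and `3`. -/
def pairCmd : Cmd :=
  .cond (.conj (.leN (.var 2) (.var 3)) (.leN (.var 3) (.var 2))) .skip
    (.seq (curveCmd true) (curveCmd false))

/-- Take into account all boundary curves. -/
def sweepCmd : Cmd :=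
  .seq (.setN 4 0) (forCmd 2 (forCmd 3 (.seq pairCmd (.setN 4 (.var 4 + 2)))))

theorem curveCmd_keepsN (τ : Bool) {x : ℕ} (h1 : x ≠ 1) (h5 : x ≠ 5) (h6 : x ≠ 6) :
    (curveCmd τ).keepsN x = true := by
  have : (seqs (breakpointsExp.map searchCmd)).keepsN x = true := by
    refine seqs_keepsN fun p hp => ?_
    obtain ⟨e, -, rfl⟩ := List.mem_map.1 hp
    simp [searchCmd, seqs, Cmd.keepsN, pointCmd, profileCmd, searchLoop, searchStep, candidateCmd,
      h1, h5]
  simp [curveCmd, Cmd.keepsN, this, h6, loadCmd, seqs]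

theorem curveCmd_keepsR (τ : Bool) {x : ℕ} (h2 : 2 < x) (h11 : x < 11) :
    (curveCmd τ).keepsR x = true := by
  have : (seqs (breakpointsExp.map searchCmd)).keepsR x = true := by
    refine seqs_keepsR fun p hp => ?_
    obtain ⟨e, -, rfl⟩ := List.mem_map.1 hp
    simp [searchCmd, seqs, Cmd.keepsR, pointCmd, profileCmd, searchLoop, searchStep, candidateCmd]
    omega
  simp [curveCmd, Cmd.keepsR, this, loadCmd, seqs]
  omega

theorem curveCmd_keepsNA (τ : Bool) (x : ℕ) : (curveCmd τ).keepsNA x = true := by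
  have : (seqs (breakpointsExp.map searchCmd)).keepsNA x = true := by
    refine seqs_keepsNA fun p hp => ?_
    obtain ⟨e, -, rfl⟩ := List.mem_map.1 hp
    simp [searchCmd, seqs, Cmd.keepsNA, pointCmd, profileCmd, searchLoop, searchStep, candidateCmd]
  simp [curveCmd, Cmd.keepsNA, this, loadCmd, seqs]

theorem curveCmd_keepsRA (τ : Bool) : (curveCmd τ).keepsRA = true := by
  have : (seqs (breakpointsExp.map searchCmd)).keepsRA = true := by
    refine seqs_keepsRA fun p hp => ?_
    obtain ⟨e, -, rfl⟩ := List.mem_map.1 hp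
    simp [searchCmd, seqs, Cmd.keepsRA, pointCmd, profileCmd, searchLoop, searchStep, candidateCmd]
  simp [curveCmd, Cmd.keepsRA, this, loadCmd, seqs]

theorem curveCmd_keepsInput (τ : Bool) : (curveCmd τ).keepsInput = true := by
  simp [Cmd.keepsInput, curveCmd_keepsN, curveCmd_keepsNA, curveCmd_keepsRA]

theorem curveCmd_keepsExtent (τ : Bool) : (curveCmd τ).keepsExtent = true := by
  refine List.all_eq_true.2 fun x hx => ?_
  rw [List.mem_range'_1] at hx
  exact curveCmd_keepsR τ (by omega) (by omega)

/-- All boundary curves of the pairs `(a, b)` before `(i, j)` have been taken into account. -/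
def Inst.Swept {n : ℕ} (I : Inst n) (i j : ℕ) (σ : State) : Prop :=
  ∀ a b : Fin n, a ≠ b → (a.val < i ∨ a.val = i ∧ b.val < j) →
    ∀ τ, ∀ v ∈ I.bdry a b τ, v ∈ I.Q → Found (I.area v) σ

theorem Inst.Swept.improves {n : ℕ} {I : Inst n} {i j : ℕ} {σ σ' : State} (h : I.Swept i j σ)
    (hi : Improves σ σ') : I.Swept i j σ' :=
  fun a b hab hlt τ v hv hvQ => hi _ (h a b hab hlt τ v hv hvQ)

theorem pairCmd_spec {n c : ℕ} (hn : 1 ≤ n) {I : Inst n} {a b : Fin n} {σ : State}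
    (hI : InputOK c I σ) (hE : I.ExtentAt σ) (hB : I.BestAt σ) (ha : σ.nv 2 = a)
    (hb : σ.nv 3 = b) (h4 : σ.nv 4 = 2 * (n * a + b)) (hS : I.Swept a b σ) :
    Halts pairCmd σ ((2 * curveCost + 7) * (c * Nat.log 2 (4 + 144 * (n * n)) + 1)) fun σ' =>
      I.BestAt σ' ∧ I.Swept a (b + 1) σ' := by
  set H := c * Nat.log 2 (4 + 144 * (n * n)) with hH
  refine (Halts.cond (B := 2 * (curveCost * (H + 1)) + 0) (fun hab => ?_) fun hab => ?_).mono ?_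
    fun _ _ h => h
  -- A pair has no vippodrome with itself, so the diagonal only advances the bookkeeping.
  · have hab : a = b := by
      simp only [BExp.holds_conj, BExp.holds_leN, NExp.eval_var, ha, hb] at hab
      exact Fin.ext (le_antisymm hab.1 hab.2)
    refine (Halts.of_flat (p := .skip) rfl fun _ => ⟨hB, ?_⟩).mono ?_ fun _ _ h => h
    · have : 1 ≤ curveCost := by unfold curveCost; omega
      simp only [Cmd.bound]
      nlinarith [Nat.zero_le (curveCost * H)]
    · rintro a' b' hab' (hlt | ⟨heq, hlt⟩) τ v hv hvQ
      · exact hS a' b' hab' (.inl hlt) τ v hv hvQ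
      · rcases Nat.lt_succ_iff_lt_or_eq.1 hlt with hlt | hlt
        · exact hS a' b' hab' (.inr ⟨heq, hlt⟩) τ v hv hvQ
        · exact absurd (Fin.ext (heq.trans ((congrArg _ hab).trans hlt.symm))) hab'
  · have hab : a ≠ b := by
      rintro rfl
      exact hab (by simp only [BExp.holds_conj, BExp.holds_leN, NExp.eval_var, ha, hb, le_refl,
        and_self])
    have hkt := curveCmd_keepsInput true
    refine ((curveCmd_spec hn hab true hI hE hB ha hb h4).seq fun σ₁ hk₁ h₁ =>
      curveCmd_spec hn hab false (hI.keeps hk₁ hkt) (hE.keeps hk₁ (curveCmd_keepsExtent true)) h₁.1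
        (by rw [hk₁.nv 2 (curveCmd_keepsN true (by decide) (by decide) (by decide)), ha])
        (by rw [hk₁.nv 3 (curveCmd_keepsN true (by decide) (by decide) (by decide)), hb])
        (by rw [hk₁.nv 4 (curveCmd_keepsN true (by decide) (by decide) (by decide)), h4])
        |>.mono le_rfl fun σ₂ _ h₂ =>
          (show I.BestAt σ₂ ∧ I.Swept a (b + 1) σ₂ from ⟨h₂.1, ?_⟩)).mono ?_ fun _ _ h => h
    · rintro a' b' hab' hlt τ v hv hvQ
      by_cases heq : a' = a ∧ b' = b
      · obtain ⟨rfl, rfl⟩ := heq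
        cases τ
        · exact h₂.2.2 v hv hvQ
        · exact h₂.2.1 _ (h₁.2.2 v hv hvQ)
      · refine h₂.2.1 _ (h₁.2.1 _ (hS a' b' hab' ?_ τ v hv hvQ))
        rcases hlt with hlt | ⟨h1, h2⟩
        · exact .inl hlt
        · refine .inr ⟨h1, lt_of_le_of_ne (Nat.lt_succ_iff.1 h2) fun h3 => heq ?_⟩
          exact ⟨Fin.ext h1, Fin.ext h3⟩
    · rw [← hH]; omega
  · have : (BExp.conj (.leN (.var 2) (.var 3)) (.leN (.var 3) (.var 2))).cost = 7 := rfl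
    rw [this]
    nlinarith

theorem pairCmd_keeps : pairCmd.keepsInput = true ∧ pairCmd.keepsExtent = true ∧
    pairCmd.keepsN 2 = true ∧ pairCmd.keepsN 3 = true ∧ pairCmd.keepsN 4 = true ∧
    pairCmd.keepsN 0 = true := by
  have hN {x : ℕ} (h1 : x ≠ 1) (h5 : x ≠ 5) (h6 : x ≠ 6) : pairCmd.keepsN x = true := by
    simp [pairCmd, Cmd.keepsN, curveCmd_keepsN, h1, h5, h6]
  refine ⟨?_, ?_, hN (by decide) (by decide) (by decide), hN (by decide) (by decide) (by decide),
    hN (by decide) (by decide) (by decide), hN (by decide) (by decide) (by decide)⟩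
  · have h0 : pairCmd.keepsN 0 = true := hN (by decide) (by decide) (by decide)
    simp only [Cmd.keepsInput, h0]
    simp [pairCmd, Cmd.keepsNA, Cmd.keepsRA, curveCmd_keepsNA,
      curveCmd_keepsRA]
  · refine List.all_eq_true.2 fun x hx => ?_
    rw [List.mem_range'_1] at hx
    simp [pairCmd, Cmd.keepsR, curveCmd_keepsR _ (show 2 < x by omega) (by omega)]

/-- The machine has no integer multiplication, so the tree index `2 (n i + j)` is maintained by
adding 2 in each inner round, including the rounds on the diagonal. -/
theorem sweepCmd_spec {n c : ℕ} (hn : 1 ≤ n) {I : Inst n} {σ : State} (hI : InputOK c I σ)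
    (hE : I.ExtentAt σ) (hB : I.BestAt σ) :
    Halts sweepCmd σ (2 + (n + 1) * ((n + 1) *
      ((2 * curveCost + 7) * (c * Nat.log 2 (4 + 144 * (n * n)) + 1) + 4 + 8) + 8)) fun σ' =>
      I.BestAt σ' ∧ I.Swept n 0 σ' := by
  obtain ⟨hp1, hp2, hp3, hp4, hp5, hp6⟩ := pairCmd_keeps
  refine Halts.seq (P := fun σ' => σ'.nv 4 = 0) (Halts.of_flat (p := .setN 4 0) rfl
    fun _ => by simp [Cmd.run]) fun σ₁ hk₁ h₁ => ?_
  refine (Halts.forCmd (x := 2) (n := n) (P := fun i σ => InputOK c I σ ∧ I.ExtentAt σ ∧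
    I.BestAt σ ∧ σ.nv 4 = 2 * (n * i) ∧ I.Swept i 0 σ) (by decide) ?_ ?_ ?_ ?_ ?_ ?_).mono le_rfl
    fun σ' _ h => ⟨h.2.2.1, h.2.2.2.2⟩
  · simp [forCmd, Cmd.keepsN, hp3]
  · simp [forCmd, Cmd.keepsN, hp6]
  · rintro i σ σ' hk ⟨h1, h2, h3, h4, h5⟩
    exact ⟨h1.keeps hk rfl, h2.keeps hk rfl, h3.keeps hk rfl, by rw [hk.nv 4 rfl, h4],
      h5.improves (hk.improves rfl)⟩
  · rintro i hi σ h0 h2 ⟨hI, hE, hB, h4, hS⟩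
    refine (Halts.forCmd (x := 3) (n := n) (P := fun j σ => InputOK c I σ ∧ I.ExtentAt σ ∧
      I.BestAt σ ∧ σ.nv 2 = i ∧ σ.nv 4 = 2 * (n * i + j) ∧ I.Swept i j σ) (by decide) ?_ ?_ ?_ ?_
      h0 ⟨hI, hE, hB, h2, h4, hS⟩).mono le_rfl fun σ' _ h => ?_
    · simp [Cmd.keepsN, hp4]
    · simp [Cmd.keepsN, hp6]
    · rintro j σ σ' hk ⟨h1, h2, h3, h4, h5, h6⟩
      exact ⟨h1.keeps hk rfl, h2.keeps hk rfl, h3.keeps hk rfl, by rw [hk.nv 2 rfl, h4],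
        by rw [hk.nv 4 rfl, h5], h6.improves (hk.improves rfl)⟩
    · rintro j hj σ h0 h3 ⟨hI, hE, hB, h2, h4, hS⟩
      refine (pairCmd_spec hn (a := ⟨i, hi⟩) (b := ⟨j, hj⟩) hI hE hB h2 h3 h4 hS).seq
        fun σ₁ hk₁ h₁ => Halts.of_flat (p := .setN 4 (.var 4 + 2)) rfl fun hk => ?_
      refine ⟨(hI.keeps hk₁ hp1).keeps hk rfl, (hE.keeps hk₁ hp2).keeps hk rfl, h₁.1.keeps hk rfl,
        ?_, ?_, h₁.2.improves (hk.improves rfl)⟩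
      · rw [hk.nv 2 rfl, hk₁.nv 2 hp3, h2]
      · simp [Cmd.run, hk₁.nv 4 hp5, h4]
        ring
    · obtain ⟨h1, h2, h3, h4, h5, h6⟩ := h
      refine ⟨h1, h2, h3, by rw [h5]; ring, fun a b hab hlt => h6 a b hab ?_⟩
      rcases hlt with hlt | ⟨-, hlt⟩
      · rcases Nat.lt_succ_iff_lt_or_eq.1 hlt with hlt | hlt
        · exact .inl hlt
        · exact .inr ⟨hlt, b.2⟩
      · omega
  · rw [hk₁.nv 0 rfl, hI.1]
  · refine ⟨hI.keeps hk₁ rfl, hE.keeps hk₁ rfl, hB.keeps hk₁ rfl, by simpa using h₁, ?_⟩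
    intro a b hab hlt
    omega

/-! ### Computing the bounding rectangles -/

/-- Store the sides of the bounding interval of the intervals of length `2` around the entries of
the real array `x` in the real registers `r` and `r + 1`. -/
def intervalCmd (x r : ℕ) : Cmd :=
  seqs [.setR r (.get x 0 - 1), .setR (r + 1) (.get x 0 + 1),
    forCmd 2 (.seq (.setR r (RExp.min (.var r) (.get x (.var 2) - 1)))
      (.setR (r + 1) (RExp.max (.var (r + 1)) (.get x (.var 2) + 1))))]

/-- The cost of one step of `intervalCmd`. -/
def intervalCost : ℕ :=
  (RExp.min (.var 0) (.get 0 (.var 2) - 1)).cost + 1 +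
    ((RExp.max (.var 0) (.get 0 (.var 2) + 1)).cost + 1)

/-- The invariant says that both stored bounds come from entries of the array and enclose the
intervals treated so far. The entry with index 0 starts the process, which needs `n ≥ 1`. -/
theorem intervalCmd_spec {n : ℕ} (hn : 1 ≤ n) (f : Fin n → ℝ) {σ : State} {x : ℕ} (r : ℕ)
    (h0 : σ.nv 0 = n) (hf : ∀ i : Fin n, σ.ra x i = f i) :
    Halts (intervalCmd x r) σ (5 + (5 + ((n + 1) * (intervalCost + 8) + 1))) fun σ' =>
      IsLeast (range f) (σ'.rv r + 1) ∧ IsGreatest (range f) (σ'.rv (r + 1) - 1) := by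
  have hx0 : σ.ra x 0 = f ⟨0, hn⟩ := hf ⟨0, hn⟩
  refine Halts.seq (P := fun σ' => ∃ i, σ'.rv r = f i - 1)
    (Halts.of_flat (p := .setR r (.get x 0 - 1)) rfl fun _ => ⟨⟨0, hn⟩, by simp [Cmd.run, hx0]⟩)
    fun σ₁ hk₁ h₁ => ?_
  have hne : (r != r + 1) = true := by simp
  refine Halts.seq (P := fun σ' => ∃ i, σ'.rv (r + 1) = f i + 1)
    (Halts.of_flat (p := .setR (r + 1) (.get x 0 + 1)) rfl fun _ =>
      ⟨⟨0, hn⟩, by simp [Cmd.run, hk₁.ra rfl, hx0]⟩) fun σ₂ hk₂ h₂ => ?_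
  rw [← hk₂.rv r (by simp [Cmd.keepsR])] at h₁
  refine (Halts.forCmd (n := n) (P := fun i σ' => σ'.ra = σ.ra ∧
    (∃ j, σ'.rv r = f j - 1) ∧ (∃ j, σ'.rv (r + 1) = f j + 1) ∧
    ∀ j : Fin n, j.val < i → σ'.rv r ≤ f j - 1 ∧ f j + 1 ≤ σ'.rv (r + 1))
    (by decide) rfl rfl ?_ ?_ ?_ ?_).seq fun σ₃ _ h₃ => Halts.of_flat (p := .skip) rfl fun _ => ?_
  · rintro i σ σ' hk h
    rwa [hk.ra rfl, hk.rv r rfl, hk.rv (r + 1) rfl]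
  · rintro i hi σ₃ - h2 ⟨hra, ⟨j₁, hj₁⟩, ⟨j₂, hj₂⟩, hall⟩
    have hxi : σ₃.ra x i = f ⟨i, hi⟩ := by
      rw [hra]
      exact hf ⟨i, hi⟩
    refine Halts.of_flat (p := .seq _ _) rfl fun hk => ⟨(hk.ra rfl).trans hra, ?_⟩
    have e1 : (Cmd.run (.seq (.setR r (RExp.min (.var r) (.get x (.var 2) - 1)))
        (.setR (r + 1) (RExp.max (.var (r + 1)) (.get x (.var 2) + 1)))) σ₃).rv r =
        min (σ₃.rv r) (f ⟨i, hi⟩ - 1) := by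
      simp [Cmd.run, h2, hxi]
    have e2 : (Cmd.run (.seq (.setR r (RExp.min (.var r) (.get x (.var 2) - 1)))
        (.setR (r + 1) (RExp.max (.var (r + 1)) (.get x (.var 2) + 1)))) σ₃).rv (r + 1) =
        max (σ₃.rv (r + 1)) (f ⟨i, hi⟩ + 1) := by
      simp [Cmd.run, h2, hxi]
    rw [e1, e2]
    refine ⟨?_, ?_, fun j hj => ?_⟩
    · rcases min_choice (σ₃.rv r) (f ⟨i, hi⟩ - 1) with h | h
      · exact ⟨j₁, h.trans hj₁⟩
      · exact ⟨_, h⟩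
    · rcases max_choice (σ₃.rv (r + 1)) (f ⟨i, hi⟩ + 1) with h | h
      · exact ⟨j₂, h.trans hj₂⟩
      · exact ⟨_, h⟩
    · rcases Nat.lt_succ_iff_lt_or_eq.1 hj with hj | rfl
      · exact ⟨(min_le_left _ _).trans (hall j hj).1, (hall j hj).2.trans (le_max_left _ _)⟩
      · exact ⟨min_le_right _ _, le_max_right _ _⟩
  · rw [hk₂.nv 0 rfl, hk₁.nv 0 rfl, h0]
  · exact ⟨(hk₂.ra rfl).trans (hk₁.ra rfl), h₁, h₂, fun j hj => absurd hj (Nat.not_lt_zero _)⟩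
  · obtain ⟨-, ⟨j₁, hj₁⟩, ⟨j₂, hj₂⟩, hall⟩ := h₃
    refine ⟨⟨⟨j₁, by simp [Cmd.run, hj₁]⟩, ?_⟩, ⟨⟨j₂, by simp [Cmd.run, hj₂]⟩, ?_⟩⟩
    · rintro _ ⟨j, rfl⟩
      have := (hall j j.2).1
      simp only [Cmd.run]
      linarith
    · rintro _ ⟨j, rfl⟩
      have := (hall j j.2).2
      simp only [Cmd.run]
      linarith

/-- Compute the sides of the bounding rectangles. -/
def extentCmd : Cmd :=
  seqs [intervalCmd 0 3, intervalCmd 2 5, intervalCmd 1 7, intervalCmd 3 9]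

theorem extentCmd_spec {n c : ℕ} (hn : 1 ≤ n) {I : Inst n} {σ : State} (hI : InputOK c I σ) :
    Halts extentCmd σ (4 * (11 + (n + 1) * (intervalCost + 8)) + 1) I.ExtentAt := by
  have hex (σ : State) (hI : InputOK c I σ) : (∀ i : Fin n, σ.ra 0 i = I.S i 0) ∧
      (∀ i : Fin n, σ.ra 1 i = I.S i 1) ∧ (∀ i : Fin n, σ.ra 2 i = I.T i 0) ∧
      (∀ i : Fin n, σ.ra 3 i = I.T i 1) :=
    ⟨fun i => (hI.2.1 i).1, fun i => (hI.2.1 i).2.1,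
        fun i => (hI.2.1 i).2.2.1, fun i => (hI.2.1 i).2.2.2.1⟩
  let K := 5 + (5 + ((n + 1) * (intervalCost + 8) + 1))
  refine Halts.mono (B := K + (K + (K + (K + 1)))) (P := I.ExtentAt) ?_ (le_of_eq ?_)
    fun _ _ h => h
  · refine (intervalCmd_spec hn _ 3 hI.1 (hex σ hI).1).seq fun σ₁ hk₁ h₁ => ?_
    have hI₁ := hI.keeps hk₁ rfl
    refine (intervalCmd_spec hn _ 5 hI₁.1 (hex σ₁ hI₁).2.2.1).seq fun σ₂ hk₂ h₂ => ?_
    have hI₂ := hI₁.keeps hk₂ rfl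
    refine (intervalCmd_spec hn _ 7 hI₂.1 (hex σ₂ hI₂).2.1).seq fun σ₃ hk₃ h₃ => ?_
    have hI₃ := hI₂.keeps hk₃ rfl
    refine (intervalCmd_spec hn _ 9 hI₃.1 (hex σ₃ hI₃).2.2.2).seq fun σ₄ hk₄ h₄ =>
      Halts.of_flat (p := .skip) rfl fun _ => ?_
    have hS₀ := And.intro (lo_discs hn h₁.1) (hi_discs hn h₁.2)
    have hT₀ := And.intro (lo_discs hn h₂.1) (hi_discs hn h₂.2)
    have hS₁ := And.intro (lo_discs hn h₃.1) (hi_discs hn h₃.2)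
    have hT₁ := And.intro (lo_discs hn h₄.1) (hi_discs hn h₄.2)
    simp only [add_sub_cancel_right, sub_add_cancel] at hS₀ hT₀ hS₁ hT₁
    intro k
    fin_cases k
    · simp [Cmd.run, hS₀, hT₀, hk₄.rv 3 rfl, hk₃.rv 3 rfl, hk₂.rv 3 rfl, hk₄.rv 4 rfl,
        hk₃.rv 4 rfl, hk₂.rv 4 rfl, hk₄.rv 5 rfl, hk₃.rv 5 rfl, hk₄.rv 6 rfl, hk₃.rv 6 rfl]
    · simp [Cmd.run, hS₁, hT₁, hk₄.rv 7 rfl, hk₄.rv 8 rfl]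
  · simp only [K]
    ring

/-! ### Testing one pair -/

open Classical in
/-- `1` if the proposition holds and `0` otherwise. -/
noncomputable def indicatorNat (p : Prop) : ℕ := if p then 1 else 0

theorem indicatorNat_true {p : Prop} (hp : p) : indicatorNat p = 1 := if_pos hp

theorem indicatorNat_false {p : Prop} (hp : ¬ p) : indicatorNat p = 0 := if_neg hp

/-- A corner of the central region. -/
noncomputable def Inst.corner {n : ℕ} (I : Inst n) : Plane :=
  !₂[lo (discs I.S) 0 - lo (discs I.T) 0, lo (discs I.S) 1 - lo (discs I.T) 1]

/-- Each coordinate of the corner is one of the two breakpoints, so it lies between their minimum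
and maximum. -/
theorem Inst.corner_mem_R₀ {n : ℕ} (I : Inst n) : I.corner ∈ I.R₀ := by
  rw [I.mem_R₀]
  intro k
  fin_cases k <;> simp [Inst.corner, Inst.brkLo, Inst.brkHi]

def cornerExp (k : Fin 2) : RExp := .var (3 + 4 * k) - .var (5 + 4 * k)

theorem eval_cornerExp {n : ℕ} {I : Inst n} {σ : State} (h : I.ExtentAt σ) (k : Fin 2) :
    (cornerExp k).eval σ = I.corner k := by
  have := h k
  simp only [cornerExp, RExp.eval_sub, RExp.eval_var, this]
  fin_cases k <;> simp [Inst.corner]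

/-- Set the integer register `8` to `1` if the corner lies in the vippodrome. -/
def vippodromeCmd (τ : Bool) : Cmd :=
  .seq (loadCmd τ) (.seq (.setR 18 ((.var 11 * (cornerExp 1 + .var 14) -
    .var 12 * (cornerExp 0 + .var 13)) / .var 15)) (.seq profileCmd
    (.cond (.ltR (.var 19) ((.var 11 * (cornerExp 0 + .var 13) +
      .var 12 * (cornerExp 1 + .var 14)) / .var 15)) (.setN 8 1) .skip)))

/-- Register `8` is only ever raised to 1, so successive calls accumulate a disjunction; `p` stands
for the outcome so far. -/
theorem vippodromeCmd_spec {n c : ℕ} {I : Inst n} {a b : Fin n} (hab : a ≠ b) (τ : Bool)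
    {σ : State} (hI : InputOK c I σ) (hE : I.ExtentAt σ) (ha : σ.nv 2 = a) (hb : σ.nv 3 = b)
    {p : Prop} (hp : σ.nv 8 = indicatorNat p) :
    Halts (vippodromeCmd τ) σ (vippodromeCmd τ).bound fun σ' =>
      σ'.nv 8 = indicatorNat (p ∨ I.corner ∈ I.vippodrome a b τ) := by
  have hload : (loadCmd τ).flat = true ∧ (loadCmd τ).keepsExtent = true ∧
      (loadCmd τ).keepsN 8 = true := by
    cases τ <;> decide
  obtain ⟨hl1, hl2, hl3⟩ := hload
  refine (Halts.of_flat (P := I.VippodromeAt a b τ) hl1 fun _ => loadCmd_spec hI ha hb τ).seq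
    fun σ₁ hk₁ h₁ => ?_
  have hE₁ := hE.keeps hk₁ hl2
  refine Halts.seq (P := fun σ' => σ'.rv 18 = I.sc a b τ I.corner)
    (Halts.of_flat (p := .setR 18 _) rfl fun _ => ?_) fun σ₂ hk₂ h₂ => ?_
  · simp [Cmd.run, eval_cornerExp hE₁, h₁.d₀, h₁.d₁, h₁.o₀, h₁.o₁, h₁.l, Inst.sc]
  have hE₂ := hE₁.keeps hk₂ rfl
  have hV₂ := h₁.keeps hk₂ rfl
  refine Halts.seq (P := fun σ' => σ'.rv 19 = profile (I.len a b τ) (I.sc a b τ I.corner))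
    (Halts.of_flat (p := profileCmd) rfl fun _ => by rw [profileCmd_spec hV₂, h₂])
    fun σ₃ hk₃ h₃ => ?_
  have hE₃ := hE₂.keeps hk₃ rfl
  have hV₃ := hV₂.keeps hk₃ rfl
  refine Halts.of_flat rfl fun _ => ?_
  have hiff : (BExp.ltR (.var 19) ((.var 11 * (cornerExp 0 + .var 13) +
      .var 12 * (cornerExp 1 + .var 14)) / .var 15)).holds σ₃ ↔
      I.corner ∈ I.vippodrome a b τ := by
    rw [I.mem_vippodrome_iff hab]
    simp [eval_cornerExp hE₃, hV₃.d₀, hV₃.d₁, hV₃.o₀, hV₃.o₁, hV₃.l, Inst.hc, h₃]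
  rw [Cmd.run, hiff]
  split_ifs with h
  · rw [indicatorNat_true (.inr h)]
    simp [Cmd.run]
  · simp only [h, or_false]
    rw [Cmd.run, hk₃.nv 8 rfl, hk₂.nv 8 rfl, hk₁.nv 8 hl3, hp]

/-- The disc of the pair `a` has to move before that of the pair `b`. -/
def Inst.Precedes {n : ℕ} (I : Inst n) (a b : Fin n) : Prop := a ≠ b ∧ I.Blocks I.corner a b

/-- Set the integer register `8` to `1` or `0`, depending on whether the first one of the pairs in
the integer registers `2` and `3` has to move before the second one, for the corner. -/
def testCmd : Cmd :=
  .seq (.setN 8 0) (.cond (.conj (.leN (.var 2) (.var 3)) (.leN (.var 3) (.var 2))) .skip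
    (.seq (vippodromeCmd true) (vippodromeCmd false)))

theorem testCmd_spec {n c : ℕ} {I : Inst n} {a b : Fin n}
    {σ : State} (hI : InputOK c I σ) (hE : I.ExtentAt σ) (ha : σ.nv 2 = a) (hb : σ.nv 3 = b) :
    Halts testCmd σ testCmd.bound fun σ' => σ'.nv 8 = indicatorNat (I.Precedes a b) := by
  refine Halts.mono
    (B := 2 + (7 + (((vippodromeCmd true).bound + (vippodromeCmd false).bound) + 1))) (P := fun σ' => σ'.nv 8 = indicatorNat (I.Precedes a b)) ?_ (le_of_eq rfl) fun _ _ h => h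
  refine Halts.seq (P := fun σ' => σ'.nv 8 = 0) (Halts.of_flat (p := .setN 8 0) rfl
    fun _ => by simp [Cmd.run]) fun σ₁ hk₁ h₁ => ?_
  rw [← hk₁.nv 2 rfl] at ha
  rw [← hk₁.nv 3 rfl] at hb
  refine Halts.cond (fun h => ?_) fun h => ?_
  · simp only [BExp.holds_conj, BExp.holds_leN, NExp.eval_var, ha, hb] at h
    refine (Halts.of_flat (p := .skip) rfl fun _ => ?_).mono (by simp only [Cmd.bound]; omega)
      fun _ _ h => h
    rw [Cmd.run, h₁, indicatorNat_false fun h' => h'.1 (Fin.ext (le_antisymm h.1 h.2))]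
  · have hab : a ≠ b := by
      rintro rfl
      exact h (by simp only [BExp.holds_conj, BExp.holds_leN, NExp.eval_var, ha, hb, le_refl,
        and_self])
    refine Halts.mono (B := (vippodromeCmd true).bound + (vippodromeCmd false).bound)
      ((vippodromeCmd_spec hab true (hI.keeps hk₁ rfl) (hE.keeps hk₁ rfl) ha hb (p := False)
        (by rw [h₁, indicatorNat_false id])).seq fun σ₂ hk₂ h₂ =>
        vippodromeCmd_spec hab false ((hI.keeps hk₁ rfl).keeps hk₂ rfl)
          ((hE.keeps hk₁ rfl).keeps hk₂ rfl) (by rw [hk₂.nv 2 rfl, ha]) (by rw [hk₂.nv 3 rfl, hb])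
          h₂) (Nat.le_succ _) fun σ₃ _ h₃ => ?_
    rw [h₃]
    congr 1
    simp only [false_or, Inst.Precedes, Inst.Blocks, Bool.exists_bool, eq_iff_iff]
    tauto

/-! ### Topological sorting

Integer arrays: `6` number of the pairs that are still to be placed before a pair, `7` whether a pair
has been placed. -/

open Classical in
/-- The number of the elements with the property. -/
noncomputable def count {n : ℕ} (p : Fin n → Prop) : ℕ := (Finset.univ.filter p).card

theorem count_eq_zero {n : ℕ} {p : Fin n → Prop} : count p = 0 ↔ ∀ a, ¬ p a := by
  simp [count, Finset.filter_eq_empty_iff]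

/-- Used in both directions: for counting predecessors one by one, and for removing a pair that has
just been placed. -/
theorem count_insert {n : ℕ} {p q : Fin n → Prop} {a : Fin n} {r : Prop} (hp : ¬ p a)
    (hq : ∀ x, q x ↔ p x ∨ x = a ∧ r) : count q = count p + indicatorNat r := by
  classical
  unfold count
  by_cases hr : r
  · rw [indicatorNat_true hr, ← Finset.card_insert_of_notMem (a := a) (by simpa using hp)]
    congr 1
    ext x
    simp [hq, hr, or_comm]
  · rw [indicatorNat_false hr, Nat.add_zero]
    congr 1
    ext x
    simp [hq, hr]

/-- The list holds, in reverse order, the pairs that have been placed. -/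
structure Inst.IsSorted {n : ℕ} (I : Inst n) (l : List (Fin n)) : Prop where
  nodup : l.Nodup
  pairwise : l.Pairwise fun x y => ¬ I.Precedes x y
  closed : ∀ x ∈ l, ∀ y ∉ l, ¬ I.Precedes y x

/-- The new pair precedes none of those placed earlier because the placed set is closed under
predecessors. It keeps the set closed because it has no unplaced predecessor. -/
theorem Inst.IsSorted.cons {n : ℕ} {I : Inst n} {l : List (Fin n)} (h : I.IsSorted l) {a : Fin n}
    (ha : a ∉ l) (hmin : ∀ y ∉ l, ¬ I.Precedes y a) : I.IsSorted (a :: l) := by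
  refine ⟨h.nodup.cons ha, h.pairwise.cons fun x hx => h.closed x hx a ha, fun x hx y hy => ?_⟩
  simp only [List.mem_cons, not_or] at hx hy
  rcases hx with rfl | hx
  · exact hmin y hy.2
  · exact h.closed x hx y hy.2

theorem Inst.IsSorted.corner_mem_Q {n : ℕ} {I : Inst n} {l : List (Fin n)} (h : I.IsSorted l)
    (hl : l.length = n) : I.corner ∈ I.Q := by
  rw [I.mem_Q_iff]
  -- The head of the list is the pair placed last, hence the reversal of the index.
  have hinj : Function.Injective fun k : Fin n => l.get (Fin.cast hl.symm k.rev) := by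
    intro k k' hkk
    have := h.nodup.injective_get hkk
    exact Fin.rev_injective (Fin.cast_injective _ this)
  refine ⟨Equiv.ofBijective _ (Finite.injective_iff_bijective.1 hinj), fun k k' hkk hB => ?_⟩
  have := List.pairwise_iff_get.1 h.pairwise (Fin.cast hl.symm k'.rev) (Fin.cast hl.symm k.rev)
    (by simpa using hkk)
  exact this ⟨fun heq => hkk.ne' (hinj heq), hB⟩

/-- In any order, consider the first pair outside `l`. It has a predecessor that is also outside `l`
and would have to come even earlier. -/
theorem Inst.corner_notMem_Q {n : ℕ} {I : Inst n} {l : List (Fin n)} (hl : l.length < n)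
    (h : ∀ y ∉ l, ∃ x ∉ l, I.Precedes x y) : I.corner ∉ I.Q := by
  rw [I.mem_Q_iff]
  rintro ⟨π, hπ⟩
  have hex : ∃ k, π k ∉ l := by
    by_contra! hall
    have hsub : (Finset.univ : Finset (Fin n)) ⊆ l.toFinset := fun x _ => by
      simpa using hall (π.symm x)
    have h1 := Finset.card_le_card hsub
    have h2 := l.toFinset_card_le
    rw [Finset.card_univ, Fintype.card_fin] at h1
    omega
  classical
  obtain ⟨k, hk⟩ := hex
  obtain ⟨m, hm, hmin⟩ :=
    (Finset.univ.filter fun k => π k ∉ l).exists_minimal ⟨k, by simpa using hk⟩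
  simp only [Finset.mem_filter, Finset.mem_univ, true_and] at hm hmin
  obtain ⟨x, hx, hne, hB⟩ := h _ hm
  obtain ⟨k', rfl⟩ := π.surjective x
  rcases lt_trichotomy m k' with hlt | rfl | hlt
  · exact hπ m k' hlt hB
  · exact hne rfl
  · exact absurd (hmin hx hlt.le) (not_le.2 hlt)

/-- The input and the sides of the bounding rectangles are available. -/
def Inst.Ready {n : ℕ} (I : Inst n) (c : ℕ) (σ : State) : Prop := InputOK c I σ ∧ I.ExtentAt σ

theorem Inst.Ready.keeps {n c : ℕ} {I : Inst n} {σ σ' : State} {p : Cmd} (h : I.Ready c σ)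
    (hk : Keeps p σ σ') (hp : (p.keepsInput && p.keepsExtent) = true) : I.Ready c σ' := by
  simp only [Bool.and_eq_true] at hp
  exact ⟨h.1.keeps hk hp.1, h.2.keeps hk hp.2⟩

/-- The arrays describe the list of the pairs that have been placed. -/
def Inst.PlacedAt {n : ℕ} (I : Inst n) (l : List (Fin n)) (σ : State) : Prop :=
  ∀ b : Fin n, σ.na 7 b = indicatorNat (b ∈ l) ∧ σ.na 6 b = count fun a => a ∉ l ∧ I.Precedes a b

/-- Initialize the arrays. -/
def initCmd : Cmd :=
  forCmd 3 (.seq (.storeN 7 (.var 3) 0) (.seq (.storeN 6 (.var 3) 0)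
    (forCmd 2 (.seq testCmd (.storeN 6 (.var 3) (.get 6 (.var 3) + .var 8))))))

theorem initCmd_spec {n c : ℕ} {I : Inst n} {σ : State} (hI : I.Ready c σ) :
    Halts initCmd σ ((n + 1) * ((3 + (3 + (n + 1) * ((testCmd.bound + 6) + 8))) + 8)) fun σ' =>
      I.Ready c σ' ∧ I.PlacedAt [] σ' := by
  refine (Halts.forCmd (x := 3) (n := n) (P := fun j σ => I.Ready c σ ∧ ∀ b : Fin n, b.val < j →
    σ.na 7 b = 0 ∧ σ.na 6 b = count (I.Precedes · b)) (by decide) rfl rfl ?_ ?_ hI.1.1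
    ⟨hI, fun b hb => absurd hb (Nat.not_lt_zero _)⟩).mono le_rfl fun σ' _ h => ⟨h.1, fun b => ?_⟩
  · rintro j σ σ' hk ⟨h1, h2⟩
    exact ⟨h1.keeps hk rfl, by rwa [hk.na 7 rfl, hk.na 6 rfl]⟩
  · rintro j hj σ - h3 ⟨hI, h⟩
    refine Halts.seq (P := fun σ' => σ'.na 7 j = 0 ∧ ∀ b : Fin n, b.val < j → σ'.na 7 b = 0)
      (Halts.of_flat (p := .storeN 7 (.var 3) 0) rfl fun _ => ⟨by simp [Cmd.run, h3],
        fun b hb => by simp [Cmd.run, h3, Function.update, (h b hb).1]⟩) fun σ₁ hk₁ h₁ => ?_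
    refine Halts.seq (P := fun σ' => σ'.na 6 j = 0 ∧ ∀ b : Fin n, b.val < j → σ'.na 6 b =
      count (I.Precedes · b)) (Halts.of_flat (p := .storeN 6 (.var 3) 0) rfl fun _ => ?_)
      fun σ₂ hk₂ h₂ => ?_
    · rw [← hk₁.nv 3 rfl] at h3
      refine ⟨by simp [Cmd.run, h3], fun b hb => ?_⟩
      simp [Cmd.run, h3, Function.update, hb.ne, hk₁.na 6 rfl, (h b hb).2]
    have hI₂ := (hI.keeps hk₁ rfl).keeps hk₂ rfl
    refine (Halts.forCmd (x := 2) (n := n) (P := fun i σ => I.Ready c σ ∧ σ.nv 3 = j ∧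
      (∀ b : Fin n, b.val < j + 1 → σ.na 7 b = 0) ∧ (∀ b : Fin n, b.val < j → σ.na 6 b =
      count (I.Precedes · b)) ∧ σ.na 6 j = count fun a => a.val < i ∧ I.Precedes a ⟨j, hj⟩)
      (by decide) rfl rfl ?_ ?_ hI₂.1.1 ⟨hI₂, ?_, ?_, h₂.2, ?_⟩).mono le_rfl fun σ' _ h => ?_
    · rintro i σ σ' hk ⟨h1, h2, h3, h4, h5⟩
      refine ⟨h1.keeps hk rfl, ?_⟩
      rw [hk.na 7 rfl, hk.na 6 rfl, hk.nv 3 rfl]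
      exact ⟨h2, h3, h4, h5⟩
    · rintro i hi σ - h2 ⟨hI, h3, h7, h6, hc⟩
      refine (testCmd_spec (a := ⟨i, hi⟩) (b := ⟨j, hj⟩) hI.1 hI.2 h2 h3).seq fun σ₁ hk₁ h₁ =>
        Halts.of_flat (p := .storeN 6 (.var 3) (.get 6 (.var 3) + .var 8)) rfl fun hk => ?_
      refine ⟨(hI.keeps hk₁ rfl).keeps hk rfl, ?_, fun b hb => ?_, fun b hb => ?_, ?_⟩
      · rw [hk.nv 3 rfl, hk₁.nv 3 rfl, h3]
      · rw [hk.na 7 rfl, hk₁.na 7 rfl, h7 b hb]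
      · simp [Cmd.run, hk₁.nv 3 rfl, h3, Function.update, hb.ne, hk₁.na 6 rfl, h6 b hb]
      · simp only [Cmd.run, NExp.eval_var, NExp.eval_add, NExp.eval_get, hk₁.nv 3 rfl, h3,
          hk₁.na 6 rfl, hc, h₁, Function.update_self]
        refine (count_insert (a := ⟨i, hi⟩) (by simp) fun x => ?_).symm
        rw [Nat.lt_succ_iff_lt_or_eq, Fin.ext_iff, or_and_right]
        refine or_congr_right (and_congr_right fun hx => ?_)
        rw [show x = ⟨i, hi⟩ from Fin.ext hx]
    · rw [hk₂.nv 3 rfl, hk₁.nv 3 rfl, h3]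
    · intro b hb
      rw [hk₂.na 7 rfl]
      rcases Nat.lt_succ_iff_lt_or_eq.1 hb with hb | hb
      · exact h₁.2 b hb
      · rw [hb]; exact h₁.1
    · rw [h₂.1, eq_comm, count_eq_zero]
      simp
    · refine ⟨h.1, fun b hb => ⟨h.2.2.1 b hb, ?_⟩⟩
      rcases Nat.lt_succ_iff_lt_or_eq.1 hb with hb | hb
      · exact h.2.2.2.1 b hb
      · rw [hb, h.2.2.2.2]
        congr 1
        ext a
        simp [← hb]
  · rw [(h.2 b b.2).1, (h.2 b b.2).2]
    refine ⟨(indicatorNat_false (by simp)).symm, ?_⟩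
    simp

/-- Find a pair that can be placed next. -/
def findCmd : Cmd :=
  .seq (.setN 9 (.var 0)) (forCmd 2
    (.cond (.conj (.leN (.get 7 (.var 2)) 0) (.leN (.get 6 (.var 2)) 0)) (.setN 9 (.var 2)) .skip))

/-- The value `n`, which is not the index of a pair, signals in register `9` that no pair can be
placed. -/
theorem findCmd_spec {n c : ℕ} {I : Inst n} {σ : State} (hI : I.Ready c σ) :
    Halts findCmd σ (2 + (n + 1) * ((9 + 3) + 8)) fun σ' => I.Ready c σ' ∧ σ'.na = σ.na ∧
      ((∃ b : Fin n, σ'.nv 9 = b ∧ σ.na 7 b = 0 ∧ σ.na 6 b = 0) ∨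
        σ'.nv 9 = n ∧ ∀ b : Fin n, ¬ (σ.na 7 b = 0 ∧ σ.na 6 b = 0)) := by
  refine Halts.seq (P := fun σ' => σ'.nv 9 = n)
    (Halts.of_flat (p := .setN 9 (.var 0)) rfl fun _ => by simp [Cmd.run, hI.1.1])
    fun σ₁ hk₁ h₁ => ?_
  have hna : σ₁.na = σ.na := funext fun x => hk₁.na x rfl
  have hI₁ := hI.keeps hk₁ rfl
  refine (Halts.forCmd (x := 2) (n := n) (P := fun i σ' => I.Ready c σ' ∧ σ'.na = σ.na ∧
    ((∃ b : Fin n, σ'.nv 9 = b ∧ σ.na 7 b = 0 ∧ σ.na 6 b = 0) ∨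
      σ'.nv 9 = n ∧ ∀ b : Fin n, b.val < i → ¬ (σ.na 7 b = 0 ∧ σ.na 6 b = 0)))
    (by decide) rfl rfl ?_ ?_ hI₁.1.1 ⟨hI₁, hna, .inr ⟨h₁, fun b hb =>
      absurd hb (Nat.not_lt_zero _)⟩⟩).mono le_rfl fun σ' _ h => ⟨h.1, h.2.1, ?_⟩
  · rintro i σ₂ σ₃ hk ⟨h1, h2, h3⟩
    exact ⟨h1.keeps hk rfl, (funext fun x => hk.na x rfl).trans h2, by rwa [hk.nv 9 rfl]⟩
  · rintro i hi σ₂ - h2 ⟨hI, hna, h⟩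
    refine Halts.cond (fun hb => ?_) fun hb => ?_
    · simp only [BExp.holds_conj, BExp.holds_leN, NExp.eval_get, NExp.eval_var, NExp.eval_ofNat,
        h2, hna, Nat.le_zero] at hb
      refine (Halts.of_flat (p := .setN 9 (.var 2)) rfl fun hk => ⟨hI.keeps hk rfl,
        (funext fun x => hk.na x rfl).trans hna, .inl ⟨⟨i, hi⟩, ?_, hb⟩⟩).mono
        (by decide) fun _ _ h => h
      simp [Cmd.run, h2]
    · simp only [BExp.holds_conj, BExp.holds_leN, NExp.eval_get, NExp.eval_var, NExp.eval_ofNat,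
        h2, hna, Nat.le_zero] at hb
      refine (Halts.of_flat (p := .skip) rfl fun _ => ⟨hI, hna, ?_⟩).mono
        (by decide) fun _ _ h => h
      refine h.imp_right fun h => ⟨h.1, fun b hb' => ?_⟩
      rcases Nat.lt_succ_iff_lt_or_eq.1 hb' with hb' | hb'
      · exact h.2 b hb'
      · rwa [hb']
  · exact h.2.2.imp_right fun h' => ⟨h'.1, fun b => h'.2 b b.2⟩

/-- Place the pair in the integer register `9`. -/
def placeCmd : Cmd :=
  .seq (.storeN 7 (.var 9) 1) (.seq (.setN 2 (.var 9))
    (forCmd 3 (.seq testCmd (.storeN 6 (.var 3) (.sub (.get 6 (.var 3)) (.var 8))))))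

/-- The precedence relation is not stored: one test per remaining index decides whether its counter
drops, so that placing a pair takes linear time. -/
theorem placeCmd_spec {n c : ℕ} {I : Inst n} {σ : State} (hI : I.Ready c σ) {l : List (Fin n)}
    (hl : I.PlacedAt l σ) {a : Fin n} (ha : a ∉ l) (h9 : σ.nv 9 = a) :
    Halts placeCmd σ (3 + (2 + (n + 1) * ((testCmd.bound + 6) + 8))) fun σ' =>
      I.Ready c σ' ∧ I.PlacedAt (a :: l) σ' := by
  have hcount (b : Fin n) : count (fun x => x ∉ l ∧ I.Precedes x b) =
      count (fun x => x ∉ a :: l ∧ I.Precedes x b) + indicatorNat (I.Precedes a b) := by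
    refine count_insert (a := a) (by simp) fun x => ?_
    by_cases hx : x = a
    · subst hx
      simp [ha]
    · simp [hx]
  refine Halts.seq (P := fun σ' => ∀ b : Fin n, σ'.na 7 b = indicatorNat (b ∈ a :: l))
    (Halts.of_flat (p := .storeN 7 (.var 9) 1) rfl fun _ b => ?_) fun σ₁ hk₁ h₁ => ?_
  · by_cases hb : b = a
    · subst hb
      rw [indicatorNat_true (by simp)]
      simp [Cmd.run, h9]
    · have hb' : b.val ≠ a.val := fun h => hb (Fin.ext h)
      simp [Cmd.run, h9, Function.update, hb', (hl b).1, hb]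
  refine Halts.seq (P := fun σ' => σ'.nv 2 = a) (Halts.of_flat (p := .setN 2 (.var 9)) rfl
    fun _ => by simp [Cmd.run, hk₁.nv 9 rfl, h9]) fun σ₂ hk₂ h₂ => ?_
  have hI₂ := (hI.keeps hk₁ rfl).keeps hk₂ rfl
  refine (Halts.forCmd (x := 3) (n := n) (P := fun j σ' => I.Ready c σ' ∧ σ'.nv 2 = a ∧
    σ'.na 7 = σ₂.na 7 ∧ (∀ b : Fin n, b.val < j → σ'.na 6 b =
      count fun x => x ∉ a :: l ∧ I.Precedes x b) ∧
      ∀ b : Fin n, j ≤ b.val → σ'.na 6 b = count fun x => x ∉ l ∧ I.Precedes x b)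
    (by decide) rfl rfl ?_ ?_ hI₂.1.1 ⟨hI₂, h₂, rfl, fun b hb => absurd hb (Nat.not_lt_zero _),
      fun b _ => ?_⟩).mono le_rfl fun σ' _ h => ⟨h.1, fun b => ⟨?_, h.2.2.2.1 b b.2⟩⟩
  · rintro j σ σ' hk ⟨h1, h2, h3, h4⟩
    refine ⟨h1.keeps hk rfl, ?_⟩
    rw [hk.na 7 rfl, hk.na 6 rfl, hk.nv 2 rfl]
    exact ⟨h2, h3, h4⟩
  · rintro j hj σ - h3 ⟨hI, h2, h7, hlt, hge⟩
    refine (testCmd_spec (a := a) (b := ⟨j, hj⟩) hI.1 hI.2 h2 h3).seq fun σ₁ hk₁ h₁ =>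
      Halts.of_flat (p := .storeN 6 (.var 3) (.sub (.get 6 (.var 3)) (.var 8))) rfl fun hk => ?_
    refine ⟨(hI.keeps hk₁ rfl).keeps hk rfl, ?_, ?_, fun b hb => ?_, fun b hb => ?_⟩
    · rw [hk.nv 2 rfl, hk₁.nv 2 rfl, h2]
    · rw [hk.na 7 rfl, hk₁.na 7 rfl, h7]
    · simp only [Cmd.run, NExp.eval_var, NExp.eval_sub, NExp.eval_get, hk₁.nv 3 rfl, h3,
          hk₁.na 6 rfl, h₁, Function.update_self]
      rcases Nat.lt_succ_iff_lt_or_eq.1 hb with hb | hb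
      · rw [Function.update_of_ne hb.ne, hlt b hb]
      · obtain rfl : b = ⟨j, hj⟩ := Fin.ext hb
        rw [Function.update_self, hge ⟨j, hj⟩ le_rfl, hcount, Nat.add_sub_cancel]
    · have hne : b.val ≠ σ₁.nv 3 := by
        rw [hk₁.nv 3 rfl, h3]
        omega
      simp [Cmd.run, hne, hk₁.na 6 rfl, hge b (by omega)]
  · rw [hk₂.na 6 rfl, hk₁.na 6 rfl, (hl b).2]
  · rw [h.2.2.1, hk₂.na 7 rfl, h₁]

/-- Sort the pairs; the integer register `7` tells whether this has been possible. -/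
def sortCmd : Cmd :=
  .seq initCmd (.seq (.setN 7 1) (forCmd 10
    (.seq findCmd (.cond (.leN (.var 0) (.var 9)) (.setN 7 0) placeCmd))))

/-- The cost of the elementary steps of `sortCmd`. -/
def sortCost : ℕ := testCmd.bound + 60

/-- Each of the `n` rounds places a pair without unplaced predecessors. If there is none, all
unplaced pairs have unplaced predecessors and the corner is invalid. This verdict is permanent, so
later rounds only have to preserve it. As each test takes constant time, the total is quadratic. -/
theorem sortCmd_spec {n c : ℕ} {I : Inst n} {σ : State} (hI : I.Ready c σ) :
    Halts sortCmd σ (2 * sortCost * ((n + 1) * (n + 1))) fun σ' =>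
      I.Ready c σ' ∧ (σ'.nv 7 = 1 ∧ I.corner ∈ I.Q ∨ σ'.nv 7 = 0 ∧ I.corner ∉ I.Q) := by
  refine Halts.mono (B := ((n + 1) * ((3 + (3 + (n + 1) * ((testCmd.bound + 6) + 8))) + 8)) +
    (2 + (n + 1) * (((2 + (n + 1) * ((9 + 3) + 8)) +
      (3 + (3 + (2 + (n + 1) * ((testCmd.bound + 6) + 8))))) + 8))) (P := fun σ' =>
      I.Ready c σ' ∧ (σ'.nv 7 = 1 ∧ I.corner ∈ I.Q ∨ σ'.nv 7 = 0 ∧ I.corner ∉ I.Q)) ?_ ?_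
      fun _ _ h => h
  · refine (initCmd_spec hI).seq fun σ₁ hk₁ h₁ => ?_
    refine Halts.seq (P := fun σ' => σ'.nv 7 = 1) (Halts.of_flat (p := .setN 7 1) rfl
      fun _ => by simp [Cmd.run]) fun σ₂ hk₂ h₂ => ?_
    have hI₂ := h₁.1.keeps hk₂ rfl
    refine (Halts.forCmd (x := 10) (n := n) (P := fun i σ' => I.Ready c σ' ∧ ∃ l, I.PlacedAt l σ' ∧
      I.IsSorted l ∧ (σ'.nv 7 = 1 ∧ l.length = i ∨ σ'.nv 7 = 0 ∧ I.corner ∉ I.Q))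
      (by decide) rfl rfl ?_ ?_ hI₂.1.1 ⟨hI₂, [], ?_, ⟨by simp, by simp, by simp⟩,
        .inl ⟨h₂, rfl⟩⟩).mono le_rfl fun σ' _ ⟨hI, l, _, hs, h⟩ => ⟨hI, ?_⟩
    · rintro i σ σ' hk ⟨h1, l, h2, h3, h4⟩
      refine ⟨h1.keeps hk rfl, l, ?_, h3, by rwa [hk.nv 7 rfl]⟩
      unfold Inst.PlacedAt
      rwa [hk.na 7 rfl, hk.na 6 rfl]
    · rintro i hi σ - - ⟨hI, l, hl, hs, h⟩
      refine (findCmd_spec hI).seq fun σ₃ hk₃ h₃ => ?_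
      obtain ⟨hI₃, hna, h₃⟩ := h₃
      have hl₃ : I.PlacedAt l σ₃ := by
        unfold Inst.PlacedAt
        rwa [hna]
      refine Halts.cond (fun hb => ?_) fun hb => ?_
      · simp only [BExp.holds_leN, NExp.eval_var, hI₃.1.1] at hb
        refine (Halts.of_flat (p := .setN 7 0) rfl fun hk => ?_).mono
          (show 2 ≤ _ by omega) fun _ _ h => h
        refine ⟨hI₃.keeps hk rfl, l, ?_, hs, .inr ⟨by simp [Cmd.run], ?_⟩⟩
        · unfold Inst.PlacedAt
          rwa [hk.na 7 rfl, hk.na 6 rfl]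
        · rcases h with h | h
          · refine I.corner_notMem_Q (l := l) (by omega) fun y hy => ?_
            rcases h₃ with ⟨b, hb', -⟩ | ⟨-, h₃⟩
            · exact absurd b.2 (by omega)
            · by_contra! hcon
              refine h₃ y ⟨?_, ?_⟩
              · rw [(hl y).1, indicatorNat_false hy]
              · rw [(hl y).2, count_eq_zero]
                exact fun a ha => hcon a ha.1 ha.2
          · exact h.2
      · simp only [BExp.holds_leN, NExp.eval_var, hI₃.1.1] at hb
        rcases h₃ with ⟨b, hb', h7, h6⟩ | ⟨h9, -⟩
        · have hbl : b ∉ l := fun hmem => by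
            rw [(hl b).1, indicatorNat_true hmem] at h7
            exact one_ne_zero h7
          rw [(hl b).2, count_eq_zero] at h6
          refine (placeCmd_spec hI₃ hl₃ hbl hb').mono le_rfl fun σ₄ hk₄ h₄ => ?_
          refine ⟨h₄.1, b :: l, h₄.2, hs.cons hbl fun y hy hp => h6 y ⟨hy, hp⟩, ?_⟩
          rw [hk₄.nv 7 rfl, hk₃.nv 7 rfl, List.length_cons]
          exact h.imp_left fun h => ⟨h.1, by rw [h.2]⟩
        · omega
    · unfold Inst.PlacedAt
      rw [hk₂.na 7 rfl, hk₂.na 6 rfl]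
      exact h₁.2
    · exact h.imp_left fun h => ⟨h.1, hs.corner_mem_Q h.2⟩
  · unfold sortCost
    generalize testCmd.bound = x
    nlinarith [Nat.zero_le (n * x), Nat.zero_le (n * n * x), Nat.zero_le (n * n)]

/-! ### The program -/

/-- Find an optimal valid translation. -/
def optimizeCmd : Cmd :=
  .seq extentCmd (.seq sortCmd (.seq (.setN 1 0)
    (.cond (.leN 1 (.var 7)) (candidateCmd (cornerExp 0) (cornerExp 1)) sweepCmd)))

/-- The cost of the elementary steps of `optimizeCmd`. -/
def optimizeCost : ℕ :=
  4 * intervalCost + 2 * sortCost + (candidateCmd (cornerExp 0) (cornerExp 1)).bound +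
    2 * curveCost + 200

/-- A valid corner is a global minimum of the area on the whole plane. With an invalid corner, every
valid translation is matched by one on a boundary curve, and all valid boundary points have been
taken into account; finding none proves that `Q` is empty. -/
theorem optimizeCmd_spec {n c : ℕ} (hn : 1 ≤ n) {I : Inst n} {σ : State} (hI : InputOK c I σ) :
    Halts optimizeCmd σ (optimizeCost * ((n + 1) * (n + 1)) *
      (c * Nat.log 2 (4 + 144 * (n * n)) + 1)) (OutputOK I) := by
  set L := c * Nat.log 2 (4 + 144 * (n * n)) with hL
  let A := (candidateCmd (cornerExp 0) (cornerExp 1)).bound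
  let B := 2 + (n + 1) * ((n + 1) * ((2 * curveCost + 7) * (L + 1) + 4 + 8) + 8)
  refine Halts.mono (B := (4 * (11 + (n + 1) * (intervalCost + 8)) + 1) +
    (2 * sortCost * ((n + 1) * (n + 1)) + (2 + (3 + (A + B))))) (P := OutputOK I) ?_ ?_
      fun _ _ h => h
  · refine (extentCmd_spec hn hI).seq fun σ₁ hk₁ hE₁ => ?_
    refine (sortCmd_spec ⟨hI.keeps hk₁ rfl, hE₁⟩).seq fun σ₂ hk₂ ⟨⟨hI₂, hE₂⟩, h₂⟩ => ?_
    refine Halts.seq (P := I.BestAt) (Halts.of_flat (p := .setN 1 0) rfl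
      fun _ => .inl (by simp [Cmd.run])) fun σ₃ hk₃ hB₃ => ?_
    rw [← hk₃.nv 7 rfl] at h₂
    have hI₃ := hI₂.keeps hk₃ rfl
    have hE₃ := hE₂.keeps hk₃ rfl
    refine Halts.cond (fun h => ?_) fun h => ?_ <;>
      simp only [BExp.holds_leN, NExp.eval_ofNat, NExp.eval_var] at h
    · have hQ : I.corner ∈ I.Q := h₂.elim And.right fun h₂ => by omega
      refine (candidateCmd_spec hn hE₃ hB₃ hQ (eval_cornerExp hE₃ 0) fun z => ?_).mono
        (Nat.le_add_right _ _) fun σ₄ _ h₄ => ?_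
      · rw [← eval_cornerExp hE₃ 1]
        simp [cornerExp, Function.update]
      · obtain ⟨hB₄, -, hf⟩ := h₄
        rcases hB₄ with h0 | ⟨h1, v, hv, hx, hy, hA⟩
        · exact absurd (h0.symm.trans hf.1) zero_ne_one
        · refine .inl ⟨h1, v, hv, hx, hy, fun w _ => ?_⟩
          rw [← hA]
          exact hf.2.trans (I.area_le_of_mem_R₀ hn I.corner_mem_R₀ w)
    · have hQ : I.corner ∉ I.Q := h₂.elim (fun h₂ => by omega) And.right
      refine (sweepCmd_spec hn hI₃ hE₃ hB₃).mono (Nat.le_add_left _ _) fun σ₄ _ ⟨hB₄, hS⟩ => ?_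
      have hfound (w : Plane) (hw : w ∈ I.Q) : Found (I.area w) σ₄ := by
        obtain ⟨a, b, hab, τ, v, hv, hvQ, hle⟩ :=
          I.exists_mem_bdry_area_le hn I.corner_mem_R₀ hQ hw
        exact (hS a b hab (.inl a.2) τ v hv hvQ).mono hle
      rcases hB₄ with h0 | ⟨h1, v, hv, hx, hy, hA⟩
      · refine .inr ⟨h0, eq_empty_iff_forall_notMem.2 fun w hw => ?_⟩
        exact zero_ne_one (h0.symm.trans (hfound w hw).1)
      · exact .inl ⟨h1, v, hv, hx, hy, fun w hw => hA ▸ (hfound w hw).2⟩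
  · have h1 : 1 ≤ n + 1 := Nat.le_add_left _ _
    have h2 : n + 1 ≤ (n + 1) * (n + 1) := Nat.le_mul_of_pos_left _ (Nat.succ_pos n)
    have hB : B = 2 + ((2 * curveCost + 7) * ((n + 1) * (n + 1)) * (L + 1) +
        12 * ((n + 1) * (n + 1)) + 8 * (n + 1)) := by
      simp only [B]
      ring
    rw [hB]
    have hO : optimizeCost =
      4 * intervalCost + 2 * sortCost + A + 2 * curveCost + 200 := rfl
    rw [hO]
    clear_value A
    generalize (n + 1) * (n + 1) = N at h2 ⊢
    generalize curveCost = K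
    generalize sortCost = S
    generalize intervalCost = J
    generalize n + 1 = m at h1 h2 ⊢
    have h3 : m * J ≤ N * J := Nat.mul_le_mul_right _ h2
    have h4 : A ≤ N * A := Nat.le_mul_of_pos_left _ (h1.trans h2)
    have h5 : (4 * J + 2 * S + A + 193) * N ≤ (4 * J + 2 * S + A + 193) * N * (L + 1) :=
      Nat.le_mul_of_pos_right _ (Nat.succ_pos L)
    nlinarith

/-- The comparison `4 + 144 n² ≤ 2⁸ (n + 1)² ≤ (n + 1)¹⁰` absorbs the constants into the exponent.
The factor 20 is a rounded-up `10 / log 2`. -/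
theorem natLog_le {n : ℕ} (hn : 1 ≤ n) :
    (Nat.log 2 (4 + 144 * (n * n)) : ℝ) ≤ 20 * Real.log (n + 1) := by
  have hle : 4 + 144 * (n * n) ≤ (n + 1) ^ 10 := by
    have h1 : 2 ^ 8 ≤ (n + 1) ^ 8 := Nat.pow_le_pow_left (by omega) 8
    have h2 : (n + 1) ^ 10 = (n + 1) ^ 8 * ((n + 1) * (n + 1)) := by ring
    rw [h2]
    refine le_trans ?_ (Nat.mul_le_mul_right _ h1)
    nlinarith
  have hpos : (0 : ℝ) < ((4 + 144 * (n * n) : ℕ) : ℝ) := by positivity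
  have hlog : Real.log ((4 + 144 * (n * n) : ℕ) : ℝ) ≤ 10 * Real.log (n + 1) := by
    have := Real.log_le_log hpos (Nat.cast_le.2 hle)
    rwa [Nat.cast_pow, Real.log_pow, Nat.cast_add n, Nat.cast_one, Nat.cast_ofNat] at this
  have h2 := Real.natLog_le_logb (4 + 144 * (n * n)) 2
  rw [Real.logb, le_div_iff₀ (by simpa using Real.log_pos one_lt_two)] at h2
  have h3 := Real.log_two_gt_d9
  have h4 : (0 : ℝ) ≤ Nat.log 2 (4 + 144 * (n * n)) := Nat.cast_nonneg _
  rw [Nat.cast_ofNat] at h2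
  nlinarith

theorem exists_cost_bound (K c : ℕ) : ∃ C : ℝ, ∀ n : ℕ, 1 ≤ n →
    ((K * ((n + 1) * (n + 1)) * (c * Nat.log 2 (4 + 144 * (n * n)) + 1) : ℕ) : ℝ) ≤
      C * (n : ℝ) ^ 2 * Real.log ((n : ℝ) + 1) := by
  -- The 4 comes from `n + 1 ≤ 2 n`, the 20 from `natLog_le`, and the 2 from `1 ≤ 2 log (n + 1)`,
  -- which absorbs the summand 1. The last estimate relies on the logarithm being that of `n + 1`,
  -- so that it does not vanish at `n = 1`.
  refine ⟨K * 4 * (20 * c + 2), fun n hn => ?_⟩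
  have hn' : (1 : ℝ) ≤ n := Nat.one_le_cast.2 hn
  have h1 : ((n : ℝ) + 1) * (n + 1) ≤ 4 * n ^ 2 := by nlinarith
  have hlog : 1 ≤ 2 * Real.log ((n : ℝ) + 1) := by
    have h2 := Real.log_two_gt_d9
    have h3 := Real.log_le_log two_pos (show (2 : ℝ) ≤ n + 1 by linarith)
    linarith
  have h2 : (c * Nat.log 2 (4 + 144 * (n * n)) + 1 : ℝ) ≤
      (20 * c + 2) * Real.log ((n : ℝ) + 1) := by
    have := mul_le_mul_of_nonneg_left (natLog_le hn) (Nat.cast_nonneg (α := ℝ) c)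
    linarith
  push_cast
  calc (K : ℝ) * ((n + 1) * (n + 1)) * (c * Nat.log 2 (4 + 144 * (n * n)) + 1)
      ≤ K * (4 * n ^ 2) * ((20 * c + 2) * Real.log ((n : ℝ) + 1)) := by gcongr
    _ = K * 4 * (20 * c + 2) * n ^ 2 * Real.log ((n : ℝ) + 1) := by ring

end DiscReconfig

theorem mainTheorem3 :
    (∃ P : DiscReconfig.Cmd, ∀ c : ℕ, ∃ C : ℝ, ∀ (n : ℕ), 1 ≤ n →
      ∀ (I : DiscReconfig.Inst n) (σ : DiscReconfig.State), DiscReconfig.InputOK c I σ →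
        ∃ (k : ℕ) (σ' : DiscReconfig.State), DiscReconfig.Exec P σ k σ' ∧
          (k : ℝ) ≤ C * (n : ℝ) ^ 2 * Real.log ((n : ℝ) + 1) ∧ DiscReconfig.OutputOK I σ') ∧
    (∀ (n : ℕ), 1 ≤ n → ∀ I : DiscReconfig.Inst n,
      (∃ α β : Fin 3 → ℝ, ∀ i j : Fin 3, ∀ v ∈ I.region i j,
        I.area v = ((![-1, 0, 1] : Fin 3 → ℝ) i * v 0 + α i) *
          ((![-1, 0, 1] : Fin 3 → ℝ) j * v 1 + β j)) ∧
      (∀ v : DiscReconfig.Plane, IsLocalMin I.area v ↔ v ∈ I.R₀) ∧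
      (∀ v ∈ I.R₀, ∀ w : DiscReconfig.Plane, I.area v ≤ I.area w)) := by
  refine ⟨⟨DiscReconfig.optimizeCmd, fun c => ?_⟩, fun n hn I => ⟨⟨I.offs 0, I.offs 1,
    fun i j v hv => I.area_region hn i j hv⟩, fun v => I.isLocalMin_iff hn v,
    fun v hv w => I.area_le_of_mem_R₀ hn hv w⟩⟩
  obtain ⟨C, hC⟩ := DiscReconfig.exists_cost_bound DiscReconfig.optimizeCost c
  refine ⟨C, fun n hn I σ hI => ?_⟩
  obtain ⟨k, σ', he, hk, ho⟩ := DiscReconfig.optimizeCmd_spec hn hI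
  exact ⟨k, σ', he, (Nat.cast_le.2 hk).trans (hC n hn), ho⟩
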